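/- A square is a closed unit square $[x,x+1]\times[y,y+1]$ with $(x,y)\in\mathbb Z^2$ (white if $x+y$ is even, black if $x+y$ is odd), a cube is a closed unit cube of $\mathbb R^3$ with vertices in $\mathbb Z^3$, a dimer is the union of two cubes that share a face, and a tiling of a finite union of cubes is a covering of it by dimers no two of which have a common cube. The $z$ axis points downwards. A flip on a tiling removes two parallel dimers that form a $2\times2\times1$ slab and places them back in the only other possible position; two tilings lie in the same flip connected component if one can be reached from the other by a finite sequence of flips. Let $D\subset\mathbb R^2$ be a finite union of squares that is connected and simply connected, and let $R=D\times[0,2]$ be the corresponding duplex region, with top floor $D\times[0,1]$ and bottom floor $D\times[1,2]$. For a tiling $t$ of $R$, the jewels are the squares of $D$ occupied by dimers parallel to the $z$ axis. Project the other dimers to $D$ and regard each as the segment joining the centers of its two squares, the ones of the bottom floor being oriented from black to white and the ones of the top floor from white to black; this gives disjoint oriented cycles (possibly of length two) that pass through exactly the squares that are not jewels. For a jewel $j$ let $k_t(j)\in\mathbb Z$ be the sum of the winding numbers of all these cycles with respect to the center of $j$ (counterclockwise counts as positive, with the $y$ axis drawn downwards), and let $$P_t(q)=\sum_{j\text{ black}}q^{k_t(j)}-\sum_{j\text{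 white}}q^{k_t(j)}\in\mathbb Z[q,q^{-1}].$$ If $B=Q\times[0,4]$ is a box with four floors, where $Q\supseteq D$ is a rectangle with integer vertices and sides parallel to the axes, so that $R$ is contained in the top two floors of $B$, then the embedding $\hat t$ of $t$ in $B$ is the tiling of $B$ that consists of the dimers of $t$, of dimers parallel to the $z$ axis filling $(Q\setminus D)\times[0,2]$, and of dimers parallel to the $z$ axis filling $Q\times[2,4]$. Proposition. If $t_0$ and $t_1$ are two tilings of the duplex region $R$ with $P_{t_0}'(1)=P_{t_1}'(1)$, then there exists a box $B$ with four floors, containing $R$ in its top two floors, such that the embeddings $\hat t_0$ and $\hat t_1$ of $t_0$ and $t_1$ in $B$ lie in the same flip connected component of the tilings of $B$. -/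

import Mathlib

open scoped LaurentPolynomial

namespace DominoBrick

/-- The pair `(x, y)` stands for the closed unit square `[x, x + 1] × [y, y + 1]` of the plane. -/
abbrev Square : Type := ℤ × ℤ

/-- The pair `((x, y), z)` stands for the closed unit cube
`[x, x + 1] × [y, y + 1] × [z, z + 1]`. The `z` axis points downwards, so that floors with a
smaller `z` lie higher. -/
abbrev Cube : Type := Square × ℤ

/-- A square is white if the sum of its coordinates is even, and black otherwise. -/
def IsWhite (v : Square) : Prop := Even (v.1 + v.2)

instance : DecidablePred IsWhite := fun v => inferInstanceAs (Decidable (Even (v.1 + v.2)))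

/-- The subset of the plane covered by a finite set of unit squares. -/
def planeRegion (D : Finset Square) : Set (ℝ × ℝ) :=
  ⋃ v ∈ D, Set.Icc (v.1 : ℝ) (v.1 + 1) ×ˢ Set.Icc (v.2 : ℝ) (v.2 + 1)

/-- The cubes over the squares of `D` in the floors `m, m + 1, …, n - 1`. -/
noncomputable def floors (D : Finset Square) (m n : ℤ) : Finset Cube := D ×ˢ Finset.Ico m n

/-- The two-story region `D × [0, 2]`, whose two floors are identical. -/
noncomputable abbrev duplex (D : Finset Square) : Finset Cube := floors D 0 2

/-- The squares contained in the rectangle `[a, b] × [c, d]`. -/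
noncomputable def rectangle (a b c d : ℤ) : Finset Square := Finset.Ico a b ×ˢ Finset.Ico c d

/-! ### Dimers, tilings and flips -/

/-- The three unit vectors parallel to the coordinate axes. -/
def axes : Finset Cube := {((1, 0), 0), ((0, 1), 0), ((0, 0), 1)}

/-- A dimer consists of two cubes that share a face. -/
def IsDimer (d : Finset Cube) : Prop := ∃ c : Cube, ∃ u ∈ axes, d = {c, c + u}

/-- A tiling of a region by pairwise disjoint dimers. -/
@[ext]
structure Tiling (R : Finset Cube) where
  /-- the dimers of the tiling -/
  dimers : Finset (Finset Cube)
  isDimer : ∀ d ∈ dimers, IsDimer d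
  disjoint : (dimers : Set (Finset Cube)).PairwiseDisjoint id
  cover : dimers.biUnion id = R

/-- `t₁` arises from `t₀` by one flip: two parallel dimers of `t₀` that form a `2 × 2 × 1` slab
(with corner `c` and edge directions `u ≠ v`) are removed and placed back in the other position. -/
def Flip {R : Finset Cube} (t₀ t₁ : Tiling R) : Prop :=
  ∃ c : Cube, ∃ u ∈ axes, ∃ v ∈ axes, u ≠ v ∧
    {c, c + u} ∈ t₀.dimers ∧ {c + v, c + u + v} ∈ t₀.dimers ∧
    t₁.dimers = (t₀.dimers \ {{c, c + u}, {c + v, c + u + v}}) ∪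
      {{c, c + v}, {c + u, c + u + v}}

/-- `t₁` lies in the flip connected component of `t₀`: it can be reached from `t₀` by a finite
sequence of flips. -/
def FlipConnected {R : Finset Cube} (t₀ t₁ : Tiling R) : Prop := Relation.ReflTransGen Flip t₀ t₁

/-! ### Embedding a tiling of a duplex region in larger regions -/

/-- Tilings of two disjoint regions give a tiling of their union `U`. -/
def Tiling.union {R S U : Finset Cube} (t : Tiling R) (s : Tiling S) (hd : Disjoint R S)
    (hU : R ∪ S = U) : Tiling U where
  dimers := t.dimers ∪ s.dimers
  isDimer d hm := (Finset.mem_union.1 hm).elim (t.isDimer d) (s.isDimer d)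
  disjoint := by
    have key : ∀ d ∈ t.dimers, ∀ e ∈ s.dimers, Disjoint d e := fun d hdt e hes =>
      hd.mono (t.cover ▸ Finset.subset_biUnion_of_mem id hdt)
        (s.cover ▸ Finset.subset_biUnion_of_mem id hes)
    intro d hm e he hne
    rcases Finset.mem_union.1 (Finset.mem_coe.1 hm) with h1 | h1 <;>
      rcases Finset.mem_union.1 (Finset.mem_coe.1 he) with h2 | h2
    · exact t.disjoint h1 h2 hne
    · exact key d h1 e h2
    · exact (key e h2 d h1).symm
    · exact s.disjoint h1 h2 hne
  cover := by rw [Finset.union_biUnion, t.cover, s.cover, hU]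

/-- The tiling of `Q × [m, m + 2]` that consists of `z` dimers only. -/
noncomputable def columns (Q : Finset Square) (m : ℤ) : Tiling (floors Q m (m + 2)) where
  dimers := Q.image fun v => {(v, m), (v, m + 1)}
  isDimer d hm := by
    obtain ⟨v, -, rfl⟩ := Finset.mem_image.1 hm
    exact ⟨(v, m), ((0, 0), 1), by simp [axes], by
      rw [show (v, m) + (((0, 0), 1) : Cube) = (v, m + 1) by ext <;> simp]⟩
  disjoint := by
    intro d hm e he hne
    obtain ⟨v, -, rfl⟩ := Finset.mem_image.1 (Finset.mem_coe.1 hm)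
    obtain ⟨w, -, rfl⟩ := Finset.mem_image.1 (Finset.mem_coe.1 he)
    have hvw : v ≠ w := fun h => hne (by rw [h])
    simp [Function.onFun, hvw.symm]
  cover := by
    ext ⟨v, z⟩
    simp only [Finset.mem_biUnion, Finset.mem_image, id, floors, Finset.mem_product,
      Finset.mem_Ico]
    constructor
    · rintro ⟨d, ⟨w, hw, rfl⟩, hz⟩
      simp only [Finset.mem_insert, Finset.mem_singleton, Prod.mk.injEq] at hz
      rcases hz with ⟨rfl, rfl⟩ | ⟨rfl, rfl⟩ <;> exact ⟨hw, by omega, by omega⟩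
    · rintro ⟨hv, h1, h2⟩
      refine ⟨_, ⟨v, hv, rfl⟩, ?_⟩
      simp only [Finset.mem_insert, Finset.mem_singleton, Prod.mk.injEq, true_and]
      omega

/-- The embedding in `Q × [0, 2]` of a tiling of the duplex region `D × [0, 2]`, where `D ⊆ Q`:
the complement is filled with `z` dimers. -/
noncomputable def Tiling.embedTwo {D Q : Finset Square} (h : D ⊆ Q) (t : Tiling (duplex D)) :
    Tiling (floors Q 0 2) :=
  t.union (columns (Q \ D) 0)
    (by
      rw [Finset.disjoint_left]
      rintro ⟨v, z⟩ h1 h2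
      simp only [floors, Finset.mem_product, Finset.mem_sdiff] at h1 h2
      exact h2.1.2 h1.1)
    (by
      ext ⟨v, z⟩
      simp only [floors, Finset.mem_union, Finset.mem_product, Finset.mem_sdiff, zero_add]
      have := @h v
      tauto)

/-- The embedding in the four floors `Q × [0, 4]` of a tiling of the duplex region `D × [0, 2]`:
the tiling is embedded in the top two floors, and the bottom two are filled with `z` dimers. -/
noncomputable def Tiling.embedFour {D Q : Finset Square} (h : D ⊆ Q) (t : Tiling (duplex D)) :
    Tiling (floors Q 0 4) :=
  (t.embedTwo h).union (columns Q 2)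
    (by
      rw [Finset.disjoint_left]
      rintro ⟨v, z⟩ h1 h2
      simp only [floors, Finset.mem_product, Finset.mem_Ico] at h1 h2
      omega)
    (by
      ext ⟨v, z⟩
      simp only [floors, Finset.mem_union, Finset.mem_product, Finset.mem_Ico]
      by_cases hv : v ∈ Q <;> simp only [hv, true_and, false_and, or_self]
      omega)

/-! ### The polynomial invariant of a tiling of a duplex region -/

/-- The jewels of `t`: the squares that lie in `z` dimers. -/
def Tiling.jewels {D : Finset Square} (t : Tiling (duplex D)) : Finset Square :=
  D.filter fun v => {(v, 0), (v, 1)} ∈ t.dimers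

/-- The oriented edges `(v, w)` of the associated drawing of `t`. They join the two squares of each
dimer that is not a `z` dimer; dimers of the bottom floor `z = 1` are oriented from black to white
and those of the top floor `z = 0` from white to black. These edges form disjoint oriented cycles
through all squares of `D` that are not jewels (cycles of length two are allowed). -/
def Tiling.drawing {D : Finset Square} (t : Tiling (duplex D)) : Finset (Square × Square) :=
  (D ×ˢ D).filter fun e =>
    if IsWhite e.1 then {(e.1, 0), (e.2, 0)} ∈ t.dimers else {(e.1, 1), (e.2, 1)} ∈ t.dimers

/-- The signed crossing of the oriented edge `e`, which joins the centers of two adjacent squares,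
with the ray that leaves the center of `j`, displaced by half a unit in the `y` direction, in the
positive `x` direction. With the `y` axis drawn downwards, upward crossings count `1` and downward
crossings count `-1`. -/
def crossing (j : Square) (e : Square × Square) : ℤ :=
  if j.1 < e.1.1 ∧ e.1.1 = e.2.1 then
    if e.1.2 = j.2 + 1 ∧ e.2.2 = j.2 then 1
    else if e.1.2 = j.2 ∧ e.2.2 = j.2 + 1 then -1
    else 0
  else 0

/-- `k_t(j)`: the sum of the winding numbers of all the cycles of the drawing with respect to the
jewel `j`, that is, the total number of signed crossings of the cycles with a ray from `j`.
(Cycles do not pass through the center of a jewel, so the displacement of the ray in `crossing`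
does not change the winding numbers.) -/
def Tiling.winding {D : Finset Square} (t : Tiling (duplex D)) (j : Square) : ℤ :=
  ∑ e ∈ t.drawing, crossing j e

/-- The invariant `P_t(q)`, a Laurent polynomial with integer coefficients: the sum of
`q ^ k_t(j)` over the black jewels `j` minus that over the white jewels. -/
noncomputable def Tiling.invariant {D : Finset Square} (t : Tiling (duplex D)) : ℤ[T;T⁻¹] :=
  (∑ j ∈ t.jewels.filter (fun v => ¬ IsWhite v), LaurentPolynomial.T (t.winding j)) -
    ∑ j ∈ t.jewels.filter (fun v => IsWhite v), LaurentPolynomial.T (t.winding j)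

/-- The derivative of a Laurent polynomial. -/
noncomputable def derivative (P : ℤ[T;T⁻¹]) : ℤ[T;T⁻¹] :=
  P.coeff.sum fun n a => LaurentPolynomial.C (a * n) * LaurentPolynomial.T (n - 1)

/-- The value of a Laurent polynomial at `q = 1`. -/
noncomputable def evalOne (P : ℤ[T;T⁻¹]) : ℤ := LaurentPolynomial.eval₂ (RingHom.id ℤ) 1 P

/-- The twist `P_t'(1)` of a tiling of a duplex region. -/
noncomputable def Tiling.twist {D : Finset Square} (t : Tiling (duplex D)) : ℤ :=
  evalOne (derivative t.invariant)

end DominoBrick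

/-! Both embedded tilings are brought by flips to one canonical tiling that depends only on the
twist. A tiling of a duplex region is a permutation of the squares (`Tiling.next`) that fixes the
jewels and moves every other square along its oriented cycle. Its winding numbers form an integer
height function on the faces of the dual grid (`flowHeight`), whose level lines are the cycles.
Cycles of length two leave no trace in the heights; flips turn them into pairs of columns
(`IsFlow.reach_hlay`). Simple connectivity makes the heights vanish at squares outside `D`
(`IsFlow.flowHeight_eq_zero`), so the columns added by the embedding contribute nothing to the
twist.

The spare floors serve as a workshop. If `S` is the set of faces of height at least `1` (or, with
signs reversed, at most `-1`), the strands that bound `S` can be lowered by two floors (`transfer`),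
where nothing else is in their way. There `S` is dismantled face by face, starting in its lowest row
(`exists_erase`). A removal is a few flips unless a strand has to cross a jewel. In that case the
crossing leaves behind a ring, a cycle of length eight around a single jewel of the same color as
the crossed one (`trit_reach`).

Rings behave like charges: a ring of sign `s` around a square `v` carries `s * sgn v`. It can travel
through a field of columns (`ring_move`), a negative ring becomes a positive one around a
neighboring square with the help of columns two floors above (`ring_convert`), and two positive
rings around squares of opposite colors cancel (`ring_cancel`). So each ring can be driven to a
parking lot away from `D` and merged with those already there, and only the total charge is
remembered (`park`, `reduce_faces`).

Induction on the total absolute height (`reduce_height`) empties the upper floors and leaves in the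
lower floors the parked configuration of charge `heightTwist`. For the height function of a tiling
this charge is the twist (`Tiling.heightTwist_eq_twist`). As flips are reversible, equal twists give
flip connected embeddings. Throughout, configurations are multisets of dimers, which can be added
without regard to disjointness; `flip_of_slabMove` shows that moves starting at a genuine tiling
stay among genuine tilings. -/

namespace DominoBrick

/-! ### Moves on multisets of dimers -/

/-- Two cubes that share a face. -/
def Adj (a b : Cube) : Prop := ∃ u ∈ axes, b = a + u ∨ a = b + u

theorem Adj.symm {a b : Cube} : Adj a b → Adj b a := fun ⟨u, hu, h⟩ => ⟨u, hu, h.symm⟩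

theorem Adj.ne {a b : Cube} (h : Adj a b) : a ≠ b := by
  obtain ⟨u, hu, h⟩ := h
  rintro rfl
  have : u = 0 := by simpa using h
  subst this
  revert hu
  decide

theorem Adj.isDimer {a b : Cube} (h : Adj a b) : IsDimer {a, b} := by
  obtain ⟨u, hu, rfl | rfl⟩ := h
  · exact ⟨a, u, hu, rfl⟩
  · exact ⟨b, u, hu, Finset.pair_comm _ _⟩

/-- Two parallel dimers in a slab with cyclically ordered cubes `a b c d` are replaced. -/
def SlabMove (X Y : Multiset (Finset Cube)) : Prop :=
  ∃ (a b c d : Cube) (C : Multiset (Finset Cube)), Adj a b ∧ Adj b c ∧ Adj c d ∧ Adj d a ∧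
    a ≠ c ∧ b ≠ d ∧ X = {a, b} ::ₘ {c, d} ::ₘ C ∧ Y = {b, c} ::ₘ {d, a} ::ₘ C

/-- `Y` can be reached from `X` by slab moves. -/
def Reach (X Y : Multiset (Finset Cube)) : Prop := Relation.ReflTransGen SlabMove X Y

theorem SlabMove.symm {X Y : Multiset (Finset Cube)} (h : SlabMove X Y) : SlabMove Y X := by
  obtain ⟨a, b, c, d, C, h1, h2, h3, h4, hac, hbd, rfl, rfl⟩ := h
  exact ⟨b, c, d, a, C, h2, h3, h4, h1, hbd, hac.symm, rfl, by
    rw [Multiset.cons_swap]⟩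

theorem Reach.refl (X : Multiset (Finset Cube)) : Reach X X := Relation.ReflTransGen.refl

theorem Reach.trans {X Y Z : Multiset (Finset Cube)} (h : Reach X Y) (h' : Reach Y Z) :
    Reach X Z := Relation.ReflTransGen.trans h h'

theorem Reach.symm {X Y : Multiset (Finset Cube)} (h : Reach X Y) : Reach Y X := by
  induction h with
  | refl => exact Reach.refl _
  | tail _ h ih => exact Relation.ReflTransGen.head h.symm ih

theorem Reach.add_right {X Y : Multiset (Finset Cube)} (h : Reach X Y)
    (C : Multiset (Finset Cube)) : Reach (X + C) (Y + C) := by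
  induction h with
  | refl => exact Reach.refl _
  | tail _ h ih =>
    refine ih.trans (Relation.ReflTransGen.single ?_)
    obtain ⟨a, b, c, d, E, h1, h2, h3, h4, hac, hbd, rfl, rfl⟩ := h
    exact ⟨a, b, c, d, E + C, h1, h2, h3, h4, hac, hbd, by simp, by simp⟩

theorem Reach.add_left {X Y : Multiset (Finset Cube)} (h : Reach X Y)
    (C : Multiset (Finset Cube)) : Reach (C + X) (C + Y) := by
  rw [add_comm C, add_comm C]; exact h.add_right C

theorem Reach.add {X Y X' Y' : Multiset (Finset Cube)} (h : Reach X Y) (h' : Reach X' Y') :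
    Reach (X + X') (Y + Y') := (h.add_right _).trans (h'.add_left _)

/-- Used for translations, possibly with the two floors exchanged, and for the reflection that
reverses all strands. -/
theorem Reach.map {X Y : Multiset (Finset Cube)} (h : Reach X Y) (f : Cube → Cube)
    (hf : Function.Injective f) (hadj : ∀ a b, Adj a b → Adj (f a) (f b)) :
    Reach (X.map (Finset.image f)) (Y.map (Finset.image f)) := by
  induction h with
  | refl => exact Reach.refl _
  | tail _ h ih =>
    refine ih.trans (Relation.ReflTransGen.single ?_)
    obtain ⟨a, b, c, d, E, h1, h2, h3, h4, hac, hbd, rfl, rfl⟩ := h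
    exact ⟨f a, f b, f c, f d, E.map (Finset.image f), hadj _ _ h1, hadj _ _ h2, hadj _ _ h3,
      hadj _ _ h4, hf.ne hac, hf.ne hbd, by simp, by simp⟩

/-! ### From cyclic slab moves on multisets to flips of tilings -/

/-- The six unit vectors. -/
def dirs : Finset Cube := axes ∪ axes.image Neg.neg

theorem Adj.exists_dir {a b : Cube} (h : Adj a b) : ∃ s ∈ dirs, b = a + s := by
  obtain ⟨u, hu, rfl | rfl⟩ := h
  · exact ⟨u, Finset.mem_union_left _ hu, rfl⟩
  · exact ⟨-u, Finset.mem_union_right _ (Finset.mem_image_of_mem _ hu), by simp⟩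

-- A closed walk of four unit steps whose opposite vertices are distinct runs around a unit square:
-- there are only finitely many walks to inspect.
set_option synthInstance.maxHeartbeats 200000 in
set_option synthInstance.maxSize 1000 in
theorem dirs_square : ∀ s ∈ dirs, ∀ t ∈ dirs, ∀ s' ∈ dirs, ∀ t' ∈ dirs, s + t + s' + t' = 0 →
    s + t ≠ 0 → t + s' ≠ 0 → s' = -s ∧ ∃ u ∈ axes, ∃ v ∈ axes, u ≠ v ∧ (s = u ∨ s = -u) ∧
      (t = v ∨ t = -v) := by
  decide +kernel

/-- A slab move names the cubes in cyclic order from any corner, whereas `Flip` wants the corner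
with the smallest coordinates. The four cases are the possible signs of the first two steps. -/
theorem exists_slab {a b c d : Cube} (h1 : Adj a b) (h2 : Adj b c) (h3 : Adj c d) (h4 : Adj d a)
    (hac : a ≠ c) (hbd : b ≠ d) :
    ∃ x, ∃ u ∈ axes, ∃ v ∈ axes, u ≠ v ∧
      (({{a, b}, {c, d}} : Finset (Finset Cube)) = {{x, x + u}, {x + v, x + u + v}}) ∧
      (({{b, c}, {d, a}} : Finset (Finset Cube)) = {{x, x + v}, {x + u, x + u + v}}) := by
  obtain ⟨s, hs, rfl⟩ := h1.exists_dir
  obtain ⟨t, ht, rfl⟩ := h2.exists_dir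
  obtain ⟨s', hs', rfl⟩ := h3.exists_dir
  obtain ⟨t', ht', h⟩ := h4.exists_dir
  obtain ⟨rfl, u, hu, v, hv, huv, hsu, htv⟩ := dirs_square s hs t ht s' hs' t' ht'
    (by simpa [add_assoc] using h.symm) (fun h0 => hac (by rw [add_assoc, h0, add_zero]))
    (fun h0 => hbd (by rw [add_assoc (a + s), h0, add_zero]))
  rcases hsu with rfl | rfl <;> rcases htv with rfl | rfl
  · have e1 : a + s + t + -s = a + t := by abel
    refine ⟨a, s, hu, t, hv, huv, ?_, ?_⟩
    · rw [e1, Finset.pair_comm (a + s + t)]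
    · rw [e1, Finset.pair_comm (a + t) a, Finset.pair_comm {a + s, a + s + t}]
  · obtain ⟨x, rfl⟩ : ∃ x, a = x + v := ⟨a - v, by simp⟩
    have e1 : x + v + s + -v = x + s := by abel
    have e2 : x + s + -s = x := by abel
    refine ⟨x, s, hu, v, hv, huv, ?_, ?_⟩
    · rw [e1, e2, add_right_comm x v s, Finset.pair_comm {x + v, x + s + v},
        Finset.pair_comm (x + s) x]
    · rw [e1, e2, add_right_comm x v s, Finset.pair_comm {x + s + v, x + s},
        Finset.pair_comm (x + s + v)]
  · obtain ⟨x, rfl⟩ : ∃ x, a = x + u := ⟨a - u, by simp⟩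
    have e1 : x + u + -u = x := by abel
    have e2 : x + t + - -u = x + u + t := by rw [neg_neg]; abel
    refine ⟨x, u, hu, t, hv, huv, ?_, ?_⟩
    · rw [e1, e2, Finset.pair_comm (x + u)]
    · rw [e1, e2, Finset.pair_comm (x + u + t)]
  · obtain ⟨x, rfl⟩ : ∃ x, a = x + u + v := ⟨a - v - u, by simp⟩
    have e1 : x + u + v + -u = x + v := by abel
    have e2 : x + v + -v = x := by abel
    have e3 : x + - -u = x + u := by rw [neg_neg]
    refine ⟨x, u, hu, v, hv, huv, ?_, ?_⟩
    · rw [e1, e2, e3, Finset.pair_comm {x + u + v, x + v}, Finset.pair_comm (x + u + v)]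
    · rw [e1, e2, e3, Finset.pair_comm (x + v) x]

/-- The two new dimers cover exactly the four cubes of the two old ones, and these cubes meet no
other dimer of `t`. Hence absence of repetitions, disjointness and covering are inherited, and
multiset moves from a tiling are flips. -/
theorem flip_of_slabMove {R : Finset Cube} (t : Tiling R) {Y : Multiset (Finset Cube)}
    (h : SlabMove t.dimers.val Y) : ∃ t' : Tiling R, t'.dimers.val = Y ∧ Flip t t' := by
  obtain ⟨a, b, c, d, C, h1, h2, h3, h4, hac, hbd, hX, rfl⟩ := h
  have hnd := t.dimers.nodup
  rw [hX, Multiset.nodup_cons, Multiset.nodup_cons, Multiset.mem_cons, not_or] at hnd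
  obtain ⟨⟨hne, ha⟩, hc, hC⟩ := hnd
  have hm : ∀ e, e ∈ t.dimers ↔ e = {a, b} ∨ e = {c, d} ∨ e ∈ C := fun e => by
    rw [← Finset.mem_val, hX]; simp
  have dis : ∀ e ∈ C, ∀ x ∈ e, x ≠ a ∧ x ≠ b ∧ x ≠ c ∧ x ≠ d := by
    intro e he x hx
    have e1 := t.disjoint (Finset.mem_coe.2 ((hm _).2 (Or.inr (Or.inr he))))
      (Finset.mem_coe.2 ((hm _).2 (Or.inl rfl))) (fun h => ha (h ▸ he))
    have e2 := t.disjoint (Finset.mem_coe.2 ((hm _).2 (Or.inr (Or.inr he))))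
      (Finset.mem_coe.2 ((hm _).2 (Or.inr (Or.inl rfl)))) (fun h => hc (h ▸ he))
    have e1' := Finset.disjoint_left.1 e1 hx
    have e2' := Finset.disjoint_left.1 e2 hx
    simp only [id, Finset.mem_insert, Finset.mem_singleton, not_or] at e1' e2'
    exact ⟨e1'.1, e1'.2, e2'.1, e2'.2⟩
  have hb' : ({b, c} : Finset Cube) ∉ C := fun h => (dis _ h b (by simp)).2.1 rfl
  have hd' : ({d, a} : Finset Cube) ∉ C := fun h => (dis _ h a (by simp)).1 rfl
  have hne' : ({b, c} : Finset Cube) ≠ {d, a} := fun h => by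
    have : b ∈ ({d, a} : Finset Cube) := h ▸ Finset.mem_insert_self _ _
    simp [hbd, h1.ne.symm] at this
  have hmY : ∀ e, e ∈ ({b, c} ::ₘ {d, a} ::ₘ C : Multiset (Finset Cube)) ↔
      e = {b, c} ∨ e = {d, a} ∨ e ∈ C := fun e => by simp
  refine ⟨⟨⟨{b, c} ::ₘ {d, a} ::ₘ C, ?_⟩, ?_, ?_, ?_⟩, rfl, ?_⟩
  · simp [hb', hd', hC, hne']
  · intro e he
    rcases (hmY e).1 he with rfl | rfl | he
    · exact h2.isDimer
    · exact h4.isDimer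
    · exact t.isDimer e ((hm e).2 (Or.inr (Or.inr he)))
  · have k1 : Disjoint ({b, c} : Finset Cube) {d, a} := by
      simp [hbd.symm, h1.ne, h3.ne.symm, hac]
    have k2 : ∀ e ∈ C, Disjoint ({b, c} : Finset Cube) e := fun e he => by
      rw [Finset.disjoint_right]
      intro x hx
      simp [(dis e he x hx).2.1, (dis e he x hx).2.2.1]
    have k3 : ∀ e ∈ C, Disjoint ({d, a} : Finset Cube) e := fun e he => by
      rw [Finset.disjoint_right]
      intro x hx
      simp [(dis e he x hx).1, (dis e he x hx).2.2.2]
    intro e he e' he' hee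
    rcases (hmY e).1 he with rfl | rfl | he <;> rcases (hmY e').1 he' with rfl | rfl | he'
    · exact absurd rfl hee
    · exact k1
    · exact k2 _ he'
    · exact k1.symm
    · exact absurd rfl hee
    · exact k3 _ he'
    · exact (k2 _ he).symm
    · exact (k3 _ he).symm
    · exact t.disjoint (Finset.mem_coe.2 ((hm e).2 (Or.inr (Or.inr he))))
        (Finset.mem_coe.2 ((hm e').2 (Or.inr (Or.inr he')))) hee
  · rw [← t.cover]
    ext x
    simp only [Finset.mem_biUnion, id]
    constructor
    · rintro ⟨e, he, hx⟩
      rcases (hmY e).1 he with rfl | rfl | he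
      · rcases Finset.mem_insert.1 hx with rfl | hx
        · exact ⟨_, (hm _).2 (Or.inl rfl), by simp⟩
        · exact ⟨_, (hm _).2 (Or.inr (Or.inl rfl)), by simp_all⟩
      · rcases Finset.mem_insert.1 hx with rfl | hx
        · exact ⟨_, (hm _).2 (Or.inr (Or.inl rfl)), by simp⟩
        · exact ⟨_, (hm _).2 (Or.inl rfl), by simp_all⟩
      · exact ⟨e, (hm e).2 (Or.inr (Or.inr he)), hx⟩
    · rintro ⟨e, he, hx⟩
      rcases (hm e).1 he with rfl | rfl | he
      · rcases Finset.mem_insert.1 hx with rfl | hx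
        · exact ⟨_, (hmY _).2 (Or.inr (Or.inl rfl)), by simp⟩
        · exact ⟨_, (hmY _).2 (Or.inl rfl), by simp_all⟩
      · rcases Finset.mem_insert.1 hx with rfl | hx
        · exact ⟨_, (hmY _).2 (Or.inl rfl), by simp⟩
        · exact ⟨_, (hmY _).2 (Or.inr (Or.inl rfl)), by simp_all⟩
      · exact ⟨e, (hmY e).2 (Or.inr (Or.inr he)), hx⟩
  · obtain ⟨x, u, hu, v, hv, huv, e1, e2⟩ := exists_slab h1 h2 h3 h4 hac hbd
    have hsub : ∀ e ∈ ({{x, x + u}, {x + v, x + u + v}} : Finset (Finset Cube)),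
        e ∈ t.dimers := by
      rw [← e1]
      intro e he
      rw [hm]
      simp only [Finset.mem_insert, Finset.mem_singleton] at he
      tauto
    refine ⟨x, u, hu, v, hv, huv, hsub _ (by simp), hsub _ (by simp), ?_⟩
    rw [← e1, ← e2]
    ext e
    rw [← Finset.mem_val]
    simp only [hmY, Finset.mem_union, Finset.mem_sdiff, hm, Finset.mem_insert,
      Finset.mem_singleton]
    constructor
    · rintro (h | h | h)
      · exact Or.inr (Or.inl h)
      · exact Or.inr (Or.inr h)
      · refine Or.inl ⟨Or.inr (Or.inr h), ?_⟩
        rintro (rfl | rfl)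
        exacts [ha h, hc h]
    · tauto

theorem exists_flipConnected {R : Finset Cube} (t : Tiling R) {Y : Multiset (Finset Cube)}
    (h : Reach t.dimers.val Y) : ∃ t' : Tiling R, t'.dimers.val = Y ∧ FlipConnected t t' := by
  induction h with
  | refl => exact ⟨t, rfl, Relation.ReflTransGen.refl⟩
  | tail _ h ih =>
    obtain ⟨t', rfl, ht⟩ := ih
    obtain ⟨t'', h1, h2⟩ := flip_of_slabMove t' h
    exact ⟨t'', h1, ht.tail h2⟩

theorem flipConnected_of_reach {R : Finset Cube} {t t' : Tiling R}
    (h : Reach t.dimers.val t'.dimers.val) : FlipConnected t t' := by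
  obtain ⟨t'', h1, h2⟩ := exists_flipConnected t h
  have : t'' = t' := Tiling.ext (Finset.val_injective h1)
  exact this ▸ h2

/-! ### Two-floor layers -/

/-- The dimer at the square `v` in the layer with floors `m`, `m + 1` described by `o`: a column if
`o v = v`, and otherwise the dimer that joins `v` and `o v`, on the floor `m` if `v` is white. -/
def cellPair (o : Square → Square) (m : ℤ) (v : Square) : Cube × Cube :=
  if o v = v then ((v, m), (v, m + 1)) else
    if IsWhite v then ((v, m), (o v, m)) else ((v, m + 1), (o v, m + 1))

/-- The two cubes of a pair. -/
def pairSet (d : Cube × Cube) : Finset Cube := {d.1, d.2}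

/-- The dimer of `cellPair`. -/
def cell (o : Square → Square) (m : ℤ) (v : Square) : Finset Cube := pairSet (cellPair o m v)

/-- The dimers over `Q` in the layer with floors `m`, `m + 1` described by `o`. -/
def lay (o : Square → Square) (Q : Finset Square) (m : ℤ) : Multiset (Finset Cube) :=
  Q.val.map (cell o m)

theorem lay_congr {o o' : Square → Square} {Q : Finset Square} (m : ℤ)
    (h : ∀ v ∈ Q, o v = o' v) : lay o Q m = lay o' Q m := by
  refine Multiset.map_congr rfl fun v hv => ?_
  rw [cell, cell, cellPair, cellPair, h v hv]

theorem lay_union {o : Square → Square} {P Q : Finset Square} (h : Disjoint P Q) (m : ℤ) :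
    lay o (P ∪ Q) m = lay o P m + lay o Q m := by
  rw [lay, ← Finset.disjUnion_eq_union _ _ h, Finset.disjUnion_val, Multiset.map_add]
  rfl

theorem lay_sdiff {o : Square → Square} {P Q : Finset Square} (h : P ⊆ Q) (m : ℤ) :
    lay o Q m = lay o P m + lay o (Q \ P) m := by
  rw [← lay_union Finset.disjoint_sdiff, Finset.union_sdiff_of_subset h]

/-- Moves inside `P` extend to any larger set `Q`. -/
theorem lay_reach_of_subset {o o' : Square → Square} {P Q : Finset Square} {m : ℤ} (hPQ : P ⊆ Q)
    (h : Reach (lay o P m) (lay o' P m)) (hoff : ∀ v ∈ Q, v ∉ P → o v = o' v) :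
    Reach (lay o Q m) (lay o' Q m) := by
  rw [lay_sdiff hPQ, lay_sdiff hPQ (o := o'), lay_congr (Q := Q \ P) (o := o) (o' := o') m
    fun v hv => hoff v (Finset.mem_sdiff.1 hv).1 (Finset.mem_sdiff.1 hv).2]
  exact h.add_right _

/-! ### A checker for explicit sequences of moves -/

/-- Whether two cubes share a face, by computation. -/
def adjCheck (a b : Cube) : Bool :=
  (a.1.1 - b.1.1).natAbs + (a.1.2 - b.1.2).natAbs + (a.2 - b.2).natAbs == 1

/-- List the two cubes of a dimer in increasing order. -/
def normPair (d : Cube × Cube) : Cube × Cube :=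
  if d.1.1.1 + d.1.1.2 + d.1.2 ≤ d.2.1.1 + d.2.1.2 + d.2.2 then d else d.swap

/-- The edge directions of the slab in a coded move. -/
def slabDirs : ℕ → Cube × Cube
  | 0 => (((1, 0), 0), ((0, 1), 0))
  | 1 => (((1, 0), 0), ((0, 0), 1))
  | 2 => (((0, 1), 0), ((1, 0), 0))
  | 3 => (((0, 1), 0), ((0, 0), 1))
  | 4 => (((0, 0), 1), ((1, 0), 0))
  | _ => (((0, 0), 1), ((0, 1), 0))

/-- Perform the slab move with cyclically ordered cubes `a b c d`. -/
def runMove (L : List (Cube × Cube)) (a b c d : Cube) : Option (List (Cube × Cube)) :=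
  if (adjCheck a b && adjCheck b c && adjCheck c d && adjCheck d a && (a != c) && (b != d)) = true ∧
      (a, b) ∈ L ∧ (d, c) ∈ L.erase (a, b) then
    some (normPair (b, c) :: normPair (d, a) :: (L.erase (a, b)).erase (d, c))
  else none

/-- Perform a sequence of coded moves. -/
def runMoves : List (Cube × Cube) → List (ℤ × ℤ × ℤ × ℕ) → Option (List (Cube × Cube))
  | L, [] => some L
  | L, (x, y, z, k) :: ms =>
    match runMove L ((x, y), z) (((x, y), z) + (slabDirs k).1)
        (((x, y), z) + (slabDirs k).1 + (slabDirs k).2) (((x, y), z) + (slabDirs k).2) with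
    | some L' => runMoves L' ms
    | none => none

/-- Whether a sequence of coded moves leads from `L` to `L'`. -/
def checkMoves (L L' : List (Cube × Cube)) (ms : List (ℤ × ℤ × ℤ × ℕ)) : Bool :=
  match runMoves (L.map normPair) ms with
  | some L'' => L''.isPerm (L'.map normPair)
  | none => false

/-- The multiset of dimers in a list. -/
def dimersOf (L : List (Cube × Cube)) : Multiset (Finset Cube) := (L : Multiset _).map pairSet

/-- Puts adjacency into linear arithmetic, where `omega` can use it. -/
theorem adj_iff {a b : Cube} : Adj a b ↔
    ((b.1.1 = a.1.1 + 1 ∨ a.1.1 = b.1.1 + 1) ∧ a.1.2 = b.1.2 ∧ a.2 = b.2) ∨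
    ((b.1.2 = a.1.2 + 1 ∨ a.1.2 = b.1.2 + 1) ∧ a.1.1 = b.1.1 ∧ a.2 = b.2) ∨
    ((b.2 = a.2 + 1 ∨ a.2 = b.2 + 1) ∧ a.1.1 = b.1.1 ∧ a.1.2 = b.1.2) := by
  obtain ⟨⟨a1, a2⟩, a3⟩ := a
  obtain ⟨⟨b1, b2⟩, b3⟩ := b
  simp only [Adj, axes, Finset.mem_insert, Finset.mem_singleton, exists_eq_or_imp,
    exists_eq_left, Prod.mk_add_mk, Prod.mk.injEq, add_zero]
  refine or_congr ?_ (or_congr ?_ ?_)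
  · constructor
    · rintro (⟨⟨h1, h2⟩, h3⟩ | ⟨⟨h1, h2⟩, h3⟩)
      exacts [⟨Or.inl h1, h2.symm, h3.symm⟩, ⟨Or.inr h1, h2, h3⟩]
    · rintro ⟨h1 | h1, h2, h3⟩
      exacts [Or.inl ⟨⟨h1, h2.symm⟩, h3.symm⟩, Or.inr ⟨⟨h1, h2⟩, h3⟩]
  · constructor
    · rintro (⟨⟨h1, h2⟩, h3⟩ | ⟨⟨h1, h2⟩, h3⟩)
      exacts [⟨Or.inl h2, h1.symm, h3.symm⟩, ⟨Or.inr h2, h1, h3⟩]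
    · rintro ⟨h1 | h1, h2, h3⟩
      exacts [Or.inl ⟨⟨h2.symm, h1⟩, h3.symm⟩, Or.inr ⟨⟨h2, h1⟩, h3⟩]
  · constructor
    · rintro (⟨⟨h1, h2⟩, h3⟩ | ⟨⟨h1, h2⟩, h3⟩)
      exacts [⟨Or.inl h3, h1.symm, h2.symm⟩, ⟨Or.inr h3, h1, h2⟩]
    · rintro ⟨h1 | h1, h2, h3⟩
      exacts [Or.inl ⟨⟨h2.symm, h3.symm⟩, h1⟩, Or.inr ⟨⟨h2, h3⟩, h1⟩]

theorem adj_of_adjCheck {a b : Cube} (h : adjCheck a b = true) : Adj a b := by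
  simp only [adjCheck, beq_iff_eq] at h
  rw [adj_iff]
  omega

theorem pairSet_normPair (d : Cube × Cube) : pairSet (normPair d) = pairSet d := by
  rw [normPair]
  split_ifs
  · rfl
  · exact Finset.pair_comm _ _

theorem reach_of_runMove {L L' : List (Cube × Cube)} {a b c d : Cube}
    (h : runMove L a b c d = some L') : Reach (dimersOf L) (dimersOf L') := by
  rw [runMove] at h
  split_ifs at h with hc
  obtain ⟨hb, h1, h2⟩ := hc
  simp only [Bool.and_eq_true, bne_iff_ne, ne_eq] at hb
  obtain ⟨⟨⟨⟨⟨k1, k2⟩, k3⟩, k4⟩, k5⟩, k6⟩ := hb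
  obtain rfl := Option.some.inj h
  refine Relation.ReflTransGen.single ⟨a, b, c, d, dimersOf ((L.erase (a, b)).erase (d, c)),
    adj_of_adjCheck k1, adj_of_adjCheck k2, adj_of_adjCheck k3, adj_of_adjCheck k4, k5, k6, ?_, ?_⟩
  · have := (List.perm_cons_erase h1).trans ((List.perm_cons_erase h2).cons (a, b))
    rw [dimersOf, Multiset.coe_eq_coe.2 this, Finset.pair_comm c d]
    rfl
  · simp only [dimersOf, Multiset.map_coe, List.map_cons, pairSet_normPair]
    rfl

theorem reach_of_runMoves {ms : List (ℤ × ℤ × ℤ × ℕ)} : ∀ {L L' : List (Cube × Cube)},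
    runMoves L ms = some L' → Reach (dimersOf L) (dimersOf L') := by
  induction ms with
  | nil => rintro L L' h; obtain rfl := Option.some.inj h; exact Reach.refl _
  | cons m ms ih =>
    obtain ⟨x, y, z, k⟩ := m
    intro L L' h
    rw [runMoves] at h
    split at h
    · next L'' hL => exact (reach_of_runMove hL).trans (ih h)
    · simp at h

/-- Soundness of the checker. Ordering the two cubes of every dimer lets the checker compare ordered
pairs, so that a permutation test decides equality of multisets of dimers. -/
theorem reach_of_checkMoves {L L' : List (Cube × Cube)} {ms : List (ℤ × ℤ × ℤ × ℕ)}
    (h : checkMoves L L' ms = true) : Reach (dimersOf L) (dimersOf L') := by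
  have key : ∀ L : List (Cube × Cube), dimersOf (L.map normPair) = dimersOf L := fun L => by
    simp [dimersOf, Function.comp_def, pairSet_normPair]
  rw [checkMoves] at h
  split at h
  · next L'' hL =>
    have := reach_of_runMoves hL
    rw [key] at this
    rwa [dimersOf.eq_1 L'', Multiset.coe_eq_coe.2 (List.isPerm_iff.1 h), ← dimersOf.eq_1,
      key] at this
  · simp at h

/-! ### Transport of explicit moves to other places -/

theorem isWhite_add (p x : Square) : IsWhite (p + x) ↔ (IsWhite p ↔ IsWhite x) := by
  simp only [IsWhite, Prod.fst_add, Prod.snd_add, Int.even_iff]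
  omega

/-- The embedding of the two floors `0`, `1` in the floors `m`, `m + 1` that translates by `p` and
exchanges the floors if `p` is black. -/
def layerMap (p : Square) (m : ℤ) (c : Cube) : Cube :=
  (p + c.1, if IsWhite p then m + c.2 else m + 1 - c.2)

theorem layerMap_injective (p : Square) (m : ℤ) : Function.Injective (layerMap p m) := by
  rintro ⟨a, z⟩ ⟨b, w⟩ h
  simp only [layerMap, Prod.mk.injEq, add_right_inj] at h
  obtain ⟨rfl, h⟩ := h
  split_ifs at h
  · simpa using h
  · simpa using h

theorem layerMap_adj (p : Square) (m : ℤ) (a b : Cube) (h : Adj a b) :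
    Adj (layerMap p m a) (layerMap p m b) := by
  rw [adj_iff] at h ⊢
  simp only [layerMap, Prod.fst_add, Prod.snd_add]
  split_ifs <;> omega

/-- The floor of a horizontal dimer is determined by the color of the square it leaves. Translation
by a black square reverses colors, and the floor exchange in `layerMap` compensates for this. -/
theorem image_layerMap_cell {o o₀ : Square → Square} {p x : Square} (m : ℤ)
    (h : o (p + x) = p + o₀ x) : (cell o₀ 0 x).image (layerMap p m) = cell o m (p + x) := by
  simp only [cell, cellPair, h, add_right_inj, isWhite_add]
  by_cases h1 : o₀ x = x <;> by_cases h2 : IsWhite p <;> by_cases h3 : IsWhite x <;>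
    simp [h1, h2, h3, pairSet, layerMap, Finset.pair_comm]

/-- An explicit sequence of moves in a neighborhood, translated to `p`. -/
theorem lay_reach_of_check {P : List Square} {o₀ o₁ : Square → Square}
    {ms : List (ℤ × ℤ × ℤ × ℕ)}
    (hc : checkMoves (P.map (cellPair o₀ 0)) (P.map (cellPair o₁ 0)) ms = true) (hP : P.Nodup)
    (p : Square) (m : ℤ) {Q : Finset Square} (hPQ : ∀ x ∈ P, p + x ∈ Q) {o o' : Square → Square}
    (h0 : ∀ x ∈ P, o (p + x) = p + o₀ x) (h1 : ∀ x ∈ P, o' (p + x) = p + o₁ x)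
    (hoff : ∀ v, (∀ x ∈ P, v ≠ p + x) → o v = o' v) : Reach (lay o Q m) (lay o' Q m) := by
  have key : ∀ o o₀ : Square → Square, (∀ x ∈ P, o (p + x) = p + o₀ x) →
      (dimersOf (P.map (cellPair o₀ 0))).map (Finset.image (layerMap p m)) =
        lay o (P.map (p + ·)).toFinset m := by
    intro o o₀ h
    rw [lay, List.toFinset_val, List.Nodup.dedup (hP.map (add_right_injective p))]
    simp only [dimersOf, Multiset.map_coe, List.map_map, Multiset.coe_eq_coe]
    refine List.Perm.of_eq (List.map_congr_left fun x hx => ?_)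
    exact image_layerMap_cell m (h x hx)
  have := (reach_of_checkMoves hc).map _ (layerMap_injective p m) (layerMap_adj p m)
  rw [key _ _ h0, key _ _ h1] at this
  refine lay_reach_of_subset ?_ this fun v _ hv => hoff v fun x hx hvx => hv ?_
  · intro v hv
    simp only [List.mem_toFinset, List.mem_map] at hv
    obtain ⟨x, hx, rfl⟩ := hv
    exact hPQ x hx
  · simp only [List.mem_toFinset, List.mem_map]
    exact ⟨x, hx, hvx.symm⟩

/-! ### Height functions -/

/-- The square that follows `v` on the strands described by the height function `h`. The value
`h p` belongs to the unit square of the dual grid with upper left corner at the center of `p`; the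
higher side of a strand is on its left. -/
def out (h : Square → ℤ) (v : Square) : Square :=
  if h (v.1, v.2 - 1) - h (v.1, v.2) = 1 then (v.1 + 1, v.2)
  else if h (v.1, v.2) - h (v.1 - 1, v.2) = 1 then (v.1, v.2 + 1)
  else if h (v.1 - 1, v.2) - h (v.1 - 1, v.2 - 1) = 1 then (v.1 - 1, v.2)
  else if h (v.1 - 1, v.2 - 1) - h (v.1, v.2 - 1) = 1 then (v.1, v.2 - 1)
  else v

/-- `g` and `h` agree on the four faces around `v`. -/
def AgreeAt (g h : Square → ℤ) (v : Square) : Prop :=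
  g (v.1, v.2) = h (v.1, v.2) ∧ g (v.1 - 1, v.2) = h (v.1 - 1, v.2) ∧
    g (v.1, v.2 - 1) = h (v.1, v.2 - 1) ∧ g (v.1 - 1, v.2 - 1) = h (v.1 - 1, v.2 - 1)

/-- The strand at a square depends only on the four faces around it; this locality lets moves
checked in a small window be used inside any configuration. -/
theorem out_congr {g h : Square → ℤ} {v : Square} (H : AgreeAt g h v) : out g v = out h v := by
  obtain ⟨h1, h2, h3, h4⟩ := H
  rw [out, out, h1, h2, h3, h4]

theorem out_translate (h : Square → ℤ) (p x : Square) :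
    out h (p + x) = p + out (fun q => h (p + q)) x := by
  obtain ⟨p1, p2⟩ := p
  obtain ⟨x1, x2⟩ := x
  simp only [out, Prod.mk_add_mk, add_sub_assoc]
  split_ifs <;> simp [add_assoc]

/-- The indicator function of the `2 × 2` faces with upper left face `p`: a ring around the square
`p + (1, 1)`. -/
def ring (p q : Square) : ℤ :=
  if p.1 ≤ q.1 ∧ q.1 ≤ p.1 + 1 ∧ p.2 ≤ q.2 ∧ q.2 ≤ p.2 + 1 then 1 else 0

/-- The list of squares of a rectangle at the origin. -/
def rectList (a b c d : ℤ) : List Square :=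
  (List.range (b - a).toNat).flatMap fun (i : ℕ) =>
    (List.range (d - c).toNat).map fun (j : ℕ) => (a + i, c + j)

theorem mem_rectList {a b c d : ℤ} {x : Square} :
    x ∈ rectList a b c d ↔ a ≤ x.1 ∧ x.1 < b ∧ c ≤ x.2 ∧ x.2 < d := by
  obtain ⟨x, y⟩ := x
  simp only [rectList, List.mem_flatMap, List.mem_range, List.mem_map, Prod.mk.injEq]
  constructor
  · rintro ⟨i, hi, j, hj, rfl, rfl⟩; omega
  · rintro ⟨h1, h2, h3, h4⟩
    exact ⟨(x - a).toNat, by omega, (y - c).toNat, by omega, by omega, by omega⟩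

/-! ### Explicit move sequences for rings and their verification -/

/-- Moves that translate a positive ring by `(1, 1)`. -/
def diagMovesPos : List (ℤ × ℤ × ℤ × ℕ) :=
  [(0, 3, 0, 4), (0, 2, 0, 0), (3, 1, 0, 5), (2, 1, 0, 2), (2, 3, 0, 4), (2, 2, 0, 0),
   (1, 2, 0, 2), (1, 2, 0, 1), (1, 1, 0, 5), (0, 1, 1, 2), (0, 0, 1, 0), (1, 0, 1, 2),
   (0, 0, 0, 3), (0, 2, 1, 0), (1, 0, 0, 1), (0, 2, 0, 3)]

/-- Moves that translate a positive ring by `(2, 0)`. -/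
def rightMovesPos : List (ℤ × ℤ × ℤ × ℕ) :=
  [(4, 1, 0, 5), (3, 0, 0, 4), (3, 1, 0, 5), (2, 1, 0, 2), (3, 1, 1, 2), (3, 0, 1, 0),
   (2, 0, 1, 2), (2, 1, 0, 1), (1, 1, 0, 4), (1, 0, 0, 0), (0, 0, 0, 2), (1, 1, 1, 0),
   (0, 1, 0, 0), (1, 1, 0, 3), (0, 0, 0, 1), (0, 1, 0, 3)]

/-- Moves that translate a positive ring by `(0, 2)`. -/
def downMovesPos : List (ℤ × ℤ × ℤ × ℕ) :=
  [(0, 3, 0, 4), (0, 2, 0, 0), (0, 4, 0, 4), (0, 3, 1, 0), (2, 3, 0, 5), (1, 3, 1, 2),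
   (1, 2, 1, 0), (1, 2, 0, 3), (1, 1, 0, 5), (1, 1, 0, 2), (0, 1, 1, 2), (0, 0, 1, 0),
   (1, 0, 1, 2), (0, 0, 0, 3), (1, 1, 0, 1), (1, 0, 0, 1)]

/-- Moves that translate a negative ring by `(1, 1)`. -/
def diagMovesNeg : List (ℤ × ℤ × ℤ × ℕ) :=
  [(0, 3, 0, 4), (3, 1, 0, 5), (2, 1, 1, 2), (0, 2, 1, 0), (2, 3, 0, 4), (2, 2, 1, 0),
   (1, 2, 1, 2), (1, 2, 0, 1), (1, 1, 0, 5), (0, 1, 0, 2), (0, 2, 0, 0), (0, 2, 0, 3),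
   (0, 0, 0, 0), (1, 0, 0, 2), (1, 0, 0, 1), (0, 0, 0, 3)]

/-- Moves that translate a negative ring by `(2, 0)`. -/
def rightMovesNeg : List (ℤ × ℤ × ℤ × ℕ) :=
  [(4, 1, 0, 5), (3, 0, 0, 4), (3, 1, 0, 5), (2, 1, 1, 2), (3, 1, 0, 2), (3, 0, 0, 0),
   (2, 0, 0, 2), (2, 1, 0, 1), (1, 1, 0, 4), (1, 0, 1, 0), (0, 0, 1, 2), (0, 1, 1, 0),
   (0, 1, 0, 3), (0, 0, 0, 1), (1, 1, 0, 0), (1, 1, 0, 3)]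

/-- Moves that translate a negative ring by `(0, 2)`. -/
def downMovesNeg : List (ℤ × ℤ × ℤ × ℕ) :=
  [(0, 3, 0, 4), (2, 3, 0, 5), (0, 2, 1, 0), (0, 4, 0, 4), (0, 3, 0, 0), (1, 3, 0, 2),
   (1, 2, 0, 0), (1, 2, 0, 3), (1, 1, 0, 5), (0, 1, 0, 2), (1, 1, 1, 2), (0, 0, 0, 0),
   (1, 0, 0, 2), (0, 0, 0, 3), (1, 1, 0, 1), (1, 0, 0, 1)]

/-- Moves that cancel two adjacent rings of the same sign. -/
def cancelMoves : List (ℤ × ℤ × ℤ × ℕ) :=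
  [(2, 1, 0, 2), (2, 0, 1, 2), (2, 1, 0, 1), (1, 1, 0, 4), (3, 1, 0, 4), (3, 1, 1, 0),
   (4, 1, 1, 2), (4, 0, 1, 0), (4, 2, 0, 1), (1, 0, 0, 0), (0, 0, 0, 2), (1, 1, 1, 0),
   (2, 1, 1, 2), (0, 1, 1, 2), (2, 0, 1, 0), (3, 0, 1, 2), (3, 1, 0, 1), (2, 0, 0, 3),
   (0, 2, 0, 1), (5, 0, 0, 3), (3, 0, 0, 1), (2, 2, 0, 1), (0, 0, 0, 1), (0, 1, 0, 1)]

/-- Moves that turn a negative ring at `(0, 0)` into a positive one at `(1, 0)`. -/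
def convertMovesEven : List (ℤ × ℤ × ℤ × ℕ) :=
  [(2, 0, 0, 5), (3, 0, 2, 5), (1, 0, 0, 5), (1, 0, 0, 2), (1, 2, 0, 4), (1, 2, 1, 1),
   (2, 0, 1, 3), (2, 1, 1, 5), (2, 1, 2, 3), (2, 2, 2, 4), (1, 1, 2, 4), (1, 0, 3, 0),
   (0, 0, 3, 2), (2, 0, 3, 2), (2, 1, 3, 0), (0, 1, 3, 0), (1, 1, 3, 2), (1, 1, 2, 1),
   (0, 0, 2, 1), (1, 0, 2, 5), (1, 0, 1, 3), (1, 0, 1, 4), (1, 0, 0, 1), (1, 1, 0, 0),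
   (0, 1, 2, 3), (1, 1, 1, 5), (1, 1, 0, 3), (2, 1, 0, 3)]

/-- Moves that turn a negative ring at `(1, 0)` into a positive one at `(2, 0)`. -/
def convertMovesOdd : List (ℤ × ℤ × ℤ × ℕ) :=
  [(4, 1, 2, 5), (2, 2, 0, 4), (3, 0, 0, 5), (2, 0, 0, 5), (2, 0, 1, 2), (2, 1, 1, 0),
   (3, 1, 1, 3), (2, 0, 1, 1), (3, 0, 1, 5), (3, 0, 2, 3), (3, 0, 2, 4), (2, 1, 2, 4),
   (2, 1, 3, 0), (1, 1, 3, 2), (1, 0, 3, 0), (3, 1, 3, 2), (3, 0, 3, 0), (2, 0, 3, 2),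
   (2, 1, 2, 1), (1, 2, 2, 1), (2, 1, 2, 5), (2, 1, 1, 3), (2, 0, 1, 5), (2, 2, 1, 4),
   (1, 0, 2, 3), (2, 0, 0, 3), (3, 0, 0, 3), (2, 2, 0, 1)]

/-- Moves that let a strand sweep over a jewel, leaving a ring around another one. -/
def tritMoves : List (ℤ × ℤ × ℤ × ℕ) :=
  [(-1, 3, 0, 4), (1, 4, 0, 5), (-1, 2, 0, 4), (-1, 2, 1, 0), (1, 2, 0, 5), (0, 2, 1, 2),
   (0, 4, 0, 5), (-1, 4, 0, 5), (-1, 4, 0, 2), (0, 4, 1, 2), (0, 3, 1, 0), (0, 1, 1, 0),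
   (-1, 1, 0, 0), (0, 1, 0, 3), (0, 0, 0, 5), (0, 0, 0, 2), (-1, 3, 0, 0), (0, 3, 0, 3),
   (0, 2, 0, 5), (0, 2, 0, 2), (0, 1, 0, 0), (1, 1, 0, 3), (-1, 2, 1, 2), (-1, 1, 0, 2),
   (-1, 2, 0, 1)]

theorem check_diag_pos : checkMoves ((rectList 0 4 0 4).map (cellPair (out (ring (0, 0))) 0))
    ((rectList 0 4 0 4).map (cellPair (out (ring (1, 1))) 0)) diagMovesPos = true := by
  decide +kernel

theorem check_right_pos : checkMoves ((rectList 0 5 0 3).map (cellPair (out (ring (0, 0))) 0))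
    ((rectList 0 5 0 3).map (cellPair (out (ring (2, 0))) 0)) rightMovesPos = true := by
  decide +kernel

theorem check_down_pos : checkMoves ((rectList 0 3 0 5).map (cellPair (out (ring (0, 0))) 0))
    ((rectList 0 3 0 5).map (cellPair (out (ring (0, 2))) 0)) downMovesPos = true := by
  decide +kernel

theorem check_diag_neg : checkMoves ((rectList 0 4 0 4).map (cellPair (out (-ring (0, 0))) 0))
    ((rectList 0 4 0 4).map (cellPair (out (-ring (1, 1))) 0)) diagMovesNeg = true := by
  decide +kernel

theorem check_right_neg : checkMoves ((rectList 0 5 0 3).map (cellPair (out (-ring (0, 0))) 0))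
    ((rectList 0 5 0 3).map (cellPair (out (-ring (2, 0))) 0)) rightMovesNeg = true := by
  decide +kernel

theorem check_down_neg : checkMoves ((rectList 0 3 0 5).map (cellPair (out (-ring (0, 0))) 0))
    ((rectList 0 3 0 5).map (cellPair (out (-ring (0, 2))) 0)) downMovesNeg = true := by
  decide +kernel

theorem check_cancel : checkMoves
    ((rectList 0 6 0 3).map (cellPair (out (ring (0, 0) + ring (3, 0))) 0))
    ((rectList 0 6 0 3).map (cellPair (out 0) 0)) cancelMoves = true := by
  decide +kernel

theorem check_convert_even : checkMoves
    ((rectList 0 4 0 3).map (cellPair (out 0) 0) ++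
      (rectList 0 4 0 3).map (cellPair (out (-ring (0, 0))) 2))
    ((rectList 0 4 0 3).map (cellPair (out 0) 0) ++
      (rectList 0 4 0 3).map (cellPair (out (ring (1, 0))) 2)) convertMovesEven = true := by
  decide +kernel

theorem check_convert_odd : checkMoves
    ((rectList 1 5 0 3).map (cellPair (out 0) 0) ++
      (rectList 1 5 0 3).map (cellPair (out (-ring (1, 0))) 2))
    ((rectList 1 5 0 3).map (cellPair (out 0) 0) ++
      (rectList 1 5 0 3).map (cellPair (out (ring (2, 0))) 2)) convertMovesOdd = true := by
  decide +kernel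

theorem rectList_nodup_cases : (rectList 0 4 0 4).Nodup ∧ (rectList 0 5 0 3).Nodup ∧
    (rectList 0 3 0 5).Nodup ∧ (rectList 0 6 0 3).Nodup ∧ (rectList 0 4 0 3).Nodup ∧
    (rectList 1 5 0 3).Nodup := by
  decide +kernel

/-! ### Moving rings -/

/-- The layer described by the height function `h`. -/
def hlay (h : Square → ℤ) (Q : Finset Square) (m : ℤ) : Multiset (Finset Cube) := lay (out h) Q m

theorem AgreeAt.refl (h : Square → ℤ) (v : Square) : AgreeAt h h v := ⟨rfl, rfl, rfl, rfl⟩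

theorem AgreeAt.add {g g' h h' : Square → ℤ} {v : Square} (H : AgreeAt g g' v)
    (H' : AgreeAt h h' v) : AgreeAt (g + h) (g' + h') v := by
  obtain ⟨h1, h2, h3, h4⟩ := H
  obtain ⟨k1, k2, k3, k4⟩ := H'
  exact ⟨congrArg₂ (· + ·) h1 k1, congrArg₂ (· + ·) h2 k2, congrArg₂ (· + ·) h3 k3,
    congrArg₂ (· + ·) h4 k4⟩

theorem AgreeAt.smul {g g' : Square → ℤ} {v : Square} (s : ℤ) (H : AgreeAt g g' v) :
    AgreeAt (s • g) (s • g') v := by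
  obtain ⟨h1, h2, h3, h4⟩ := H
  exact ⟨congrArg (s • ·) h1, congrArg (s • ·) h2, congrArg (s • ·) h3, congrArg (s • ·) h4⟩

theorem AgreeAt.symm {g h : Square → ℤ} {v : Square} (H : AgreeAt g h v) : AgreeAt h g v :=
  ⟨H.1.symm, H.2.1.symm, H.2.2.1.symm, H.2.2.2.symm⟩

theorem AgreeAt.trans {f g h : Square → ℤ} {v : Square} (H : AgreeAt f g v) (H' : AgreeAt g h v) :
    AgreeAt f h v :=
  ⟨H.1.trans H'.1, H.2.1.trans H'.2.1, H.2.2.1.trans H'.2.2.1, H.2.2.2.trans H'.2.2.2⟩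

theorem out_zero (v : Square) : out 0 v = v := by simp [out]

theorem ring_eq_zero {p q : Square}
    (h : q.1 < p.1 ∨ p.1 + 1 < q.1 ∨ q.2 < p.2 ∨ p.2 + 1 < q.2) : ring p q = 0 :=
  if_neg (by omega)

theorem ring_agreeAt {p v : Square}
    (h : v.1 < p.1 ∨ p.1 + 2 < v.1 ∨ v.2 < p.2 ∨ p.2 + 2 < v.2) : AgreeAt (ring p) 0 v :=
  ⟨ring_eq_zero (by simp only; omega), ring_eq_zero (by simp only; omega),
    ring_eq_zero (by simp only; omega), ring_eq_zero (by simp only; omega)⟩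

theorem ring_add (p r q : Square) : ring (p + r) (p + q) = ring r q := by
  simp [ring, add_assoc]

theorem ring_add_zero (p q : Square) : ring p (p + q) = ring (0, 0) q := by
  have := ring_add p 0 q
  rwa [add_zero] at this

/-- An explicit sequence of moves in a rectangle, translated to `p`. -/
theorem hlay_reach_of_check {a b c d : ℤ} {h₀ h₁ : Square → ℤ} {ms : List (ℤ × ℤ × ℤ × ℕ)}
    (hc : checkMoves ((rectList a b c d).map (cellPair (out h₀) 0))
      ((rectList a b c d).map (cellPair (out h₁) 0)) ms = true) (hP : (rectList a b c d).Nodup)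
    (p : Square) (m : ℤ) {Q : Finset Square} {h h' : Square → ℤ}
    (hQ : ∀ v : Square, p.1 + a ≤ v.1 → v.1 < p.1 + b → p.2 + c ≤ v.2 → v.2 < p.2 + d → v ∈ Q)
    (H0 : ∀ q : Square, a - 1 ≤ q.1 → q.1 < b → c - 1 ≤ q.2 → q.2 < d → h (p + q) = h₀ q)
    (H1 : ∀ q : Square, a - 1 ≤ q.1 → q.1 < b → c - 1 ≤ q.2 → q.2 < d → h' (p + q) = h₁ q)
    (hoff : ∀ v : Square, v.1 < p.1 + a ∨ p.1 + b ≤ v.1 ∨ v.2 < p.2 + c ∨ p.2 + d ≤ v.2 →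
      AgreeAt h h' v) : Reach (hlay h Q m) (hlay h' Q m) := by
  have key : ∀ h h₀ : Square → ℤ,
      (∀ q : Square, a - 1 ≤ q.1 → q.1 < b → c - 1 ≤ q.2 → q.2 < d → h (p + q) = h₀ q) →
      ∀ x ∈ rectList a b c d, out h (p + x) = p + out h₀ x := by
    intro h h₀ H x hx
    rw [mem_rectList] at hx
    rw [out_translate]
    congr 1
    refine out_congr ⟨H _ ?_ ?_ ?_ ?_, H _ ?_ ?_ ?_ ?_, H _ ?_ ?_ ?_ ?_, H _ ?_ ?_ ?_ ?_⟩ <;>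
      simp only <;> omega
  refine lay_reach_of_check hc hP p m ?_ (key _ _ H0) (key _ _ H1) ?_
  · intro x hx
    rw [mem_rectList] at hx
    refine hQ _ ?_ ?_ ?_ ?_ <;> simp only [Prod.fst_add, Prod.snd_add] <;> omega
  · intro v hv
    refine out_congr (hoff v ?_)
    by_contra hcon
    refine hv (v - p) ?_ (by simp)
    rw [mem_rectList, Prod.fst_sub, Prod.snd_sub]
    omega

/-- A ring occupies `3 × 3` squares, so the bounding rectangle of a ring and its translate has sides
`dx + 3` and `dy + 3`. The faces around the squares of this rectangle begin one row and one column
before it, hence the margin in `hg`. -/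
theorem ring_step {W H dx dy : ℤ} {mp mn : List (ℤ × ℤ × ℤ × ℕ)}
    (hp : checkMoves ((rectList 0 W 0 H).map (cellPair (out (ring (0, 0))) 0))
      ((rectList 0 W 0 H).map (cellPair (out (ring (dx, dy))) 0)) mp = true)
    (hn : checkMoves ((rectList 0 W 0 H).map (cellPair (out (-ring (0, 0))) 0))
      ((rectList 0 W 0 H).map (cellPair (out (-ring (dx, dy))) 0)) mn = true)
    (hnd : (rectList 0 W 0 H).Nodup) (hdx : 0 ≤ dx) (hdy : 0 ≤ dy) (hW : dx + 3 = W)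
    (hH : dy + 3 = H) {s : ℤ} (hs : s = 1 ∨ s = -1) {g : Square → ℤ} {p : Square} (m : ℤ)
    {Q : Finset Square}
    (hQ : ∀ v : Square, p.1 ≤ v.1 → v.1 < p.1 + W → p.2 ≤ v.2 → v.2 < p.2 + H → v ∈ Q)
    (hg : ∀ q : Square, p.1 - 1 ≤ q.1 → q.1 < p.1 + W → p.2 - 1 ≤ q.2 → q.2 < p.2 + H →
      g q = 0) :
    Reach (hlay (g + s • ring p) Q m) (hlay (g + s • ring (p + (dx, dy))) Q m) := by
  have hg' : ∀ q : Square, 0 - 1 ≤ q.1 → q.1 < W → 0 - 1 ≤ q.2 → q.2 < H → g (p + q) = 0 := by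
    intro q h1 h2 h3 h4
    apply hg <;> simp only [Prod.fst_add, Prod.snd_add] <;> omega
  have hoff : ∀ v : Square, v.1 < p.1 + 0 ∨ p.1 + W ≤ v.1 ∨ v.2 < p.2 + 0 ∨ p.2 + H ≤ v.2 →
      AgreeAt (g + s • ring p) (g + s • ring (p + (dx, dy))) v := by
    intro v hv
    refine (AgreeAt.refl g v).add (AgreeAt.smul s ?_)
    exact (ring_agreeAt (by omega)).trans
      (ring_agreeAt (by simp only [Prod.fst_add, Prod.snd_add]; omega)).symm
  have hQ' : ∀ v : Square, p.1 + 0 ≤ v.1 → v.1 < p.1 + W → p.2 + 0 ≤ v.2 → v.2 < p.2 + H →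
      v ∈ Q := by simpa using hQ
  rcases hs with rfl | rfl
  · refine hlay_reach_of_check hp hnd p m hQ' ?_ ?_ hoff
    · intro q h1 h2 h3 h4
      simp [hg' q h1 h2 h3 h4, ring_add_zero]
    · intro q h1 h2 h3 h4
      simp [hg' q h1 h2 h3 h4, ring_add]
  · refine hlay_reach_of_check hn hnd p m hQ' ?_ ?_ hoff
    · intro q h1 h2 h3 h4
      simp [hg' q h1 h2 h3 h4, ring_add_zero]
    · intro q h1 h2 h3 h4
      simp [hg' q h1 h2 h3 h4, ring_add]

/-- The available steps `(1, 1)`, `(2, 0)` and `(0, 2)` preserve color, whence the even distance.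
Diagonal steps are used until one coordinate is right, then straight ones. -/
theorem ring_move {s : ℤ} (hs : s = 1 ∨ s = -1) {g : Square → ℤ} (m : ℤ) {Q : Finset Square}
    {p' : Square} (n : ℕ) : ∀ {p : Square}, p.1 ≤ p'.1 → p.2 ≤ p'.2 →
      p'.1 - p.1 + (p'.2 - p.2) = 2 * n →
      (∀ v : Square, p.1 ≤ v.1 → v.1 ≤ p'.1 + 2 → p.2 ≤ v.2 → v.2 ≤ p'.2 + 2 → v ∈ Q) →
      (∀ q : Square, p.1 - 1 ≤ q.1 → q.1 ≤ p'.1 + 2 → p.2 - 1 ≤ q.2 → q.2 ≤ p'.2 + 2 →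
        g q = 0) → Reach (hlay (g + s • ring p) Q m) (hlay (g + s • ring p') Q m) := by
  obtain ⟨nd1, nd2, nd3, -⟩ := rectList_nodup_cases
  induction n with
  | zero =>
    intro p h1 h2 h3 _ _
    obtain rfl : p = p' := Prod.ext (by omega) (by omega)
    exact Reach.refl _
  | succ n ih =>
    intro p h1 h2 h3 hQ hg
    have main : ∀ dx dy : ℤ, 0 ≤ dx → 0 ≤ dy → dx + dy = 2 → p.1 + dx ≤ p'.1 →
        p.2 + dy ≤ p'.2 →
        Reach (hlay (g + s • ring p) Q m) (hlay (g + s • ring (p + (dx, dy))) Q m) →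
        Reach (hlay (g + s • ring p) Q m) (hlay (g + s • ring p') Q m) := by
      intro dx dy k1 k2 k3 k4 k5 hr
      refine hr.trans (ih ?_ ?_ ?_ ?_ ?_)
      · simpa using k4
      · simpa using k5
      · simp only [Prod.fst_add, Prod.snd_add]; omega
      · simp only [Prod.fst_add, Prod.snd_add]
        intro v e1 e2 e3 e4
        exact hQ v (by omega) e2 (by omega) e4
      · simp only [Prod.fst_add, Prod.snd_add]
        intro v e1 e2 e3 e4
        exact hg v (by omega) e2 (by omega) e4
    rcases h1.eq_or_lt with e1 | e1
    · refine main 0 2 (by omega) (by omega) (by omega) (by omega) (by omega) ?_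
      refine ring_step check_down_pos check_down_neg nd3 (by omega) (by omega) (by omega)
        (by omega) hs m (fun v _ _ _ _ => hQ v ?_ ?_ ?_ ?_) (fun v _ _ _ _ => hg v ?_ ?_ ?_ ?_) <;>
        omega
    rcases h2.eq_or_lt with e2 | e2
    · refine main 2 0 (by omega) (by omega) (by omega) (by omega) (by omega) ?_
      refine ring_step check_right_pos check_right_neg nd2 (by omega) (by omega) (by omega)
        (by omega) hs m (fun v _ _ _ _ => hQ v ?_ ?_ ?_ ?_) (fun v _ _ _ _ => hg v ?_ ?_ ?_ ?_) <;>
        omega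
    · refine main 1 1 (by omega) (by omega) (by omega) (by omega) (by omega) ?_
      refine ring_step check_diag_pos check_diag_neg nd1 (by omega) (by omega) (by omega)
        (by omega) hs m (fun v _ _ _ _ => hQ v ?_ ?_ ?_ ?_) (fun v _ _ _ _ => hg v ?_ ?_ ?_ ?_) <;>
        omega

/-- The two rings surround jewels at the odd distance `3`, of opposite colors, so their charges are
opposite. -/
theorem ring_cancel {g : Square → ℤ} {p : Square} (m : ℤ) {Q : Finset Square}
    (hQ : ∀ v : Square, p.1 ≤ v.1 → v.1 < p.1 + 6 → p.2 ≤ v.2 → v.2 < p.2 + 3 → v ∈ Q)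
    (hg : ∀ q : Square, p.1 - 1 ≤ q.1 → q.1 < p.1 + 6 → p.2 - 1 ≤ q.2 → q.2 < p.2 + 3 →
      g q = 0) :
    Reach (hlay (g + ring p + ring (p + (3, 0))) Q m) (hlay g Q m) := by
  obtain ⟨-, -, -, nd, -⟩ := rectList_nodup_cases
  have hg' : ∀ q : Square, 0 - 1 ≤ q.1 → q.1 < 6 → 0 - 1 ≤ q.2 → q.2 < 3 → g (p + q) = 0 := by
    intro q h1 h2 h3 h4
    apply hg <;> simp only [Prod.fst_add, Prod.snd_add] <;> omega
  refine hlay_reach_of_check check_cancel nd p m (by simpa using hQ) ?_ ?_ ?_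
  · intro q h1 h2 h3 h4
    simp [hg' q h1 h2 h3 h4, ring_add_zero, ring_add]
  · intro q h1 h2 h3 h4
    simp [hg' q h1 h2 h3 h4]
  · intro v hv
    have e1 : AgreeAt (ring p) 0 v := ring_agreeAt (by omega)
    have e2 : AgreeAt (ring (p + (3, 0))) 0 v :=
      ring_agreeAt (by simp only [Prod.fst_add, Prod.snd_add]; omega)
    simpa using ((AgreeAt.refl g v).add e1).add e2

theorem image_layerMap_cell_of_isWhite {o o₀ : Square → Square} {p x : Square} (m : ℤ)
    (hp : IsWhite p) (h : o (p + x) = p + o₀ x) :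
    (cell o₀ m x).image (layerMap p 0) = cell o m (p + x) := by
  simp only [cell, cellPair, h, add_right_inj, isWhite_add, hp, true_iff]
  by_cases h1 : o₀ x = x <;> by_cases h3 : IsWhite x <;>
    simp [h1, h3, pairSet, layerMap, hp]

/-- Reversing a ring and shifting it to a square of the other color keeps its charge. The moves use
the columns of the upper two floors, so `u` has to vanish here too. -/
theorem ring_convert {u g : Square → ℤ} {q : Square} {Q : Finset Square}
    (hQ : ∀ v : Square, q.1 ≤ v.1 → v.1 < q.1 + 4 → q.2 ≤ v.2 → v.2 < q.2 + 3 → v ∈ Q)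
    (hg : ∀ f : Square, q.1 - 1 ≤ f.1 → f.1 < q.1 + 4 → q.2 - 1 ≤ f.2 → f.2 < q.2 + 3 →
      g f = 0 ∧ u f = 0) :
    Reach (hlay u Q 0 + hlay (g - ring q) Q 2)
      (hlay u Q 0 + hlay (g + ring (q + (1, 0))) Q 2) := by
  -- Only translations by white squares are applied, since exchanging the floors inside both layers
  -- would not preserve adjacency between the layers. A black `q` is reached from the white `q - (1,
  -- 0)` with the sequence verified at offset `1`.
  obtain ⟨a, w, rfl, hw, hnd, ms, hc⟩ : ∃ (a : ℤ) (w : Square), q = w + (a, 0) ∧ IsWhite w ∧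
      (rectList a (a + 4) 0 3).Nodup ∧ ∃ ms, checkMoves
        ((rectList a (a + 4) 0 3).map (cellPair (out 0) 0) ++
          (rectList a (a + 4) 0 3).map (cellPair (out (-ring (a, 0))) 2))
        ((rectList a (a + 4) 0 3).map (cellPair (out 0) 0) ++
          (rectList a (a + 4) 0 3).map (cellPair (out (ring (a + 1, 0))) 2)) ms = true := by
    obtain ⟨-, -, -, -, nd1, nd2⟩ := rectList_nodup_cases
    by_cases h : IsWhite q
    · exact ⟨0, q, by simp, h, nd1, _, check_convert_even⟩
    · refine ⟨1, q - (1, 0), by simp, ?_, nd2, _, check_convert_odd⟩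
      simp only [IsWhite, Prod.fst_sub, Prod.snd_sub, Int.even_iff] at h ⊢
      omega
  simp only [Prod.fst_add, Prod.snd_add] at hQ hg
  set P := ((rectList a (a + 4) 0 3).map (w + ·)).toFinset with hPdef
  have hmem : ∀ v : Square, v ∈ P ↔ w.1 + a ≤ v.1 ∧ v.1 < w.1 + a + 4 ∧ w.2 ≤ v.2 ∧
      v.2 < w.2 + 3 := by
    intro v
    simp only [hPdef, List.mem_toFinset, List.mem_map, mem_rectList]
    constructor
    · rintro ⟨x, hx, rfl⟩
      simp only [Prod.fst_add, Prod.snd_add]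
      omega
    · intro h
      refine ⟨v - w, ?_, by simp⟩
      simp only [Prod.fst_sub, Prod.snd_sub]
      omega
  have key : ∀ (h h₀ : Square → ℤ) (m : ℤ),
      (∀ f : Square, a - 1 ≤ f.1 → f.1 < a + 4 → -1 ≤ f.2 → f.2 < 3 → h (w + f) = h₀ f) →
      (dimersOf ((rectList a (a + 4) 0 3).map (cellPair (out h₀) m))).map
        (Finset.image (layerMap w 0)) = hlay h P m := by
    intro h h₀ m H
    rw [hlay, lay, hPdef, List.toFinset_val, List.Nodup.dedup (hnd.map (add_right_injective w))]
    simp only [dimersOf, Multiset.map_coe, List.map_map, Multiset.coe_eq_coe]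
    refine List.Perm.of_eq (List.map_congr_left fun x hx => ?_)
    refine image_layerMap_cell_of_isWhite m hw ?_
    rw [mem_rectList] at hx
    rw [out_translate]
    congr 1
    refine out_congr ⟨H _ ?_ ?_ ?_ ?_, H _ ?_ ?_ ?_ ?_, H _ ?_ ?_ ?_ ?_, H _ ?_ ?_ ?_ ?_⟩ <;>
      simp only <;> omega
  have hsplit : ∀ L L' : List (Cube × Cube), (dimersOf (L ++ L')).map
      (Finset.image (layerMap w 0)) = (dimersOf L).map (Finset.image (layerMap w 0)) +
        (dimersOf L').map (Finset.image (layerMap w 0)) := by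
    intro L L'
    rw [dimersOf, ← Multiset.coe_add, Multiset.map_add, Multiset.map_add]
    rfl
  have hz : ∀ f : Square, a - 1 ≤ f.1 → f.1 < a + 4 → -1 ≤ f.2 → f.2 < 3 →
      g (w + f) = 0 ∧ u (w + f) = 0 := by
    intro f h1 h2 h3 h4
    apply hg <;> simp only [Prod.fst_add, Prod.snd_add] <;> omega
  have main := (reach_of_checkMoves hc).map _ (layerMap_injective w 0) (layerMap_adj w 0)
  rw [hsplit, hsplit,
    key u 0 0 (fun f h1 h2 h3 h4 => (hz f h1 h2 h3 h4).2),
    key (g - ring (w + (a, 0))) (-ring (a, 0)) 2 (fun f h1 h2 h3 h4 => by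
      simp [(hz f h1 h2 h3 h4).1, ring_add]),
    key (g + ring (w + (a, 0) + (1, 0))) (ring (a + 1, 0)) 2 (fun f h1 h2 h3 h4 => by
      simp [(hz f h1 h2 h3 h4).1, add_assoc w, ring_add])] at main
  have hPQ : P ⊆ Q := by
    intro v hv
    rw [hmem] at hv
    exact hQ v (by omega) (by omega) (by omega) (by omega)
  have hoff : hlay (g - ring (w + (a, 0))) (Q \ P) 2 =
      hlay (g + ring (w + (a, 0) + (1, 0))) (Q \ P) 2 := by
    refine lay_congr 2 fun v hv => out_congr ?_
    rw [Finset.mem_sdiff, hmem] at hv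
    have e1 : AgreeAt (ring (w + (a, 0))) 0 v :=
      ring_agreeAt (by simp only [Prod.fst_add, Prod.snd_add]; omega)
    have e2 : AgreeAt (ring (w + (a, 0) + (1, 0))) 0 v :=
      ring_agreeAt (by simp only [Prod.fst_add, Prod.snd_add]; omega)
    have := ((AgreeAt.refl g v).add (e1.smul (-1))).trans
      ((AgreeAt.refl g v).add ((e2.smul 1).trans (by simpa using AgreeAt.refl 0 v)).symm)
    simpa [sub_eq_add_neg] using this
  rw [hlay, hlay, hlay, lay_sdiff hPQ, lay_sdiff hPQ (o := out (g - _)),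
    lay_sdiff hPQ (o := out (g + _))]
  rw [hlay, hlay] at hoff
  rw [hoff, add_add_add_comm, add_add_add_comm (lay (out u) P 0) _ (lay (out (g + _)) P 2)]
  exact main.add_right _

/-! ### The parking lot -/

/-- The sum of `k` rings in a row, at distance `6` of each other, the last one at `(X, Y)`. -/
def rings (X Y : ℤ) : ℕ → Square → ℤ
  | 0 => 0
  | k + 1 => rings X Y k + ring (X - 6 * k, Y)

theorem rings_eq_zero {X Y : ℤ} {k : ℕ} {q : Square}
    (h : q.1 < X - 6 * k + 6 ∨ q.2 < Y) : rings X Y k q = 0 := by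
  induction k with
  | zero => rfl
  | succ k ih =>
    push_cast at h
    rw [rings, Pi.add_apply, ih (by omega), zero_add]
    exact ring_eq_zero (by simp only; omega)

/-- The standard height function with `n` rings around black squares, or `-n` rings around white
squares if `n` is negative. -/
def parked (X Y n : ℤ) : Square → ℤ :=
  if 0 ≤ n then rings X Y n.toNat else rings (X - 3) Y (-n).toNat

theorem parked_zero (X Y : ℤ) : parked X Y 0 = 0 := rfl

theorem parked_eq_zero_of_snd {X Y n : ℤ} {q : Square} (h : q.2 < Y) : parked X Y n q = 0 := by
  rw [parked]
  split_ifs <;> exact rings_eq_zero (Or.inr h)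

theorem parked_natCast (X Y : ℤ) (k : ℕ) : parked X Y k = rings X Y k := by
  rw [parked, if_pos (by omega), Int.toNat_natCast]

theorem parked_neg_natCast (X Y : ℤ) (k : ℕ) : parked X Y (-k) = rings (X - 3) Y k := by
  rcases Nat.eq_zero_or_pos k with rfl | h
  · rfl
  · rw [parked, if_neg (by omega), neg_neg, Int.toNat_natCast]

/-- A further ring can be parked at a suitable place. -/
theorem exists_parking_place (X Y n : ℤ) {c : ℤ} (hc : c = 1 ∨ c = -1) :
    ∃ x : ℤ, X - 6 * |n| - 3 ≤ x ∧ x ≤ X ∧ ((X - x) % 2 = 0 ↔ c = 1) ∧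
      (∀ q : Square, q.1 ≤ x + 2 → parked X Y n q = 0) ∧
      ∀ (Q : Finset Square) (g : Square → ℤ) (m : ℤ), (∀ q : Square, Y - 1 ≤ q.2 → g q = 0) →
        (∀ v : Square, x ≤ v.1 → v.1 ≤ X + 2 → Y ≤ v.2 → v.2 ≤ Y + 2 → v ∈ Q) →
        Reach (hlay (g + parked X Y n + ring (x, Y)) Q m) (hlay (g + parked X Y (n + c)) Q m) := by
  -- A new ring three units to the left of the last parked one has the other color and annihilates
  -- it. The gaps of `6` keep the other parked rings clear of this.
  have cancel : ∀ (X' : ℤ) (k : ℕ) (Q : Finset Square) (g : Square → ℤ) (m : ℤ), X' ≤ X →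
      (∀ q : Square, Y - 1 ≤ q.2 → g q = 0) →
      (∀ v : Square, X' - 6 * k - 3 ≤ v.1 → v.1 ≤ X + 2 → Y ≤ v.2 → v.2 ≤ Y + 2 → v ∈ Q) →
      Reach (hlay (g + rings X' Y (k + 1) + ring (X' - 6 * k - 3, Y)) Q m)
        (hlay (g + rings X' Y k) Q m) := by
    intro X' k Q g m hX hg hQ
    have := ring_cancel (g := g + rings X' Y k) (p := (X' - 6 * k - 3, Y)) m (Q := Q)
      (fun v h1 h2 h3 h4 => hQ v (by simpa using h1) (by simp only at h2; omega) h3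
        (by simp only at h4; omega))
      (fun q h1 h2 h3 h4 => by
        rw [Pi.add_apply, hg q h3, zero_add]
        exact rings_eq_zero (by simp only at h2; omega))
    have e : ((X' - 6 * k - 3, Y) : Square) + (3, 0) = (X' - 6 * k, Y) := by simp
    rw [e, add_right_comm] at this
    rwa [rings, ← add_assoc]
  -- Rings of positive total charge occupy the places `X - 6 * i`, those of negative charge `X - 3 -
  -- 6 * i`. The new ring extends the row if its charge has the same sign or the row is empty;
  -- otherwise it cancels the last one.
  obtain ⟨k, rfl | rfl⟩ := n.eq_nat_or_neg
  · rcases hc with rfl | rfl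
    · refine ⟨X - 6 * k, by simp, by omega, by omega, fun q hq => ?_, fun Q g m hg hQ => ?_⟩
      · rw [parked_natCast]
        exact rings_eq_zero (by omega)
      · rw [parked_natCast, show (k : ℤ) + 1 = ((k + 1 : ℕ) : ℤ) by simp, parked_natCast, rings,
          ← add_assoc]
        exact Reach.refl _
    · rcases k with _ | k
      · refine ⟨X - 3, by simp, by omega, by omega, fun q hq => rfl, fun Q g m hg hQ => ?_⟩
        rw [show ((0 : ℕ) : ℤ) + -1 = -((1 : ℕ) : ℤ) by simp, parked_neg_natCast, rings, rings,
          Nat.cast_zero, parked_zero]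
        simpa using Reach.refl _
      · refine ⟨X - 6 * k - 3, by rw [Nat.abs_cast]; push_cast; omega, by omega, by omega,
          fun q hq => ?_, fun Q g m hg hQ => ?_⟩
        · rw [parked_natCast]
          exact rings_eq_zero (by push_cast; omega)
        · rw [parked_natCast, show ((k + 1 : ℕ) : ℤ) + -1 = (k : ℤ) by simp, parked_natCast]
          exact cancel X k Q g m le_rfl hg hQ
  · rcases hc with rfl | rfl
    · rcases k with _ | k
      · refine ⟨X, by simp, by omega, by omega, fun q hq => rfl, fun Q g m hg hQ => ?_⟩
        rw [show -((0 : ℕ) : ℤ) + 1 = ((1 : ℕ) : ℤ) by simp, parked_natCast, rings, rings,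
          Nat.cast_zero, neg_zero, parked_zero]
        simpa using Reach.refl _
      · refine ⟨X - 3 - 6 * k - 3, by rw [abs_neg, Nat.abs_cast]; push_cast; omega, by omega,
          by omega, fun q hq => ?_, fun Q g m hg hQ => ?_⟩
        · rw [parked_neg_natCast]
          exact rings_eq_zero (by push_cast; omega)
        · rw [parked_neg_natCast, show -((k + 1 : ℕ) : ℤ) + 1 = -(k : ℤ) by simp,
            parked_neg_natCast]
          exact cancel (X - 3) k Q g m (by omega) hg hQ
    · refine ⟨X - 3 - 6 * k, by rw [abs_neg, Nat.abs_cast]; omega, by omega, by omega,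
        fun q hq => ?_, fun Q g m hg hQ => ?_⟩
      · rw [parked_neg_natCast]
        exact rings_eq_zero (by omega)
      · rw [parked_neg_natCast, show -(k : ℤ) + -1 = -((k + 1 : ℕ) : ℤ) by push_cast; ring,
          parked_neg_natCast, rings, ← add_assoc]
        exact Reach.refl _

/-- `1` on black squares and `-1` on white squares. -/
def sgn (v : Square) : ℤ := if IsWhite v then -1 else 1

theorem sgn_eq (v : Square) : sgn v = 1 ∨ sgn v = -1 := by
  rw [sgn]; split_ifs <;> simp

theorem sgn_eq_one {v : Square} : sgn v = 1 ↔ (v.1 + v.2) % 2 = 1 := by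
  simp only [sgn, IsWhite, Int.even_iff]
  split_ifs with h
  · simp [h]
  · simpa using h

/-- A ring moves to the parking lot. -/
theorem park {X Y n s : ℤ} (hXY : (X + Y) % 2 = 1) (hs : s = 1 ∨ s = -1) {u g : Square → ℤ}
    {p : Square} {Q : Finset Square} (hp1 : p.1 + 6 * |n| + 4 ≤ X) (hp2 : p.2 ≤ Y)
    (hg : ∀ q : Square, p.2 - 1 ≤ q.2 → g q = 0) (hu : ∀ q : Square, Y - 1 ≤ q.2 → u q = 0)
    (hQ : ∀ v : Square, p.1 ≤ v.1 → v.1 ≤ X + 2 → p.2 ≤ v.2 → v.2 ≤ Y + 2 → v ∈ Q) :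
    Reach (hlay u Q 0 + hlay (g + parked X Y n + s • ring p) Q 2)
      (hlay u Q 0 + hlay (g + parked X Y (n + s * sgn p)) Q 2) := by
  have hsgn := sgn_eq_one (v := p)
  have key : s * sgn p = 1 ∨ s * sgn p = -1 := by
    rcases hs with rfl | rfl <;> rcases sgn_eq p with h | h <;> simp [h]
  obtain ⟨x, h1, h2, h3, h4, h5⟩ := exists_parking_place X Y n key
  have h5' := h5 Q g 2 (fun q hq => hg q (by omega)) (fun v e1 e2 e3 e4 =>
    hQ v (by omega) (by omega) (by omega) (by omega))
  have hzero : ∀ q : Square, q.1 ≤ x + 2 → p.2 - 1 ≤ q.2 → (g + parked X Y n) q = 0 :=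
    fun q e1 e2 => by rw [Pi.add_apply, hg q e2, h4 q e1, add_zero]
  rcases hs with rfl | rfl
  · refine Reach.trans (Reach.add_left ?_ _) (h5'.add_left _)
    rw [one_mul] at h3
    obtain ⟨k, hk⟩ : ∃ k : ℕ, x - p.1 + (Y - p.2) = 2 * k :=
      ⟨((x - p.1 + (Y - p.2)) / 2).toNat, by omega⟩
    have := ring_move (Or.inl rfl) (g := g + parked X Y n) 2 (Q := Q) (p' := (x, Y)) k
      (p := p) (by simp only; omega) hp2 hk
      (fun v e1 e2 e3 e4 => hQ v e1 (by simp only at e2; omega) e3 e4)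
      (fun q e1 e2 e3 e4 => hzero q e2 e3)
    simpa using this
  -- A negative ring has to stop at `x - 1`, so that its conversion to a positive ring puts it
  -- exactly at the parking place `x`.
  · obtain ⟨k, hk⟩ : ∃ k : ℕ, x - 1 - p.1 + (Y - p.2) = 2 * k := by
      refine ⟨((x - 1 - p.1 + (Y - p.2)) / 2).toNat, ?_⟩
      rcases sgn_eq p with h | h <;> rw [h] at h3 hsgn <;> omega
    have m1 := ring_move (Or.inr rfl) (g := g + parked X Y n) 2 (Q := Q) (p' := (x - 1, Y)) k
      (p := p) (by simp only; omega) hp2 hk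
      (fun v e1 e2 e3 e4 => hQ v e1 (by simp only at e2; omega) e3 e4)
      (fun q e1 e2 e3 e4 => hzero q (by simp only at e2; omega) e3)
    have m2 := ring_convert (u := u) (g := g + parked X Y n) (q := (x - 1, Y)) (Q := Q)
      (fun v e1 e2 e3 e4 => by
        simp only at e1 e2 e3 e4
        exact hQ v (by omega) (by omega) (by omega) (by omega))
      (fun f e1 e2 e3 e4 => by
        simp only at e1 e2 e3 e4
        exact ⟨hzero f (by omega) (by omega), hu f (by omega)⟩)
    refine (m1.add_left _).trans (Reach.trans ?_ (h5'.add_left _))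
    simpa [sub_eq_add_neg] using m2

/-! ### Valid height functions and reflection -/

/-- The four faces around every square have at most two values `k`, `k + 1`, not in a
checkerboard pattern. -/
def ValidAt (h : Square → ℤ) (v : Square) : Prop :=
  (h (v.1, v.2) - h (v.1 - 1, v.2) ≤ 1 ∧ h (v.1 - 1, v.2) - h (v.1, v.2) ≤ 1) ∧
  (h (v.1, v.2) - h (v.1, v.2 - 1) ≤ 1 ∧ h (v.1, v.2 - 1) - h (v.1, v.2) ≤ 1) ∧
  (h (v.1, v.2) - h (v.1 - 1, v.2 - 1) ≤ 1 ∧ h (v.1 - 1, v.2 - 1) - h (v.1, v.2) ≤ 1) ∧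
  (h (v.1 - 1, v.2) - h (v.1, v.2 - 1) ≤ 1 ∧ h (v.1, v.2 - 1) - h (v.1 - 1, v.2) ≤ 1) ∧
  (h (v.1 - 1, v.2) - h (v.1 - 1, v.2 - 1) ≤ 1 ∧ h (v.1 - 1, v.2 - 1) - h (v.1 - 1, v.2) ≤ 1) ∧
  (h (v.1, v.2 - 1) - h (v.1 - 1, v.2 - 1) ≤ 1 ∧ h (v.1 - 1, v.2 - 1) - h (v.1, v.2 - 1) ≤ 1) ∧
  ¬ (h (v.1, v.2) = h (v.1 - 1, v.2 - 1) ∧ h (v.1 - 1, v.2) = h (v.1, v.2 - 1) ∧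
    h (v.1, v.2) ≠ h (v.1, v.2 - 1))

theorem ValidAt.congr {g h : Square → ℤ} {v : Square} (H : AgreeAt g h v) (hg : ValidAt g v) :
    ValidAt h v := by
  obtain ⟨h1, h2, h3, h4⟩ := H
  rw [ValidAt, h1, h2, h3, h4] at hg
  exact hg

theorem validAt_ring (p v : Square) : ValidAt (ring p) v := by
  simp only [ValidAt, ring]
  split_ifs <;> omega

/-- Negating the heights exchanges the left and right sides of the strands and so reverses them. In
particular the strands form a permutation, which is what `out_injective` extracts. -/
theorem out_neg_out {h : Square → ℤ} (hv : ∀ v, ValidAt h v) (v : Square) :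
    out (-h) (out h v) = v := by
  obtain ⟨x, y⟩ := v
  have h0 := hv (x, y)
  have h1 := hv (x + 1, y)
  have h2 := hv (x, y + 1)
  have h3 := hv (x - 1, y)
  have h4 := hv (x, y - 1)
  simp only [ValidAt, add_sub_cancel_right] at h0 h1 h2 h3 h4
  rw [out.eq_1 h]
  split_ifs with c1 c2 c3 c4 <;> simp only at c1
  · rw [out, if_neg, if_neg, if_pos] <;> simp only [Pi.neg_apply, add_sub_cancel_right] <;> omega
  · simp only at c2
    rw [out, if_neg, if_neg, if_neg, if_pos] <;>
      simp only [Pi.neg_apply, add_sub_cancel_right] <;> omega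
  · simp only at c2 c3
    rw [out, if_pos] <;> simp only [Pi.neg_apply, sub_add_cancel]
    omega
  · simp only at c2 c3 c4
    rw [out, if_neg, if_pos] <;> simp only [Pi.neg_apply, sub_add_cancel] <;> omega
  · simp only at c2 c3 c4
    rw [out, if_neg, if_neg, if_neg, if_neg] <;> simp only [Pi.neg_apply] <;> omega

theorem out_injective {h : Square → ℤ} (hv : ∀ v, ValidAt h v) : Function.Injective (out h) :=
  (show Function.LeftInverse (out (-h)) (out h) from out_neg_out hv).injective

theorem out_out_ne {h : Square → ℤ} (hv : ∀ v, ValidAt h v) {v : Square} (hne : out h v ≠ v) :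
    out h (out h v) ≠ out h v := fun he => hne (out_injective hv he)

theorem out_adj (h : Square → ℤ) (v : Square) (m : ℤ) (hne : out h v ≠ v) :
    Adj (v, m) (out h v, m) := by
  rw [adj_iff]
  rw [out] at hne ⊢
  split_ifs at hne ⊢ <;> first | exact absurd rfl hne | simp

theorem isWhite_out {h : Square → ℤ} {v : Square} (hne : out h v ≠ v) :
    IsWhite (out h v) ↔ ¬ IsWhite v := by
  have := out_adj h v 0 hne
  rw [adj_iff] at this
  simp only [IsWhite, Int.even_iff] at this ⊢
  omega

/-- The reflection that exchanges the floors `m` and `m + 1`. -/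
def mirror (m : ℤ) (c : Cube) : Cube := (c.1, 2 * m + 1 - c.2)

theorem mirror_injective (m : ℤ) : Function.Injective (mirror m) := by
  rintro ⟨a, z⟩ ⟨b, w⟩ h
  simp only [mirror, Prod.mk.injEq] at h
  exact Prod.ext h.1 (by simp only; omega)

theorem mirror_adj (m : ℤ) (a b : Cube) (h : Adj a b) : Adj (mirror m a) (mirror m b) := by
  rw [adj_iff] at h ⊢
  simp only [mirror]
  omega

/-- Reversing an edge makes it leave from its other end, of the other color, and hence moves its
dimer to the other floor. The multiset is reindexed along `out h`, because the reversed strands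
attach each dimer to the square it used to enter. -/
theorem hlay_neg {h : Square → ℤ} (hv : ∀ v, ValidAt h v) {Q : Finset Square}
    (hQ : ∀ v, out h v ≠ v → v ∈ Q) (m : ℤ) :
    hlay (-h) Q m = (hlay h Q m).map (Finset.image (mirror m)) := by
  have hmaps : ∀ v ∈ Q, out h v ∈ Q := fun v hvQ => by
    by_cases hne : out h v = v
    · rwa [hne]
    · exact hQ _ (out_out_ne hv hne)
  have himg : Q.image (out h) = Q :=
    Finset.eq_of_subset_of_card_le (Finset.image_subset_iff.2 hmaps)
      (Finset.card_image_of_injective _ (out_injective hv)).ge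
  have hmap : Q.val.map (out h) = Q.val := by
    have := Finset.image_val_of_injOn ((out_injective hv).injOn (s := Q))
    rw [himg] at this
    exact this.symm
  rw [hlay, lay, ← hmap, hlay, lay, Multiset.map_map, Multiset.map_map]
  refine Multiset.map_congr rfl fun v _ => ?_
  have e1 : ∀ w : Square, mirror m (w, m) = (w, m + 1) := fun w => by simp [mirror]; ring
  have e2 : ∀ w : Square, mirror m (w, m + 1) = (w, m) := fun w => by simp [mirror]; ring
  simp only [Function.comp_apply, cell, cellPair, out_neg_out hv]
  by_cases hne : out h v = v
  · simp [hne, pairSet, Finset.image_insert, e1, e2, Finset.pair_comm]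
  · have hw := isWhite_out hne
    by_cases hv' : IsWhite v
    · simp [hne, Ne.symm hne, hw, hv', pairSet, Finset.image_insert, e1, Finset.pair_comm]
    · simp [hne, Ne.symm hne, hw, hv', pairSet, Finset.image_insert, e2, Finset.pair_comm]

theorem hlay_reach_neg {h h' : Square → ℤ} (hv : ∀ v, ValidAt h v) (hv' : ∀ v, ValidAt h' v)
    {Q : Finset Square} (hQ : ∀ v, out h v ≠ v → v ∈ Q) (hQ' : ∀ v, out h' v ≠ v → v ∈ Q) {m : ℤ}
    (H : Reach (hlay h Q m) (hlay h' Q m)) : Reach (hlay (-h) Q m) (hlay (-h') Q m) := by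
  rw [hlay_neg hv hQ, hlay_neg hv' hQ']
  exact H.map _ (mirror_injective m) (mirror_adj m)

/-! ### Removing a face -/

/-- The indicator function of a set of faces. -/
def ind (S : Finset Square) (p : Square) : ℤ := if p ∈ S then 1 else 0

theorem ind_of_mem {S : Finset Square} {p : Square} (h : p ∈ S) : ind S p = 1 := if_pos h

theorem ind_of_notMem {S : Finset Square} {p : Square} (h : p ∉ S) : ind S p = 0 := if_neg h

/-- The strands around a set of faces do not meet. -/
def NoCheckerboard (S : Finset Square) : Prop := ∀ v, ValidAt (ind S) v

theorem noCheckerboard_iff {S : Finset Square} : NoCheckerboard S ↔ ∀ x y : ℤ,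
    ¬ ((x, y) ∈ S ∧ (x - 1, y - 1) ∈ S ∧ (x - 1, y) ∉ S ∧ (x, y - 1) ∉ S) ∧
    ¬ ((x, y) ∉ S ∧ (x - 1, y - 1) ∉ S ∧ (x - 1, y) ∈ S ∧ (x, y - 1) ∈ S) := by
  rw [NoCheckerboard, Prod.forall]
  refine forall₂_congr fun x y => ?_
  by_cases h1 : (x, y) ∈ S <;> by_cases h2 : (x - 1, y - 1) ∈ S <;>
    by_cases h3 : (x - 1, y) ∈ S <;> by_cases h4 : (x, y - 1) ∈ S <;>
    simp [ValidAt, ind, h1, h2, h3, h4]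

/-- The squares in the interior of a set of faces. -/
def interior (S : Finset Square) : Finset Square :=
  S.filter fun v => (v.1 - 1, v.2) ∈ S ∧ (v.1, v.2 - 1) ∈ S ∧ (v.1 - 1, v.2 - 1) ∈ S

theorem mem_interior {S : Finset Square} {x y : ℤ} : (x, y) ∈ interior S ↔
    (x, y) ∈ S ∧ (x - 1, y) ∈ S ∧ (x, y - 1) ∈ S ∧ (x - 1, y - 1) ∈ S := by
  simp [interior]

theorem mem_interior_erase {S : Finset Square} {a b x y : ℤ} :
    (x, y) ∈ interior (S.erase (a, b)) ↔ (x, y) ∈ interior S ∧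
      ¬ ((x = a ∨ x = a + 1) ∧ (y = b ∨ y = b + 1)) := by
  simp only [mem_interior, Finset.mem_erase, ne_eq, Prod.mk.injEq]
  constructor
  · rintro ⟨⟨h1, k1⟩, ⟨h2, k2⟩, ⟨h3, k3⟩, ⟨h4, k4⟩⟩
    exact ⟨⟨k1, k2, k3, k4⟩, by omega⟩
  · rintro ⟨⟨k1, k2, k3, k4⟩, h⟩
    exact ⟨⟨by omega, k1⟩, ⟨by omega, k2⟩, ⟨by omega, k3⟩, ⟨by omega, k4⟩⟩

/-- The four corners of the face at the origin. -/
def corners : List Square := [(0, 0), (1, 0), (0, 1), (1, 1)]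

theorem ind_erase_add (S : Finset Square) (p q : Square) : ind (S.erase p) (p + q) =
    if q = (0, 0) then 0 else ind S (p + q) := by
  simp only [ind, Finset.mem_erase, ne_eq, add_eq_left]
  by_cases h : q = (0, 0)
  · rw [if_pos h, if_neg (fun hh => hh.1 h)]
  · rw [if_neg h]; simp only [show ¬ q = 0 from h, not_false_eq_true, true_and]

theorem agreeAt_update {H : Square → ℤ} {y : Square} (hy : y ∉ corners) :
    AgreeAt H (fun q => if q = (0, 0) then 0 else H q) y := by
  obtain ⟨a, b⟩ := y
  simp only [corners, List.mem_cons, Prod.mk.injEq, List.not_mem_nil, or_false, not_or] at hy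
  refine ⟨?_, ?_, ?_, ?_⟩ <;> refine (if_neg ?_).symm <;> simp only [Prod.mk.injEq] <;> omega

/-- Deleting a face affects the strands at its four corners only. `P` lists the corners whose dimers
move; a corner outside `P` keeps its outgoing edge, though its incoming one may change. -/
theorem erase_reach {S : Finset Square} {p : Square} {P : List Square} {o₀ o₁ : Square → Square}
    {ms : List (ℤ × ℤ × ℤ × ℕ)}
    (hc : checkMoves (P.map (cellPair o₀ 0)) (P.map (cellPair o₁ 0)) ms = true) (hP : P.Nodup)
    (hPc : P ⊆ corners) {H : Square → ℤ} (hH : H = fun q => ind S (p + q))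
    (h0 : ∀ x ∈ P, out H x = o₀ x)
    (h1 : ∀ x ∈ P, out (fun q => if q = (0, 0) then 0 else H q) x = o₁ x)
    (h2 : ∀ x ∈ corners, x ∉ P → out H x = out (fun q => if q = (0, 0) then 0 else H q) x)
    {Q : Finset Square} (hQ : ∀ x ∈ corners, p + x ∈ Q) (m : ℤ) :
    Reach (hlay (ind S) Q m) (hlay (ind (S.erase p)) Q m) := by
  have hH' : (fun q => ind (S.erase p) (p + q)) = fun q => if q = (0, 0) then 0 else H q := by
    funext q; rw [ind_erase_add, hH]
  refine lay_reach_of_check hc hP p m (fun x hx => hQ x (hPc hx)) (fun x hx => ?_)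
    (fun x hx => ?_) fun v hv => ?_
  · rw [out_translate, ← hH, h0 x hx]
  · rw [out_translate, hH', h1 x hx]
  · obtain ⟨y, rfl⟩ : ∃ y, v = p + y := ⟨v - p, by simp⟩
    rw [out_translate, out_translate, ← hH, hH']
    by_cases hy : y ∈ corners
    · rw [h2 y hy fun hyP => hv y hyP rfl]
    · rw [out_congr (agreeAt_update hy)]

/-! ### Local moves that remove a face -/

theorem check_isolated : checkMoves
    ([(0, 0), (1, 0), (1, 1), (0, 1)].map (cellPair (fun x : Square => if x = (0, 0) then (0, 1)
      else if x = (0, 1) then (1, 1) else if x = (1, 1) then (1, 0) else (0, 0)) 0))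
    ([(0, 0), (1, 0), (1, 1), (0, 1)].map (cellPair id 0))
    [(0, 0, 1, 0), (1, 0, 0, 3), (0, 0, 0, 3)] = true := by decide +kernel

theorem check_upper : checkMoves
    ([(0, 0), (0, 1), (1, 1)].map (cellPair (fun x : Square => if x = (0, 0) then (0, 1)
      else if x = (0, 1) then (1, 1) else (1, 0)) 0))
    ([(0, 0), (0, 1), (1, 1)].map (cellPair (fun x => if x = (0, 0) then (1, 0) else x) 0))
    [(0, 0, 0, 2), (0, 1, 0, 1)] = true := by decide +kernel

theorem check_left : checkMoves
    ([(0, 1), (1, 1), (1, 0)].map (cellPair (fun x : Square => if x = (0, 1) then (1, 1)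
      else if x = (1, 1) then (1, 0) else (0, 0)) 0))
    ([(0, 1), (1, 1), (1, 0)].map (cellPair (fun x => if x = (0, 1) then (0, 0) else x) 0))
    [(0, 0, 1, 0), (1, 0, 0, 3)] = true := by decide +kernel

theorem check_right : checkMoves
    ([(1, 0), (0, 0), (0, 1)].map (cellPair (fun x : Square => if x = (1, 0) then (0, 0)
      else if x = (0, 0) then (0, 1) else (1, 1)) 0))
    ([(1, 0), (0, 0), (0, 1)].map (cellPair (fun x => if x = (1, 0) then (1, 1) else x) 0))
    [(0, 0, 1, 0), (0, 0, 0, 3)] = true := by decide +kernel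

/-- Two antiparallel edges on opposite sides of the face are reconnected by one flip. -/
theorem check_saddle : checkMoves
    ([(1, 0), (0, 1)].map (cellPair (fun x : Square => if x = (1, 0) then (0, 0)
      else (1, 1)) 0))
    ([(1, 0), (0, 1)].map (cellPair (fun x => if x = (1, 0) then (1, 1) else (0, 0)) 0))
    [(0, 0, 1, 0)] = true := by decide +kernel

theorem ind_cases (S : Finset Square) (p : Square) : ind S p = 0 ∨ ind S p = 1 := by
  rw [ind]; split_ifs <;> simp

/-- The height function of a quadrant. -/
def quadrant (q : Square) : ℤ := if q.1 ≤ 0 ∧ q.2 ≤ 0 then 1 else 0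

/-- The height function of a quadrant whose corner was removed, with a ring below it. -/
def cutQuadrant (q : Square) : ℤ :=
  (if q = (0, 0) then 0 else quadrant q) + ring (-1, 3) q

/-- The squares in which a strand is swept over a jewel. -/
def tritList : List Square := [(-1, 1), (0, 1), (1, 1), (0, 0)] ++ rectList (-1) 2 2 6

theorem check_trit : checkMoves (tritList.map (cellPair (out quadrant) 0))
    (tritList.map (cellPair (out cutQuadrant) 0)) tritMoves = true := by decide +kernel

theorem tritList_nodup : tritList.Nodup := by decide +kernel

/-- The corner of `S` at `p` is cut off, so the strand passes to the other side of the jewel `p`,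
which flips in two floors cannot do for free. The empty rows below supply the room for a
compensating ring around `p + (0, 4)`, a square of the same color as `p`. -/
theorem trit_reach {S : Finset Square} {p : Square} {H : Square → ℤ}
    (hH : H = fun q => ind S (p + q)) (h00 : H (0, 0) = 1) (hU : H (0, -1) = 1)
    (hL : H (-1, 0) = 1) (hUL : H (-1, -1) = 1) (hR : H (1, 0) = 0)
    (hD : ∀ i j, 1 ≤ j → H (i, j) = 0) {Q : Finset Square} (hQ : ∀ x ∈ tritList, p + x ∈ Q)
    (m : ℤ) :
    Reach (hlay (ind S) Q m) (hlay (ind (S.erase p) + ring (p + (-1, 3))) Q m) := by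
  set H' : Square → ℤ := fun q => (if q = (0, 0) then 0 else H q) + ring (-1, 3) q with hH'def
  have hH' : (fun q => (ind (S.erase p) + ring (p + (-1, 3))) (p + q)) = H' := by
    funext q; rw [Pi.add_apply, ind_erase_add, ring_add, hH'def, hH]
  have hH'' : ∀ i j, j ≤ 2 → H' (i, j) = if i = 0 ∧ j = 0 then 0 else H (i, j) := fun i j hj => by
    simp only [hH'def, Prod.mk.injEq]
    rw [ring_eq_zero (by simp only; omega), add_zero]
  have k0 : ∀ x ∈ tritList, out H x = out quadrant x := by
    intro x hx
    rw [tritList, List.mem_append] at hx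
    rcases hx with hx | hx
    · simp only [List.mem_cons, List.not_mem_nil, or_false] at hx
      rcases hx with rfl | rfl | rfl | rfl <;> simp [out, quadrant, *, -hH, -hH', -hH'def]
    · rw [mem_rectList] at hx
      refine out_congr ⟨?_, ?_, ?_, ?_⟩ <;> rw [hD _ _ (by omega), quadrant, if_neg] <;>
        simp only <;> omega
  have k1 : ∀ x ∈ tritList, out H' x = out cutQuadrant x := by
    intro x hx
    rw [tritList, List.mem_append] at hx
    rcases hx with hx | hx
    · simp only [List.mem_cons, List.not_mem_nil, or_false] at hx
      rcases hx with rfl | rfl | rfl | rfl <;>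
        simp [out, cutQuadrant, quadrant, ring_eq_zero, *, -hH, -hH', -hH'def]
    · rw [mem_rectList] at hx
      have key : ∀ i j, 1 ≤ j → H' (i, j) = cutQuadrant (i, j) := fun i j hj => by
        have hne : ((i, j) : Square) ≠ (0, 0) := by simp only [ne_eq, Prod.mk.injEq]; omega
        simp only [hH'def, cutQuadrant, if_neg hne, hD i j hj, quadrant]
        rw [if_neg (by omega)]
      refine out_congr ⟨?_, ?_, ?_, ?_⟩ <;> exact key _ _ (by omega)
  refine lay_reach_of_check check_trit tritList_nodup p m hQ (fun x hx => ?_)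
    (fun x hx => ?_) fun v hv => ?_
  · rw [out_translate, ← hH, k0 x hx]
  · rw [out_translate, hH', k1 x hx]
  · obtain ⟨y, rfl⟩ : ∃ y, v = p + y := ⟨v - p, by simp⟩
    rw [out_translate, out_translate, ← hH, hH']
    congr 1
    have hy : y ∉ tritList := fun hy => hv y hy rfl
    rw [tritList, List.mem_append, not_or, mem_rectList] at hy
    obtain ⟨hy1, hy2⟩ := hy
    have hr : AgreeAt (ring (-1, 3)) 0 y := ring_agreeAt (by simp only; omega)
    have e1 : out H' y = out (fun q => if q = (0, 0) then 0 else H q) y :=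
      out_congr (by
        have := (AgreeAt.refl (fun q => if q = (0, 0) then 0 else H q) y).add hr
        rwa [add_zero] at this)
    rw [e1]
    by_cases hy : y ∈ corners
    -- This is the one corner that is not in `tritList`: the face `(1, -1)` is not controlled, but
    -- for either of its values the outgoing edge at `(1, 0)` stays the same.
    · obtain rfl : y = (1, 0) := by
        simp only [corners, List.mem_cons, List.not_mem_nil, or_false] at hy hy1
        tauto
      have := ind_cases S (p + (1, -1))
      have h1 : H (1, -1) = ind S (p + (1, -1)) := by rw [hH]
      rw [← h1] at this
      clear h1
      rcases this with h | h <;> simp [out, *, -hH, -hH', -hH'def]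
    · exact out_congr (agreeAt_update hy)

/-- A new checkerboard could only appear at a corner of the deleted face: `hUL` excludes the upper
left one, `hR` the upper right one, and `hD` both lower ones. -/
theorem noCheckerboard_erase {S : Finset Square} (hS : NoCheckerboard S) {a b : ℤ}
    (hR : (a + 1, b) ∉ S ∨ (a + 1, b - 1) ∈ S ∨ (a, b - 1) ∉ S)
    (hD : ∀ x, (x, b + 1) ∉ S)
    (hUL : ¬ ((a, b - 1) ∈ S ∧ (a - 1, b) ∈ S ∧ (a - 1, b - 1) ∉ S)) :
    NoCheckerboard (S.erase (a, b)) := by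
  rw [noCheckerboard_iff] at hS ⊢
  intro x y
  have h := hS x y
  simp only [Finset.mem_erase, ne_eq, Prod.mk.injEq]
  by_cases h1 : x = a ∧ y = b
  · obtain ⟨rfl, rfl⟩ := h1
    refine ⟨by simp, ?_⟩
    rintro ⟨-, h2, h3, h4⟩
    exact hUL ⟨h4.2, h3.2, fun h5 => h2 ⟨by omega, h5⟩⟩
  by_cases h2 : x = a + 1 ∧ y = b
  · obtain ⟨rfl, rfl⟩ := h2
    simp only [add_sub_cancel_right] at h ⊢
    refine ⟨?_, by simp⟩
    rintro ⟨h3, h4, -, h6⟩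
    rcases hR with hR | hR | hR
    · exact hR h3.2
    · exact h6 ⟨by omega, hR⟩
    · exact hR h4.2
  by_cases h3 : x = a ∧ y = b + 1
  · obtain ⟨rfl, rfl⟩ := h3
    have := hD x
    have := hD (x - 1)
    simp only [add_sub_cancel_right] at h ⊢
    tauto
  by_cases h4 : x = a + 1 ∧ y = b + 1
  · obtain ⟨rfl, rfl⟩ := h4
    have := hD a
    have := hD (a + 1)
    simp only [add_sub_cancel_right] at h ⊢
    tauto
  · have e1 : ¬ (x - 1 = a ∧ y = b) := by omega
    have e2 : ¬ (x = a ∧ y - 1 = b) := by omega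
    have e3 : ¬ (x - 1 = a ∧ y - 1 = b) := by omega
    simpa [h1, e1, e2, e3] using h

theorem interior_erase_eq {S : Finset Square} {a b : ℤ}
    (h : ∀ x y : ℤ, (x = a ∨ x = a + 1) → (y = b ∨ y = b + 1) → (x, y) ∉ interior S) :
    interior (S.erase (a, b)) = interior S := by
  ext ⟨x, y⟩
  rw [mem_interior_erase]
  have := h x y
  tauto

theorem exists_lowest_face {S : Finset Square} (hS : S.Nonempty) : ∃ a b : ℤ, (a, b) ∈ S ∧
    (∀ x y, b < y → (x, y) ∉ S) ∧ ∀ x, a < x → (x, b) ∉ S := by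
  obtain ⟨⟨a, b⟩, h1, h2⟩ := S.exists_max_image (fun q => toLex (q.2, q.1)) hS
  refine ⟨a, b, h1, fun x y hy hm => ?_, fun x hx hm => ?_⟩
  · have := h2 _ hm
    rw [Prod.Lex.le_iff] at this
    simp only [ofLex_toLex] at this
    omega
  · have := h2 _ hm
    rw [Prod.Lex.le_iff] at this
    simp only [ofLex_toLex] at this
    omega

/-- A face can be removed, at the cost of a ring in the case of a jewel. -/
theorem exists_erase {S : Finset Square} (hS : S.Nonempty) (hv : NoCheckerboard S) {R : ℤ}
    (hR : ∀ q ∈ S, |q.1| ≤ R ∧ |q.2| ≤ R) {Q : Finset Square}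
    (hQ : ∀ v : Square, |v.1| ≤ R + 6 → |v.2| ≤ R + 6 → v ∈ Q) :
    ∃ p ∈ S, NoCheckerboard (S.erase p) ∧
      ((interior (S.erase p) = interior S ∧
          ∀ m, Reach (hlay (ind S) Q m) (hlay (ind (S.erase p)) Q m)) ∨
        ((∀ q ∈ S, q.2 ≤ p.2) ∧ p ∉ interior (S.erase p) ∧
          interior S = insert p (interior (S.erase p)) ∧
          ∀ m, Reach (hlay (ind S) Q m) (hlay (ind (S.erase p) + ring (p + (-1, 3))) Q m))) := by
  obtain ⟨a, b, hab, hlow, hright⟩ := exists_lowest_face hS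
  have hlow1 : ∀ x, (x, b + 1) ∉ S := fun x => hlow x _ (by omega)
  have hright1 := hright (a + 1) (by omega)
  have hb0 := hR _ hab
  simp only [abs_le] at hb0 hQ
  have hQc : ∀ x ∈ corners, ((a, b) : Square) + x ∈ Q := by
    intro x hx
    simp only [corners, List.mem_cons, List.not_mem_nil, or_false] at hx
    rcases hx with rfl | rfl | rfl | rfl <;> apply hQ <;> simp <;> omega
  have hchk := hv
  rw [noCheckerboard_iff] at hchk
  -- The face `(a, b)` is the last one of the lowest row, so only its upper, left and upper left
  -- neighbors matter. If all three are present, the square `(a, b)` is an interior jewel and a ring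
  -- is unavoidable.
  by_cases hU : (a, b - 1) ∈ S <;> by_cases hL : (a - 1, b) ∈ S
  · by_cases hUL : (a - 1, b - 1) ∈ S
    · refine ⟨(a, b), hab, noCheckerboard_erase hv (Or.inl hright1) hlow1 (by tauto),
        Or.inr ⟨?_, ?_, ?_, fun m => ?_⟩⟩
      · rintro ⟨x, y⟩ hq
        by_contra hlt
        exact hlow x y (by simpa using hlt) hq
      · rw [mem_interior_erase]; simp
      · ext ⟨x, y⟩
        rw [Finset.mem_insert, mem_interior_erase, Prod.mk.injEq]
        constructor
        · intro h
          by_cases hxy : x = a ∧ y = b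
          · exact Or.inl hxy
          · refine Or.inr ⟨h, ?_⟩
            rw [mem_interior] at h
            rintro ⟨rfl | rfl, rfl | rfl⟩
            · exact hxy ⟨rfl, rfl⟩
            · exact hlow1 _ h.1
            · exact hright1 h.1
            · exact hlow1 _ h.1
        · rintro (⟨rfl, rfl⟩ | h)
          · rw [mem_interior]; exact ⟨hab, hL, hU, hUL⟩
          · exact h.1
      · refine trit_reach rfl ?_ ?_ ?_ ?_ ?_ ?_ ?_ m
        · simpa using ind_of_mem hab
        · simpa [← sub_eq_add_neg] using ind_of_mem hU
        · simpa [← sub_eq_add_neg] using ind_of_mem hL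
        · simpa [← sub_eq_add_neg] using ind_of_mem hUL
        · simpa using ind_of_notMem hright1
        · exact fun i j hj => ind_of_notMem (hlow _ _ (by omega))
        · intro x hx
          rw [tritList, List.mem_append, mem_rectList] at hx
          simp only [List.mem_cons, List.not_mem_nil, or_false] at hx
          apply hQ <;> rcases hx with (rfl | rfl | rfl | rfl) | hx <;> simp <;> omega
    -- Removing `(a, b)` would leave `(a, b - 1)` and `(a - 1, b)` in a checkerboard. The left
    -- neighbor is removed instead; its upper neighbor is absent, so no interior square is lost.
    · have hab' : (a - 1, b) ∈ S := hL
      have hQl : ∀ x ∈ corners, ((a - 1, b) : Square) + x ∈ Q := by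
        intro x hx
        simp only [corners, List.mem_cons, List.not_mem_nil, or_false] at hx
        rcases hx with rfl | rfl | rfl | rfl <;> apply hQ <;> simp <;> omega
      refine ⟨(a - 1, b), hL, noCheckerboard_erase hv (Or.inr (Or.inr hUL)) hlow1 (by tauto),
        Or.inl ⟨?_, fun m => ?_⟩⟩
      · refine interior_erase_eq ?_
        rintro x y (rfl | rfl) (rfl | rfl) h <;> rw [mem_interior] at h
        · exact hUL h.2.2.1
        · exact hlow1 _ h.1
        · simp only [sub_add_cancel] at h
          exact hUL h.2.2.2
        · exact hlow1 _ h.1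
      · obtain ⟨H, hH⟩ : ∃ H : Square → ℤ, H = fun q => ind S ((a - 1, b) + q) := ⟨_, rfl⟩
        have f00 : H (0, 0) = 1 := by rw [hH]; simpa using ind_of_mem hL
        have f10 : H (1, 0) = 1 := by rw [hH]; simpa using ind_of_mem hab
        have f01 : H (0, 1) = 0 := by rw [hH]; simpa using ind_of_notMem (hlow1 _)
        have f11 : H (1, 1) = 0 := by rw [hH]; simpa using ind_of_notMem (hlow1 _)
        have fm1 : H (-1, 1) = 0 := by
          rw [hH]; simpa using ind_of_notMem (hlow1 (a - 1 + -1))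
        have f0m : H (0, -1) = 0 := by
          rw [hH]; simpa [← sub_eq_add_neg] using ind_of_notMem hUL
        have f1m : H (1, -1) = 1 := by
          rw [hH]; simpa [← sub_eq_add_neg] using ind_of_mem hU
        by_cases hLL : (a - 1 - 1, b) ∈ S
        · have fm0 : H (-1, 0) = 1 := by
            rw [hH]; simpa [← sub_eq_add_neg] using ind_of_mem hLL
          have fmm : H (-1, -1) = 0 ∨ H (-1, -1) = 1 := by rw [hH]; exact ind_cases _ _
          refine erase_reach check_saddle (by decide) (by decide) hH ?_ ?_ ?_ hQl m
          · simp [out, *, -hH]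
          · simp [out, *, -hH]
          · intro x hx hxP
            simp only [corners, List.mem_cons, List.not_mem_nil, or_false] at hx hxP
            obtain rfl | rfl : x = (0, 0) ∨ x = (1, 1) := by tauto
            · rcases fmm with fmm | fmm <;> simp [out, *, -hH]
            · simp [out, *, -hH]
        · have fm0 : H (-1, 0) = 0 := by
            rw [hH]; simpa [← sub_eq_add_neg] using ind_of_notMem hLL
          have fmm : H (-1, -1) = 0 := by
            rw [hH]
            refine ind_of_notMem fun h => (hchk (a - 1) b).1 ⟨hL, ?_, hLL, hUL⟩
            simpa [← sub_eq_add_neg] using h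
          refine erase_reach check_right (by decide) (by decide) hH ?_ ?_ ?_ hQl m
          · simp [out, *, -hH]
          · simp [out, *, -hH]
          · intro x hx hxP
            simp only [corners, List.mem_cons, List.not_mem_nil, or_false] at hx hxP
            obtain rfl : x = (1, 1) := by tauto
            simp [out, *, -hH]
  all_goals
    refine ⟨(a, b), hab, noCheckerboard_erase hv (Or.inl hright1) hlow1 (by tauto),
      Or.inl ⟨?_, fun m => ?_⟩⟩
    · refine interior_erase_eq ?_
      rintro x y (rfl | rfl) (rfl | rfl) h <;> rw [mem_interior] at h
      · exact absurd h (by tauto)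
      · exact hlow1 _ h.1
      · exact hright1 h.1
      · exact hlow1 _ h.1
    obtain ⟨H, hH⟩ : ∃ H : Square → ℤ, H = fun q => ind S ((a, b) + q) := ⟨_, rfl⟩
    have f00 : H (0, 0) = 1 := by rw [hH]; simpa using ind_of_mem hab
    have f10 : H (1, 0) = 0 := by rw [hH]; simpa using ind_of_notMem hright1
    have f01 : H (0, 1) = 0 := by rw [hH]; simpa using ind_of_notMem (hlow1 _)
    have f11 : H (1, 1) = 0 := by rw [hH]; simpa using ind_of_notMem (hlow1 _)
    have fm1 : H (-1, 1) = 0 := by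
      rw [hH]; simpa using ind_of_notMem (hlow1 (a + -1))
    have fU : H (0, -1) = ind S (a, b - 1) := by rw [hH]; simp [← sub_eq_add_neg]
    have fL : H (-1, 0) = ind S (a - 1, b) := by rw [hH]; simp [← sub_eq_add_neg]
    have fUL : H (-1, -1) = ind S (a - 1, b - 1) := by rw [hH]; simp [← sub_eq_add_neg]
    have f1m : H (1, -1) = 0 ∨ H (1, -1) = 1 := by rw [hH]; exact ind_cases _ _
    have fmm : H (-1, -1) = 0 ∨ H (-1, -1) = 1 := by rw [hH]; exact ind_cases _ _
  · rw [ind_of_mem hU] at fU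
    rw [ind_of_notMem hL] at fL
    refine erase_reach check_upper (by decide) (by decide) hH ?_ ?_ ?_ hQc m
    · simp [out, *, -hH]
    · simp [out, *, -hH]
    · intro x hx hxP
      simp only [corners, List.mem_cons, List.not_mem_nil, or_false] at hx hxP
      obtain rfl : x = (1, 0) := by tauto
      rcases f1m with f1m | f1m <;> simp [out, *, -hH]
  · rw [ind_of_notMem hU] at fU
    rw [ind_of_mem hL] at fL
    -- Otherwise `(a + 1, b - 1)` and `(a, b)` would form a checkerboard.
    have f1m' : H (1, -1) = 0 := by
      rw [hH]
      refine ind_of_notMem fun h => (hchk (a + 1) b).2 ⟨hright1, ?_, ?_, ?_⟩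
      · simpa using hU
      · simpa using hab
      · simpa [← sub_eq_add_neg] using h
    clear f1m
    refine erase_reach check_left (by decide) (by decide) hH ?_ ?_ ?_ hQc m
    · simp [out, *, -hH]
    · simp [out, *, -hH]
    · intro x hx hxP
      simp only [corners, List.mem_cons, List.not_mem_nil, or_false] at hx hxP
      obtain rfl : x = (0, 0) := by tauto
      clear fUL
      rcases fmm with fmm | fmm <;> simp [out, *, -hH]
  · rw [ind_of_notMem hU] at fU
    rw [ind_of_notMem hL] at fL
    have f1m' : H (1, -1) = 0 := by
      rw [hH]
      refine ind_of_notMem fun h => (hchk (a + 1) b).2 ⟨hright1, ?_, ?_, ?_⟩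
      · simpa using hU
      · simpa using hab
      · simpa [← sub_eq_add_neg] using h
    have fmm' : H (-1, -1) = 0 := by
      rw [fUL]
      exact ind_of_notMem fun h => (hchk a b).1 ⟨hab, h, hL, hU⟩
    clear f1m fmm fUL
    refine erase_reach check_isolated (by decide) (by decide) hH ?_ ?_ ?_ hQc m
    · simp [out, *, -hH]
    · simp [out, *, -hH]
    · intro x hx hxP
      simp only [corners, List.mem_cons, List.not_mem_nil, or_false] at hx hxP
      tauto

/-! ### Reducing a set of faces to parked rings -/

theorem out_eq_self {h : Square → ℤ} {v : Square} (H : AgreeAt h 0 v) : out h v = v := by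
  rw [out_congr H, out_zero]

/-- A sequence of moves in a part of a floor where the other rings are absent, with a sign. -/
theorem hlay_reach_smul_add {h h' g : Square → ℤ} (hv : ∀ v, ValidAt h v)
    (hv' : ∀ v, ValidAt h' v) {Q₁ Q : Finset Square} (hsub : Q₁ ⊆ Q)
    (h0 : ∀ v, v ∉ Q₁ → AgreeAt h 0 v) (h0' : ∀ v, v ∉ Q₁ → AgreeAt h' 0 v)
    (hg : ∀ v ∈ Q₁, AgreeAt g 0 v) {m : ℤ} (H : Reach (hlay h Q₁ m) (hlay h' Q₁ m)) {s : ℤ}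
    (hs : s = 1 ∨ s = -1) : Reach (hlay (s • h + g) Q m) (hlay (s • h' + g) Q m) := by
  have hr : Reach (hlay (s • h) Q₁ m) (hlay (s • h') Q₁ m) := by
    rcases hs with rfl | rfl
    · simpa using H
    · simpa using hlay_reach_neg hv hv'
        (fun v hne => by_contra fun hm => hne (out_eq_self (h0 v hm)))
        (fun v hne => by_contra fun hm => hne (out_eq_self (h0' v hm))) H
  have key : ∀ f : Square → ℤ, hlay (s • f + g) Q₁ m = hlay (s • f) Q₁ m := fun f =>
    lay_congr m fun v hvQ => out_congr (by
      have := (AgreeAt.refl (s • f) v).add (hg v hvQ)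
      rwa [add_zero] at this)
  refine lay_reach_of_subset hsub ?_ fun v _ hv1 => out_congr ?_
  · rw [← key h, ← key h'] at hr
    exact hr
  · exact (((h0 v hv1).trans (h0' v hv1).symm).smul s).add (AgreeAt.refl g v)

theorem interior_empty : interior ∅ = ∅ := rfl

theorem ind_empty : ind ∅ = 0 := by ext; simp [ind]

/-- Each removal either leaves the interior alone or takes one jewel out of it and yields one ring
of charge `s * sgn p`, which is parked. The sum over the interior thus reappears as parked charge.
As every step parks at most one ring, `|n| + k` does not grow, and `N` bounds the size of the lot.
-/
theorem reduce_faces {X Y r N s : ℤ} (hXY : (X + Y) % 2 = 1) (hs : s = 1 ∨ s = -1)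
    (hY : r + 10 ≤ Y) (hX : r + 6 * N + 4 ≤ X) {u : Square → ℤ}
    (hu : ∀ q : Square, Y - 1 ≤ q.2 → u q = 0) {Q : Finset Square}
    (hQ : ∀ v : Square, -r - 10 ≤ v.1 → v.1 ≤ X + 2 → -r - 10 ≤ v.2 → v.2 ≤ Y + 2 → v ∈ Q)
    (k : ℕ) : ∀ {S : Finset Square} {n : ℤ}, S.card = k → NoCheckerboard S →
      (∀ q ∈ S, |q.1| ≤ r ∧ |q.2| ≤ r) → |n| + k ≤ N →
      Reach (hlay u Q 0 + hlay (s • ind S + parked X Y n) Q 2)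
        (hlay u Q 0 + hlay (parked X Y (n + s * ∑ v ∈ interior S, sgn v)) Q 2) := by
  induction k with
  | zero =>
    intro S n hk _ _ _
    obtain rfl := Finset.card_eq_zero.1 hk
    simpa [ind_empty, interior_empty] using Reach.refl _
  | succ k ih =>
    intro S n hk hv hR hn
    push_cast at hn
    have hne : S.Nonempty := Finset.card_pos.1 (by omega)
    -- A removal stays within distance `6` of the faces (the ring construction reaches five rows
    -- below), and this box ends above row `Y`, where the parked rings begin.
    set Q₁ : Finset Square := Finset.Icc (-r - 6) (r + 6) ×ˢ Finset.Icc (-r - 6) (r + 6) with hQ₁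
    have hmem : ∀ v : Square, v ∈ Q₁ ↔ |v.1| ≤ r + 6 ∧ |v.2| ≤ r + 6 := fun v => by
      simp only [hQ₁, Finset.mem_product, Finset.mem_Icc, abs_le]; omega
    obtain ⟨p, hp, hv', hcase⟩ := exists_erase hne hv hR (Q := Q₁)
      fun v h1 h2 => (hmem v).2 ⟨h1, h2⟩
    have hR' : ∀ q ∈ S.erase p, |q.1| ≤ r ∧ |q.2| ≤ r :=
      fun q hq => hR q (Finset.mem_of_mem_erase hq)
    have hcard : (S.erase p).card = k := by rw [Finset.card_erase_of_mem hp, hk]; rfl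
    have hpr := hR p hp
    simp only [abs_le] at hmem hpr
    have hsub : Q₁ ⊆ Q := fun v hvQ => by
      rw [hmem] at hvQ
      have := abs_nonneg n
      exact hQ v (by omega) (by omega) (by omega) (by omega)
    have hind : ∀ T : Finset Square, (∀ q ∈ T, |q.1| ≤ r ∧ |q.2| ≤ r) → ∀ v, v ∉ Q₁ →
        AgreeAt (ind T) 0 v := by
      intro T hT v hvQ
      rw [hmem] at hvQ
      simp only [abs_le] at hT
      refine ⟨?_, ?_, ?_, ?_⟩ <;> refine ind_of_notMem fun hm => ?_ <;>
        have := hT _ hm <;> simp only at this <;> omega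
    have hpark : ∀ v ∈ Q₁, AgreeAt (parked X Y n) 0 v := fun v hvQ => by
      rw [hmem] at hvQ
      refine ⟨?_, ?_, ?_, ?_⟩ <;> refine parked_eq_zero_of_snd ?_ <;> simp only <;> omega
    rcases hcase with ⟨hint, hreach⟩ | ⟨hlow, hnot, hint, hreach⟩
    · rw [← hint]
      refine Reach.trans (Reach.add_left ?_ _) (ih hcard hv' hR' (by omega))
      exact hlay_reach_smul_add hv hv' hsub (hind S hR) (hind _ hR') hpark (hreach 2) hs
    · have hrow : ∀ q : Square, p.2 < q.2 → ind (S.erase p) q = 0 := fun q hq =>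
        ind_of_notMem fun hm => by have := hlow q (Finset.mem_of_mem_erase hm); omega
      have hval : ∀ v, ValidAt (ind (S.erase p) + ring (p + (-1, 3))) v := by
        intro v
        by_cases hvp : v.2 ≤ p.2 + 2
        · refine ValidAt.congr ?_ (hv' v)
          have := (AgreeAt.refl (ind (S.erase p)) v).add (ring_agreeAt (p := p + (-1, 3)) (v := v)
            (by simp only [Prod.fst_add, Prod.snd_add]; omega)).symm
          rwa [add_zero] at this
        · refine ValidAt.congr ?_ (validAt_ring (p + (-1, 3)) v)
          have h0 : AgreeAt 0 (ind (S.erase p)) v :=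
            ⟨(hrow _ (by simp only; omega)).symm, (hrow _ (by simp only; omega)).symm,
              (hrow _ (by simp only; omega)).symm, (hrow _ (by simp only; omega)).symm⟩
          have := h0.add (AgreeAt.refl (ring (p + (-1, 3))) v)
          rwa [zero_add] at this
      have h0' : ∀ v, v ∉ Q₁ → AgreeAt (ind (S.erase p) + ring (p + (-1, 3))) 0 v := by
        intro v hvQ
        have := (hind _ hR' v hvQ).add (ring_agreeAt (p := p + (-1, 3)) (v := v)
            (by rw [hmem] at hvQ; simp only [Prod.fst_add, Prod.snd_add]; omega))
        rwa [add_zero] at this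
      have hsum : n + s * ∑ v ∈ interior S, sgn v =
          n + s * sgn (p + (-1, 3)) + s * ∑ v ∈ interior (S.erase p), sgn v := by
        -- The shift `(-1, 3)` has even coordinate sum, so the ring has the color of the crossed
        -- jewel.
        have : sgn (p + (-1, 3)) = sgn p := by
          simp only [sgn, IsWhite, Prod.fst_add, Prod.snd_add, Int.even_iff]
          congr 1
          exact propext (by omega)
        rw [hint, Finset.sum_insert hnot, this]
        ring
      rw [hsum]
      have hgrow : ∀ q : Square, (p + (-1, 3)).2 - 1 ≤ q.2 → (s • ind (S.erase p)) q = 0 := by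
        intro q hq
        simp only [Prod.snd_add] at hq
        rw [Pi.smul_apply, hrow q (by omega), smul_zero]
      have hpark2 := park (p := p + (-1, 3)) (n := n) (Q := Q) hXY hs
        (by simp only [Prod.fst_add]; omega) (by simp only [Prod.snd_add]; omega) hgrow hu
        (fun v h1 h2 h3 h4 => by
          simp only [Prod.fst_add, Prod.snd_add] at h1 h3
          exact hQ v (by omega) h2 (by omega) h4)
      have h1 := hlay_reach_smul_add hv hval hsub (hind S hR) h0' hpark (hreach 2) hs
      rw [smul_add, add_right_comm] at h1
      refine ((h1.add_left _).trans hpark2).trans (ih hcard hv' hR' ?_)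
      have h2 : |s * sgn (p + (-1, 3))| = 1 := by
        rcases hs with rfl | rfl <;> rcases sgn_eq (p + (-1, 3)) with h | h <;> simp [h]
      have := abs_add_le n (s * sgn (p + (-1, 3)))
      omega

/-! ### Sweeps: pairs of columns become pairs of horizontal dimers -/

/-- The `z` dimers at the squares of `M` in the floors `m`, `m + 1`. -/
def cols (M : Multiset Square) (m : ℤ) : Multiset (Finset Cube) :=
  M.map fun v => {(v, m), (v, m + 1)}

/-- The dimers that join `v` and `o v` on the floor `m`, for the squares `v` of `M`. -/
def flats (o : Square → Square) (M : Multiset Square) (m : ℤ) : Multiset (Finset Cube) :=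
  M.map fun v => {(v, m), (o v, m)}

/-- The columns at `v` and `o v` form a vertical slab, and one flip lays them down on its two
floors. The slabs of different `v` are treated one at a time. -/
theorem sweep {o : Square → Square} {M : Multiset Square} (h : ∀ v ∈ M, Adj (v, 0) (o v, 0))
    (m : ℤ) : Reach (cols M m + cols (M.map o) m) (flats o M m + flats o M (m + 1)) := by
  induction M using Multiset.induction_on with
  | empty => exact Reach.refl _
  | cons v M ih =>
    have hv := h v (Multiset.mem_cons_self v M)
    have e : ∀ z : ℤ, Adj (v, z) (o v, z) := fun z => by
      rw [adj_iff] at hv ⊢; simpa using hv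
    have hcol : ∀ w : Square, Adj (w, m) (w, m + 1) := fun w => by rw [adj_iff]; simp
    have hne : v ≠ o v := fun he => hv.ne (Prod.ext he rfl)
    have h1 : Reach (({{(v, m), (v, m + 1)}} : Multiset (Finset Cube)) + {{(o v, m), (o v, m + 1)}})
        (({{(v, m), (o v, m)}} : Multiset (Finset Cube)) + {{(v, m + 1), (o v, m + 1)}}) := by
      refine Relation.ReflTransGen.single ⟨(v, m), (v, m + 1), (o v, m + 1), (o v, m), 0, hcol v,
        e _, (hcol _).symm, (e _).symm, by simp, by simp [hne], ?_, ?_⟩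
      · rw [Finset.pair_comm (o v, m + 1)]; rfl
      · rw [Finset.pair_comm (o v, m), Multiset.cons_swap]; rfl
    have := h1.add (ih fun w hw => h w (Multiset.mem_cons_of_mem hw))
    simp only [cols, flats, Multiset.map_cons] at this ⊢
    simp only [← Multiset.singleton_add] at this ⊢
    rw [add_add_add_comm, add_add_add_comm (a := ({{(v, m), (o v, m)}} : Multiset (Finset Cube)))]
    exact this

theorem cols_add (M N : Multiset Square) (m : ℤ) : cols (M + N) m = cols M m + cols N m :=
  Multiset.map_add _ _ _

theorem lay_id (Q : Finset Square) (m : ℤ) : lay id Q m = cols Q.val m := by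
  refine Multiset.map_congr rfl fun v _ => ?_
  simp [cell, cellPair, pairSet]

theorem lay_eq_cols {o : Square → Square} {Q : Finset Square} (h : ∀ v ∈ Q, o v = v) (m : ℤ) :
    lay o Q m = cols Q.val m := by
  rw [← lay_id, lay_congr m h]; rfl

theorem filter_isWhite_add (A : Finset Square) :
    (A.filter IsWhite).val + (A.filter fun v => ¬ IsWhite v).val = A.val := by
  rw [Finset.filter_val, Finset.filter_val, Multiset.filter_add_not]

theorem lay_eq_flats {o : Square → Square} {A : Finset Square} (h : ∀ v ∈ A, o v ≠ v) (m : ℤ) :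
    lay o A m = flats o (A.filter IsWhite).val m +
      flats o (A.filter fun v => ¬ IsWhite v).val (m + 1) := by
  rw [lay, ← filter_isWhite_add, Multiset.map_add, flats, flats]
  congr 1 <;> refine Multiset.map_congr rfl fun v hv => ?_ <;>
    rw [Finset.mem_val, Finset.mem_filter] at hv <;>
    simp [cell, cellPair, pairSet, hv.2, h v hv.1]

/-- The square `o v` has the other color than `v`, and `o` permutes `A`. -/
theorem map_filter_isWhite {o : Square → Square} {A : Finset Square} (ho : Set.InjOn o A)
    (hm : ∀ v ∈ A, o v ∈ A) (hw : ∀ v ∈ A, (IsWhite (o v) ↔ ¬ IsWhite v)) :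
    (A.filter IsWhite).val.map o = (A.filter fun v => ¬ IsWhite v).val ∧
      (A.filter fun v => ¬ IsWhite v).val.map o = (A.filter IsWhite).val := by
  have himg : A.image o = A := Finset.eq_of_subset_of_card_le (Finset.image_subset_iff.2 hm)
    (Finset.card_image_of_injOn ho).ge
  have key : ∀ P P' : Square → Prop, ∀ [DecidablePred P] [DecidablePred P'],
      (∀ v ∈ A, P' (o v) ↔ P v) → (A.filter P).val.map o = (A.filter P').val := by
    intro P P' _ _ hP
    rw [← Finset.image_val_of_injOn (ho.mono (Finset.coe_subset.2 (Finset.filter_subset _ _)))]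
    congr 1
    ext w
    simp only [Finset.mem_image, Finset.mem_filter]
    constructor
    · rintro ⟨v, ⟨hv, hp⟩, rfl⟩
      exact ⟨hm v hv, (hP v hv).2 hp⟩
    · rintro ⟨hwA, hp⟩
      rw [← himg, Finset.mem_image] at hwA
      obtain ⟨v, hv, rfl⟩ := hwA
      exact ⟨v, ⟨hv, (hP v hv).1 hp⟩, rfl⟩
  exact ⟨key _ _ fun v hv => by rw [hw v hv, not_not], key _ _ hw⟩

/-- The strands over `A` move two floors down. -/
theorem transfer_lay {o : Square → Square} {A : Finset Square} (ho : Set.InjOn o A)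
    (hm : ∀ v ∈ A, o v ∈ A) (hadj : ∀ v ∈ A, Adj (v, 0) (o v, 0)) :
    Reach (lay o A 0 + lay id A 2) (lay id A 0 + lay o A 2) := by
  have hw : ∀ v ∈ A, (IsWhite (o v) ↔ ¬ IsWhite v) := fun v hv => by
    have := hadj v hv
    rw [adj_iff] at this
    simp only [IsWhite, Int.even_iff] at this ⊢
    omega
  have hne : ∀ v ∈ A, o v ≠ v := fun v hv he => (hadj v hv).ne (by rw [he])
  obtain ⟨hWB, hBW⟩ := map_filter_isWhite ho hm hw
  have hW : ∀ v ∈ (A.filter IsWhite).val, Adj (v, 0) (o v, 0) := fun v hv =>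
    hadj v (Finset.mem_filter.1 hv).1
  have hB : ∀ v ∈ (A.filter fun v => ¬ IsWhite v).val, Adj (v, 0) (o v, 0) := fun v hv =>
    hadj v (Finset.mem_filter.1 hv).1
  have sW := sweep hW
  have sB := sweep hB
  rw [hWB] at sW
  rw [hBW] at sB
  rw [lay_eq_flats hne, lay_eq_flats hne, lay_id, lay_id, ← filter_isWhite_add A, cols_add, cols_add]
  set W := (A.filter IsWhite).val
  set B := (A.filter fun v => ¬ IsWhite v).val
  -- At the start `W` lies on floor `0`, `B` on floor `1`, and columns fill floors `2`, `3`. The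
  -- columns are laid down as two copies of `B`; the copies of `B` on floors `1`, `2` are stood up
  -- and laid down again as two copies of `W`; and the copies of `W` on floors `0`, `1` are stood
  -- up. This leaves `W` on floor `2`, `B` on floor `3`, and columns above.
  have s1 := (sB 2).add_left (flats o W 0 + flats o B (0 + 1))
  have s2 := (sB 1).symm.add_left (flats o W 0 + flats o B 3)
  have s3 := (sW 1).add_left (flats o W 0 + flats o B 3)
  have s4 := (sW 0).symm.add_left (flats o W 2 + flats o B 3)
  norm_num at s1 s2 s3 s4 ⊢
  rw [add_comm (cols W 2)]
  refine s1.trans ?_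
  have e1 : flats o W 0 + flats o B 1 + (flats o B 2 + flats o B 3) =
      flats o W 0 + flats o B 3 + (flats o B 1 + flats o B 2) := by abel
  rw [e1]
  refine s2.trans ?_
  rw [add_comm (cols B 1)]
  refine s3.trans ?_
  have e2 : flats o W 0 + flats o B 3 + (flats o W 1 + flats o W 2) =
      flats o W 2 + flats o B 3 + (flats o W 0 + flats o W 1) := by abel
  rw [e2, add_comm (cols W 0 + cols B 0)]
  exact s4

/-- The height function is constant around `v`. -/
def ConstAt (h : Square → ℤ) (v : Square) : Prop := ∃ c : ℤ, AgreeAt h (fun _ => c) v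

theorem out_add_const (h : Square → ℤ) (c : ℤ) (v : Square) :
    out (h + fun _ => c) v = out h v := by
  simp [out]

theorem out_add_of_constAt {h k : Square → ℤ} {v : Square} (hk : ConstAt k v) :
    out (h + k) v = out h v := by
  obtain ⟨c, hc⟩ := hk
  rw [out_congr ((AgreeAt.refl h v).add hc), out_add_const]

theorem out_eq_self_of_constAt {k : Square → ℤ} {v : Square} (hk : ConstAt k v) :
    out k v = v := by
  have := out_add_of_constAt (h := 0) hk
  rwa [zero_add, out_zero] at this

/-- The height differences around `v` sum to zero. Unless all vanish, one of them is positive, hence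
equal to `1` by validity, and this is an outgoing strand. -/
theorem out_eq_self_iff {h : Square → ℤ} {v : Square} (hv : ValidAt h v) :
    out h v = v ↔ ConstAt h v := by
  refine ⟨fun he => ⟨h (v.1, v.2), rfl, ?_, ?_, ?_⟩, out_eq_self_of_constAt⟩ <;>
  · obtain ⟨x, y⟩ := v
    simp only [ValidAt] at hv
    rw [out] at he
    split_ifs at he with h1 h2 h3 h4 <;> simp only [Prod.mk.injEq] at he h1 <;> try omega
    simp only at h2 h3 h4 ⊢
    omega

theorem ConstAt.neg {k : Square → ℤ} {v : Square} (hk : ConstAt k v) : ConstAt (-k) v := by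
  obtain ⟨c, h1, h2, h3, h4⟩ := hk
  exact ⟨-c, congrArg Neg.neg h1, congrArg Neg.neg h2, congrArg Neg.neg h3, congrArg Neg.neg h4⟩

/-- The part `k` of the height function `h` moves from the upper two floors to the lower two. -/
theorem transfer {h g k : Square → ℤ} (hk : ∀ v, ValidAt k v) {Q : Finset Square}
    (hQ : ∀ v, out k v ≠ v → v ∈ Q)
    (hc : ∀ v, out k v ≠ v → ConstAt (h - k) v ∧ ConstAt g v) :
    Reach (hlay h Q 0 + hlay g Q 2) (hlay (h - k) Q 0 + hlay (g + k) Q 2) := by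
  -- On `A` the strands of `h` are those of `k` alone and `g` has none, so `transfer_lay` applies.
  -- Off `A` the function `k` is locally constant, and adding or subtracting it changes no strand.
  set A := Q.filter fun v => out k v ≠ v with hA
  have hAQ : A ⊆ Q := Finset.filter_subset _ _
  have hmA : ∀ v, v ∈ A ↔ out k v ≠ v := fun v => by
    rw [hA, Finset.mem_filter]; exact ⟨And.right, fun hne => ⟨hQ v hne, hne⟩⟩
  have main := transfer_lay (o := out k) (A := A) ((out_injective hk).injOn)
    (fun v hv => (hmA _).2 (out_out_ne hk ((hmA v).1 hv)))
    (fun v hv => out_adj k v 0 ((hmA v).1 hv))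
  have e1 : lay (out h) A 0 = lay (out k) A 0 := lay_congr 0 fun v hv => by
    have := out_add_of_constAt (h := k) (hc v ((hmA v).1 hv)).1
    rwa [add_sub_cancel] at this
  have e2 : lay (out g) A 2 = lay id A 2 := lay_congr 2 fun v hv =>
    out_eq_self_of_constAt (hc v ((hmA v).1 hv)).2
  have e3 : lay (out (h - k)) A 0 = lay id A 0 := lay_congr 0 fun v hv =>
    out_eq_self_of_constAt (hc v ((hmA v).1 hv)).1
  have e4 : lay (out (g + k)) A 2 = lay (out k) A 2 := lay_congr 2 fun v hv => by
    rw [add_comm, out_add_of_constAt (hc v ((hmA v).1 hv)).2]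
  have hoff : ∀ v ∈ Q \ A, ConstAt k v := fun v hv => by
    rw [Finset.mem_sdiff, hmA, not_not] at hv
    exact (out_eq_self_iff (hk v)).1 hv.2
  have e5 : lay (out (h - k)) (Q \ A) 0 = lay (out h) (Q \ A) 0 := lay_congr 0 fun v hv => by
    rw [sub_eq_add_neg, out_add_of_constAt (hoff v hv).neg]
  have e6 : lay (out (g + k)) (Q \ A) 2 = lay (out g) (Q \ A) 2 := lay_congr 2 fun v hv =>
    out_add_of_constAt (hoff v hv)
  simp only [hlay]
  rw [lay_sdiff hAQ, lay_sdiff hAQ (o := out g), lay_sdiff hAQ (o := out (h - k)),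
    lay_sdiff hAQ (o := out (g + k)), e1, e2, e3, e4, e5, e6, add_add_add_comm,
    add_add_add_comm (lay id A 0)]
  exact main.add_right _

/-! ### Reducing a height function to parked rings -/

theorem constAt_iff {h : Square → ℤ} {x y : ℤ} : ConstAt h (x, y) ↔
    h (x - 1, y) = h (x, y) ∧ h (x, y - 1) = h (x, y) ∧ h (x - 1, y - 1) = h (x, y) := by
  constructor
  · rintro ⟨c, h1, h2, h3, h4⟩
    simp only at h1 h2 h3 h4
    omega
  · rintro ⟨h2, h3, h4⟩
    exact ⟨h (x, y), rfl, h2, h3, h4⟩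

instance (h : Square → ℤ) : DecidablePred (ConstAt h) := fun _ => decidable_of_iff' _ constAt_iff

/-- The height at the squares that are surrounded by faces of one height, and `0` elsewhere. -/
def level (h : Square → ℤ) (v : Square) : ℤ := if ConstAt h v then h v else 0

/-- The sum of the heights at the jewels in `F`, signed by color. -/
def heightTwist (F : Finset Square) (h : Square → ℤ) : ℤ := ∑ v ∈ F, sgn v * level h v

theorem ValidAt.neg {h : Square → ℤ} {v : Square} (hv : ValidAt h v) : ValidAt (-h) v := by
  simp only [ValidAt, Pi.neg_apply] at hv ⊢
  omega

theorem ValidAt.sign_smul {h : Square → ℤ} {v : Square} (hv : ValidAt h v) {s : ℤ}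
    (hs : s = 1 ∨ s = -1) : ValidAt (s • h) v := by
  rcases hs with rfl | rfl
  · simpa using hv
  · simpa using hv.neg

theorem ConstAt.smul {h : Square → ℤ} {v : Square} (hk : ConstAt h v) (s : ℤ) :
    ConstAt (s • h) v :=
  let ⟨c, hc⟩ := hk
  ⟨s * c, hc.smul s⟩

theorem level_neg (h : Square → ℤ) (v : Square) : level (-h) v = -level h v := by
  have : ConstAt (-h) v ↔ ConstAt h v := ⟨fun H => by simpa using H.neg, ConstAt.neg⟩
  simp only [level, this, Pi.neg_apply]
  split_ifs <;> simp

theorem heightTwist_smul (F : Finset Square) (h : Square → ℤ) {s : ℤ} (hs : s = 1 ∨ s = -1) :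
    heightTwist F (s • h) = s * heightTwist F h := by
  rcases hs with rfl | rfl
  · simp
  · simp [heightTwist, level_neg]

/-- The strands pass through as many black as white squares. -/
theorem sum_sgn_not_constAt {g : Square → ℤ} (hv : ∀ v, ValidAt g v) {F : Finset Square}
    (hF : ∀ v, v ∉ F → ConstAt g v) : ∑ v ∈ F, sgn v * (if ConstAt g v then 0 else 1) = 0 := by
  set A := F.filter fun v => ¬ ConstAt g v with hA
  have hmA : ∀ v, v ∈ A ↔ out g v ≠ v := fun v => by
    rw [hA, Finset.mem_filter, Ne, out_eq_self_iff (hv v)]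
    exact ⟨And.right, fun hne => ⟨by_contra fun hm => hne (hF v hm), hne⟩⟩
  have e1 : ∑ v ∈ F, sgn v * (if ConstAt g v then 0 else 1) = ∑ v ∈ A, sgn v := by
    rw [hA, Finset.sum_filter]
    exact Finset.sum_congr rfl fun v _ => by split_ifs <;> simp
  have hmaps : Set.MapsTo (out g) A A := fun v hv' =>
    (hmA _).2 (out_out_ne hv ((hmA v).1 hv'))
  have hinj : Set.InjOn (out g) A := (out_injective hv).injOn
  -- `out g` permutes `A` and reverses colors, so the signed count of `A` equals its own negative.
  have e2 : ∑ v ∈ A, sgn (out g v) = ∑ v ∈ A, sgn v :=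
    Finset.sum_nbij (out g) hmaps hinj
      (Finset.surjOn_of_injOn_of_card_le _ hmaps hinj le_rfl) fun _ _ => rfl
  have e3 : ∑ v ∈ A, sgn (out g v) = -∑ v ∈ A, sgn v := by
    rw [← Finset.sum_neg_distrib]
    refine Finset.sum_congr rfl fun v hv' => ?_
    have := isWhite_out ((hmA v).1 hv')
    simp only [sgn, this]
    split_ifs <;> simp
  rw [e1]
  omega

theorem ind_eq_of_pos {f : Square → ℤ} {S : Finset Square} (hS : ∀ q, q ∈ S ↔ 1 ≤ f q)
    (q : Square) : ind S q = if 1 ≤ f q then 1 else 0 := by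
  simp only [ind, hS]

theorem noCheckerboard_pos {f : Square → ℤ} (hf : ∀ v, ValidAt f v) {S : Finset Square}
    (hS : ∀ q, q ∈ S ↔ 1 ≤ f q) : NoCheckerboard S := by
  rw [noCheckerboard_iff]
  intro x y
  have := hf (x, y)
  simp only [ValidAt] at this
  simp only [hS]
  omega

theorem validAt_sub_ind {f : Square → ℤ} {S : Finset Square} (hS : ∀ q, q ∈ S ↔ 1 ≤ f q)
    {v : Square} (hf : ValidAt f v) : ValidAt (f - ind S) v := by
  simp only [ValidAt, Pi.sub_apply, ind_eq_of_pos hS] at hf ⊢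
  split_ifs <;> omega

/-- Around a square on the boundary of `S` only the heights `0` and `1` occur, so subtracting the
indicator leaves `0`. Thus the outermost level lines touch no others, as `transfer` requires. -/
theorem constAt_sub_ind {f : Square → ℤ} {S : Finset Square} (hS : ∀ q, q ∈ S ↔ 1 ≤ f q)
    {v : Square} (hf : ValidAt f v) (hc : ¬ ConstAt (ind S) v) : ConstAt (f - ind S) v := by
  obtain ⟨x, y⟩ := v
  rw [constAt_iff] at hc ⊢
  simp only [ValidAt, Pi.sub_apply, ind_eq_of_pos hS] at hf hc ⊢
  split_ifs at hc ⊢ <;> omega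

/-- The positive part of `f - 1`. -/
def truncate (f : Square → ℤ) (q : Square) : ℤ := if 1 ≤ f q then f q - 1 else 0

theorem validAt_truncate {f : Square → ℤ} {v : Square} (hf : ValidAt f v) :
    ValidAt (truncate f) v := by
  simp only [ValidAt, truncate] at hf ⊢
  split_ifs <;> omega

/-- Levels are additive except at squares on strands between positive heights: such a square is not
a jewel of `f`, yet it lies in the interior of `S` and counts `1` there. The strands of `truncate f`
are exactly these. -/
theorem level_eq {f : Square → ℤ} {S : Finset Square} (hS : ∀ q, q ∈ S ↔ 1 ≤ f q)
    {v : Square} (hf : ValidAt f v) : level f v = level (ind S) v + level (f - ind S) v -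
      if ConstAt (truncate f) v then 0 else 1 := by
  obtain ⟨x, y⟩ := v
  simp only [level, constAt_iff, Pi.sub_apply, ind_eq_of_pos hS, truncate]
  simp only [ValidAt] at hf
  generalize f (x, y) = a at *
  generalize f (x - 1, y) = b at *
  generalize f (x, y - 1) = c at *
  generalize f (x - 1, y - 1) = d at *
  by_cases ha : 1 ≤ a <;> by_cases hb : 1 ≤ b <;> by_cases hc : 1 ≤ c <;> by_cases hd : 1 ≤ d <;>
    simp only [ha, hb, hc, hd, and_self, and_true, true_and, if_true, if_false] <;>
    split_ifs <;> omega

theorem sum_sgn_level_ind {S F : Finset Square} (hF : S ⊆ F) :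
    ∑ v ∈ F, sgn v * level (ind S) v = ∑ v ∈ interior S, sgn v := by
  have hsub : interior S ⊆ F := (Finset.filter_subset _ _).trans hF
  rw [← Finset.sum_subset hsub (f := fun v => sgn v * level (ind S) v)]
  · refine Finset.sum_congr rfl fun ⟨x, y⟩ hv => ?_
    rw [mem_interior] at hv
    have : ConstAt (ind S) (x, y) := by
      rw [constAt_iff]; simp [ind, hv]
    rw [level, if_pos this, ind_of_mem hv.1, mul_one]
  · rintro ⟨x, y⟩ - hv
    rw [mem_interior] at hv
    rw [level]
    split_ifs with hc
    · rw [ind_of_notMem, mul_zero]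
      intro hm
      rw [constAt_iff] at hc
      simp only [ind, hm, if_true] at hc
      refine hv ⟨hm, ?_, ?_, ?_⟩ <;> by_contra hn <;> simp [hn] at hc
    · exact mul_zero _

/-- The error terms in `level_eq` sum to zero by `sum_sgn_not_constAt`, because strands alternate
between black and white squares. -/
theorem heightTwist_sub_ind {f : Square → ℤ} (hf : ∀ v, ValidAt f v) {S F : Finset Square}
    (hS : ∀ q, q ∈ S ↔ 1 ≤ f q) (hF : ∀ v, v ∉ F → AgreeAt f 0 v) :
    heightTwist F f = ∑ v ∈ interior S, sgn v + heightTwist F (f - ind S) := by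
  have hSF : S ⊆ F := fun q hq => by
    by_contra hm
    have h1 : f (q.1, q.2) = 0 := (hF q hm).1
    have h2 : 1 ≤ f (q.1, q.2) := (hS _).1 hq
    omega
  have hconst : ∀ v, v ∉ F → ConstAt (truncate f) v := fun v hv => by
    obtain ⟨h1, h2, h3, h4⟩ := hF v hv
    refine ⟨0, ?_, ?_, ?_, ?_⟩ <;> simp [truncate, h1, h2, h3, h4]
  have := sum_sgn_not_constAt (fun v => validAt_truncate (hf v)) hconst
  rw [heightTwist, Finset.sum_congr rfl fun v _ => by rw [level_eq hS (hf v)]]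
  simp only [mul_sub, mul_add, Finset.sum_sub_distrib, Finset.sum_add_distrib, this,
    sum_sgn_level_ind hSF]
  rw [sub_zero, heightTwist]

theorem interior_card_le (S : Finset Square) : (interior S).card ≤ S.card :=
  Finset.card_le_card (Finset.filter_subset _ _)

theorem abs_sum_sgn_le (S : Finset Square) : |∑ v ∈ S, sgn v| ≤ S.card := by
  refine (Finset.abs_sum_le_sum_abs _ _).trans ?_
  rw [Finset.sum_congr rfl fun v _ => show |sgn v| = 1 by
    rcases sgn_eq v with h | h <;> simp [h]]
  simp

/-- Induction on the total absolute height. In each round the boundary of `{h ≥ 1}`, or of `{h ≤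
-1}`, is transferred to the lower floors and dismantled; this parks the charge that `heightTwist`
loses. A round lowers the total by the number of faces, which bounds the number of rings, so the
budget `N` is kept. -/
theorem reduce_height {X Y r N : ℤ} (hXY : (X + Y) % 2 = 1)
    (hY : r + 10 ≤ Y) (hX : r + 6 * N + 4 ≤ X) {Q : Finset Square}
    (hQ : ∀ v : Square, -r - 10 ≤ v.1 → v.1 ≤ X + 2 → -r - 10 ≤ v.2 → v.2 ≤ Y + 2 → v ∈ Q)
    {F : Finset Square} (hF : ∀ v, v ∈ F ↔ |v.1| ≤ r + 1 ∧ |v.2| ≤ r + 1) (k : ℕ) :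
    ∀ {h : Square → ℤ} {n : ℤ}, (∀ v, ValidAt h v) →
      (∀ q, h q ≠ 0 → |q.1| ≤ r ∧ |q.2| ≤ r) → ∑ v ∈ F, |h v| = k → |n| + k ≤ N →
      Reach (hlay h Q 0 + hlay (parked X Y n) Q 2)
        (hlay 0 Q 0 + hlay (parked X Y (n + heightTwist F h)) Q 2) := by
  induction k using Nat.strong_induction_on with
  | _ k ih =>
  intro h n hv hr hk hn
  have hbox : ∀ q, h q ≠ 0 → q ∈ F := fun q hq => by
    have := hr q hq
    exact (hF q).2 (by omega)
  by_cases h0 : h = 0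
  · subst h0
    have : heightTwist F 0 = 0 := Finset.sum_eq_zero fun v _ => by simp [level]
    rw [this, add_zero]
    exact Reach.refl _
  obtain ⟨q₀, hq₀⟩ := Function.ne_iff.1 h0
  -- The sign of a nonzero height decides which side is peeled, so that `S` is not empty and the
  -- total decreases.
  obtain ⟨s, hs, hs0⟩ : ∃ s : ℤ, (s = 1 ∨ s = -1) ∧ 1 ≤ s * h q₀ := by
    rcases lt_or_gt_of_ne hq₀ with hlt | hlt <;> simp only [Pi.zero_apply] at hlt
    · exact ⟨-1, Or.inr rfl, by omega⟩
    · exact ⟨1, Or.inl rfl, by omega⟩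
  have hss : s * s = 1 := by rcases hs with rfl | rfl <;> rfl
  set f : Square → ℤ := s • h with hfdef
  have hfh : h = s • f := by rw [hfdef, smul_smul, hss, one_smul]
  have hf : ∀ v, ValidAt f v := fun v => (hv v).sign_smul hs
  set S := F.filter fun q => 1 ≤ f q with hSdef
  have hS : ∀ q, q ∈ S ↔ 1 ≤ f q := fun q => by
    rw [hSdef, Finset.mem_filter]
    refine ⟨And.right, fun hq => ⟨hbox q fun he => ?_, hq⟩⟩
    rw [hfdef, Pi.smul_apply, he, smul_zero] at hq
    omega
  have hSr : ∀ q ∈ S, |q.1| ≤ r ∧ |q.2| ≤ r := fun q hq => hr q fun he => by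
    have := (hS q).1 hq
    rw [hfdef, Pi.smul_apply, he, smul_zero] at this
    omega
  have hchk := noCheckerboard_pos hf hS
  have hsub : h - s • ind S = s • (f - ind S) := by rw [smul_sub, ← hfh]
  have hsum : ∑ v ∈ F, |(h - s • ind S) v| = k - S.card := by
    have e : ∀ v ∈ F, |(h - s • ind S) v| = |h v| - ind S v := fun v _ => by
      rw [hsub, Pi.smul_apply, Pi.sub_apply, smul_eq_mul, abs_mul,
        show |h v| = |f v| by rw [hfdef, Pi.smul_apply, smul_eq_mul, abs_mul]; rcases hs with
          rfl | rfl <;> simp, ind_eq_of_pos hS]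
      have : |s| = 1 := by rcases hs with rfl | rfl <;> simp
      rw [this, one_mul]
      split_ifs with h1
      · rw [abs_of_nonneg (by omega), abs_of_nonneg (by omega)]
      · simp
    rw [Finset.sum_congr rfl e, Finset.sum_sub_distrib, hk]
    congr 1
    simp only [ind, Finset.sum_ite_mem]
    rw [Finset.inter_eq_right.2 (Finset.filter_subset _ _), Finset.sum_const, nsmul_eq_mul,
      mul_one]
  have hpos : 0 < S.card := Finset.card_pos.2 ⟨q₀, (hS q₀).2 hs0⟩
  have hle : (S.card : ℤ) ≤ k := by
    have : 0 ≤ ∑ v ∈ F, |(h - s • ind S) v| := Finset.sum_nonneg fun v _ => abs_nonneg _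
    omega
  have hagree : ∀ g : Square → ℤ, (∀ q, g q ≠ 0 → |q.1| ≤ r ∧ |q.2| ≤ r) → ∀ v, v ∉ F →
      AgreeAt g 0 v := by
    intro g hg v hvF
    rw [hF] at hvF
    simp only [abs_le] at hvF hg
    refine ⟨?_, ?_, ?_, ?_⟩ <;> by_contra hne <;> have := hg _ hne <;> simp only at this <;> omega
  have hh2 : ∀ q, (h - s • ind S) q ≠ 0 → |q.1| ≤ r ∧ |q.2| ≤ r := fun q hq => by
    by_cases hh : h q = 0
    · refine hSr q (by_contra fun hm => hq ?_)
      rw [Pi.sub_apply, Pi.smul_apply, ind_of_notMem hm, hh, smul_zero, sub_zero]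
    · exact hr q hh
  have hv2 : ∀ v, ValidAt (h - s • ind S) v := fun v => by
    rw [hsub]; exact (validAt_sub_ind hS (hf v)).sign_smul hs
  have habs := abs_nonneg n
  have hindF : ∀ v, v ∉ F → AgreeAt (ind S) 0 v :=
    hagree _ fun q hq => hSr q (by_contra fun hm => hq (ind_of_notMem hm))
  have hout : ∀ v, out (s • ind S) v ≠ v → ¬ ConstAt (ind S) v ∧ v ∈ F := fun v hne => by
    refine ⟨fun hc => hne (out_eq_self_of_constAt (hc.smul s)), by_contra fun hm => ?_⟩
    exact hne (out_eq_self_of_constAt (ConstAt.smul ⟨0, hindF v hm⟩ s))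
  have step := transfer (h := h) (g := parked X Y n) (k := s • ind S) (Q := Q)
    (fun v => (hchk v).sign_smul hs)
    (fun v hne => by
      have := (hout v hne).2
      rw [hF] at this
      simp only [abs_le] at this
      exact hQ v (by omega) (by omega) (by omega) (by omega))
    (fun v hne => by
      obtain ⟨h1, h2⟩ := hout v hne
      refine ⟨?_, 0, ?_⟩
      · rw [hsub]
        exact (constAt_sub_ind hS (hf v) h1).smul s
      · rw [hF] at h2
        simp only [abs_le] at h2
        refine ⟨?_, ?_, ?_, ?_⟩ <;> refine parked_eq_zero_of_snd ?_ <;> simp only <;> omega)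
  have hu : ∀ q : Square, Y - 1 ≤ q.2 → (h - s • ind S) q = 0 := fun q hq => by
    by_contra hne
    have := hh2 q hne
    simp only [abs_le] at this
    omega
  have step2 := reduce_faces hXY hs hY hX hu hQ S.card (n := n) rfl hchk hSr (by omega)
  have htw : n + heightTwist F h =
      n + s * ∑ v ∈ interior S, sgn v + heightTwist F (h - s • ind S) := by
    rw [hsub, heightTwist_smul _ _ hs, hfh, heightTwist_smul _ _ hs,
      heightTwist_sub_ind hf hS (hagree f fun q hq => hr q fun he => hq (by
        rw [hfdef, Pi.smul_apply, he, smul_zero]))]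
    ring
  rw [htw]
  rw [add_comm (parked X Y n)] at step
  refine (step.trans step2).trans (ih (k - S.card) (by omega) hv2 hh2 ?_ ?_)
  · rw [hsum]; omega
  · have h1 := abs_add_le n (s * ∑ v ∈ interior S, sgn v)
    have h2 : |s * ∑ v ∈ interior S, sgn v| = |∑ v ∈ interior S, sgn v| := by
      rcases hs with rfl | rfl <;> simp
    have h3 := abs_sum_sgn_le (interior S)
    have h4 := interior_card_le S
    omega

/-! ### The height function of a system of cycles -/

/-- The permutation `o` of the squares moves every square of `D` to itself or to an adjacent square
of `D`, and fixes all other squares. -/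
structure IsFlow (D : Finset Square) (o : Square → Square) : Prop where
  mem : ∀ v ∈ D, o v ∈ D
  fix : ∀ v, v ∉ D → o v = v
  inj : Function.Injective o
  adj : ∀ v, o v ≠ v → Adj (v, 0) (o v, 0)

/-- The sum of the signed crossings of the cycles of `o` with the ray from a face. -/
def flowHeight (D : Finset Square) (o : Square → Square) (j : Square) : ℤ :=
  ∑ v ∈ D, crossing j (v, o v)

/-- `1` if `o v = w`, and `0` otherwise. -/
def arrow (o : Square → Square) (v w : Square) : ℤ := if o v = w then 1 else 0

theorem crossing_self (j v : Square) : crossing j (v, v) = 0 := by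
  simp only [crossing]
  split_ifs <;> omega

theorem crossing_right (j : Square) (a b : ℤ) : crossing j ((a, b), (a + 1, b)) = 0 :=
  if_neg (by simp)

theorem crossing_left (j : Square) (a b : ℤ) : crossing j ((a, b), (a - 1, b)) = 0 :=
  if_neg (by simp only [not_and]; omega)

theorem crossing_down (j : Square) (a b : ℤ) : crossing j ((a, b), (a, b + 1)) =
    -if j.1 < a ∧ j.2 = b then 1 else 0 := by
  simp only [crossing, and_true]
  split_ifs <;> omega

theorem crossing_up (j : Square) (a b : ℤ) : crossing j ((a, b), (a, b - 1)) =
    if j.1 < a ∧ j.2 = b - 1 then 1 else 0 := by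
  simp only [crossing, and_true]
  split_ifs <;> omega

namespace IsFlow

variable {D : Finset Square} {o : Square → Square}

theorem sum_comp (ho : IsFlow D o) (χ : Square → ℤ) : ∑ v ∈ D, χ (o v) = ∑ v ∈ D, χ v :=
  Finset.sum_nbij o ho.mem ho.inj.injOn
    (Finset.surjOn_of_injOn_of_card_le _ ho.mem ho.inj.injOn le_rfl) fun _ _ => rfl

theorem sum_arrow (ho : IsFlow D o) {v w : Square} (hne : v ≠ w) :
    ∑ u ∈ D, (if u = v ∧ o u = w then (1 : ℤ) else 0) = arrow o v w := by
  rw [arrow]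
  by_cases hv : v ∈ D
  · rw [Finset.sum_eq_single v]
    · simp
    · intro u _ hu
      rw [if_neg fun h => hu h.1]
    · exact fun h => absurd hv h
  · rw [ho.fix v hv, if_neg hne]
    refine Finset.sum_eq_zero fun u hu => if_neg ?_
    rintro ⟨rfl, -⟩
    exact hv hu

theorem adj_cases (ho : IsFlow D o) (x y : ℤ) : o (x, y) = (x, y) ∨ o (x, y) = (x + 1, y) ∨
    o (x, y) = (x, y + 1) ∨ o (x, y) = (x - 1, y) ∨ o (x, y) = (x, y - 1) := by
  by_cases h : o (x, y) = (x, y)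
  · exact Or.inl h
  · have := ho.adj _ h
    rw [adj_iff] at this
    simp only [Prod.ext_iff] at this h ⊢
    omega

/-- The ray from the left face crosses one more vertical edge position, the one between the two
faces. -/
theorem flowHeight_left (ho : IsFlow D o) (x y : ℤ) :
    flowHeight D o (x - 1, y) - flowHeight D o (x, y) =
      arrow o (x, y + 1) (x, y) - arrow o (x, y) (x, y + 1) := by
  rw [← ho.sum_arrow (by simp), ← ho.sum_arrow (by simp), flowHeight, flowHeight,
    ← Finset.sum_sub_distrib, ← Finset.sum_sub_distrib]
  refine Finset.sum_congr rfl fun ⟨a, b⟩ _ => ?_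
  rcases ho.adj_cases a b with h | h | h | h | h <;> rw [h] <;>
    simp only [crossing_self, crossing_right, crossing_left, crossing_up, crossing_down,
      Prod.mk.injEq] <;> split_ifs <;> omega

/-- The two rays enclose the half row of squares to the right of `x` in row `y`. Since `o` is a
permutation, as many arrows leave this half row as enter it, so the difference of the vertical
crossings equals the flow through its end. -/
theorem flowHeight_up (ho : IsFlow D o) (x y : ℤ) :
    flowHeight D o (x, y - 1) - flowHeight D o (x, y) =
      arrow o (x, y) (x + 1, y) - arrow o (x + 1, y) (x, y) := by
  have h0 := ho.sum_comp fun v => if x < v.1 ∧ v.2 = y then 1 else 0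
  rw [← sub_eq_zero, ← Finset.sum_sub_distrib] at h0
  rw [← ho.sum_arrow (by simp), ← ho.sum_arrow (by simp), flowHeight, flowHeight,
    ← Finset.sum_sub_distrib, ← Finset.sum_sub_distrib, ← sub_eq_zero, ← Finset.sum_sub_distrib,
    ← neg_eq_zero, ← Finset.sum_neg_distrib, ← h0]
  refine Finset.sum_congr rfl fun ⟨a, b⟩ _ => ?_
  rcases ho.adj_cases a b with h | h | h | h | h <;> rw [h] <;>
    simp only [crossing_self, crossing_right, crossing_left, crossing_up, crossing_down,
      Prod.mk.injEq] <;> split_ifs <;> omega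

theorem surjective (ho : IsFlow D o) : Function.Surjective o := by
  intro v
  by_cases hv : v ∈ D
  · obtain ⟨u, -, hu⟩ := Finset.surjOn_of_injOn_of_card_le (s := D) (t := D) o ho.mem
      ho.inj.injOn le_rfl hv
    exact ⟨u, hu⟩
  · exact ⟨v, ho.fix v hv⟩

theorem arrow_from (x y : ℤ) (w : Square) : arrow o (x, y) w = if o (x, y) = w then 1 else 0 := rfl

theorem arrow_to (ho : IsFlow D o) {v u : Square} (hu : o u = v) (w : Square) :
    arrow o w v = if w = u then 1 else 0 := by
  rw [arrow, ← hu]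
  simp only [ho.inj.eq_iff]

/-- The heights around a square are determined by the two arrows at the square. -/
theorem flowHeight_around (ho : IsFlow D o) (x y : ℤ) : ∃ u, o u = (x, y) ∧
    (u = (x, y) ∨ u = (x + 1, y) ∨ u = (x, y + 1) ∨ u = (x - 1, y) ∨ u = (x, y - 1)) ∧
    flowHeight D o (x, y - 1) - flowHeight D o (x, y) =
      (if o (x, y) = (x + 1, y) then 1 else 0) - (if (x + 1, y) = u then 1 else 0) ∧
    flowHeight D o (x, y) - flowHeight D o (x - 1, y) =
      (if o (x, y) = (x, y + 1) then 1 else 0) - (if (x, y + 1) = u then 1 else 0) ∧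
    flowHeight D o (x - 1, y) - flowHeight D o (x - 1, y - 1) =
      (if o (x, y) = (x - 1, y) then 1 else 0) - (if (x - 1, y) = u then 1 else 0) ∧
    flowHeight D o (x - 1, y - 1) - flowHeight D o (x, y - 1) =
      (if o (x, y) = (x, y - 1) then 1 else 0) - (if (x, y - 1) = u then 1 else 0) := by
  obtain ⟨u, hu⟩ := ho.surjective (x, y)
  have d1 := ho.flowHeight_up x y
  have d2 := ho.flowHeight_left x y
  have d3 := ho.flowHeight_up (x - 1) y
  have d4 := ho.flowHeight_left x (y - 1)
  simp only [sub_add_cancel] at d3 d4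
  rw [ho.arrow_to hu, arrow_from] at d1 d2 d3 d4
  refine ⟨u, hu, ?_, d1, by omega, by omega, d4⟩
  obtain ⟨a, b⟩ := u
  rcases ho.adj_cases a b with h | h | h | h | h <;> rw [h] at hu <;>
    simp only [Prod.mk.injEq] at hu ⊢ <;> omega

theorem validAt (ho : IsFlow D o) (v : Square) : ValidAt (flowHeight D o) v := by
  obtain ⟨x, y⟩ := v
  obtain ⟨u, hu, hc, d1, d2, d3, d4⟩ := ho.flowHeight_around x y
  simp only [ValidAt]
  rcases hc with rfl | rfl | rfl | rfl | rfl <;>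
    rcases ho.adj_cases x y with h | h | h | h | h <;> rw [h] at d1 d2 d3 d4 <;>
    simp only [Prod.mk.injEq, true_and, and_true, add_eq_left, left_eq_add, sub_eq_self,
      and_self, if_true] at d1 d2 d3 d4 <;>
    split_ifs at d1 d2 d3 d4 <;> omega

/-- An arrow is a step of the heights unless the opposite arrow cancels it; so the heights determine
the flow except on cycles of length two, where they are locally constant. -/
theorem out_flowHeight (ho : IsFlow D o) (v : Square) :
    out (flowHeight D o) v = if o (o v) = v then v else o v := by
  obtain ⟨x, y⟩ := v
  obtain ⟨u, hu, hc, d1, d2, d3, d4⟩ := ho.flowHeight_around x y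
  have e : o (o (x, y)) = (x, y) ↔ o (x, y) = u := by
    rw [← hu, ho.inj.eq_iff, hu]
  simp only [out, e, d1, d2, d3, d4]
  clear d1 d2 d3 d4 e hu
  have n1 : ∀ z : ℤ, ¬ z + 1 = z - 1 := by omega
  have n2 : ∀ z : ℤ, ¬ z - 1 = z + 1 := by omega
  have n3 : ∀ z : ℤ, ¬ z = z - 1 := by omega
  rcases hc with rfl | rfl | rfl | rfl | rfl <;>
    rcases ho.adj_cases x y with h | h | h | h | h <;> rw [h] <;>
    simp [n1, n2, n3]

end IsFlow

/-! ### Cycles of length two and the twist of a flow -/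

namespace IsFlow

variable {D : Finset Square} {o : Square → Square}

/-- Cycles of length two are replaced by columns. -/
theorem reach_hlay (ho : IsFlow D o) {Q : Finset Square} (hDQ : D ⊆ Q) (m : ℤ) :
    Reach (lay o Q m) (hlay (flowHeight D o) Q m) := by
  set A := D.filter fun v => o (o v) = v ∧ o v ≠ v with hA
  have hmA : ∀ v, v ∈ A ↔ o (o v) = v ∧ o v ≠ v := fun v => by
    rw [hA, Finset.mem_filter]
    exact ⟨And.right, fun h => ⟨by_contra fun hD => h.2 (ho.fix v hD), h⟩⟩
  have hAQ : A ⊆ Q := (Finset.filter_subset _ _).trans hDQ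
  have hadj : ∀ v ∈ A, Adj (v, 0) (o v, 0) := fun v hv => ho.adj v ((hmA v).1 hv).2
  have hcolor : ∀ v ∈ A, (IsWhite (o v) ↔ ¬ IsWhite v) := fun v hv => by
    have := hadj v hv
    rw [adj_iff] at this
    simp only [IsWhite, Int.even_iff] at this ⊢
    omega
  have hne : ∀ v ∈ A, o v ≠ v := fun v hv => ((hmA v).1 hv).2
  have hmaps : ∀ v ∈ A, o v ∈ A := fun v hv => by
    rw [hmA] at hv ⊢
    exact ⟨by rw [hv.1], fun he => hv.2 (by rw [hv.1] at he; exact he.symm)⟩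
  obtain ⟨hWB, -⟩ := map_filter_isWhite ho.inj.injOn hmaps hcolor
  -- In a cycle of length two both dimers cover the same pair of squares, one on each floor, so they
  -- form a vertical slab that flips to two columns.
  have hflip : flats o (A.filter fun v => ¬ IsWhite v).val (m + 1) =
      flats o (A.filter IsWhite).val (m + 1) := by
    rw [← hWB, flats, flats, Multiset.map_map]
    refine Multiset.map_congr rfl fun v hv => ?_
    rw [Function.comp_apply, ((hmA v).1 (Finset.mem_filter.1 hv).1).1, Finset.pair_comm]
  refine lay_reach_of_subset hAQ ?_ fun v _ hvA => ?_
  · rw [lay_eq_flats hne, hflip, lay_eq_cols (o := out (flowHeight D o)) (Q := A) fun v hv => by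
      rw [ho.out_flowHeight, if_pos ((hmA v).1 hv).1], ← filter_isWhite_add A, cols_add, ← hWB]
    exact (sweep (fun v hv => hadj v (Finset.mem_filter.1 hv).1) m).symm
  · rw [hmA] at hvA
    rw [ho.out_flowHeight]
    split_ifs with h
    · by_contra hov
      exact hvA ⟨h, hov⟩
    · rfl

theorem constAt_iff (ho : IsFlow D o) (v : Square) :
    ConstAt (flowHeight D o) v ↔ o (o v) = v := by
  rw [← out_eq_self_iff (ho.validAt v), ho.out_flowHeight]
  refine ⟨fun h => ?_, fun h => if_pos h⟩
  by_contra hn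
  rw [if_neg hn] at h
  exact hn (by rw [h, h])

/-- The heights are also constant around the squares of cycles of length two, which are not jewels.
The involution `o` pairs these: equal heights, opposite colors, so their terms cancel. -/
theorem heightTwist_eq (ho : IsFlow D o) {F : Finset Square} (hDF : D ⊆ F)
    (h0 : ∀ v, v ∉ D → flowHeight D o v = 0) : heightTwist F (flowHeight D o) =
      ∑ v ∈ D.filter fun v => o v = v, sgn v * flowHeight D o v := by
  have e1 : heightTwist F (flowHeight D o) = ∑ v ∈ D, sgn v * level (flowHeight D o) v := by
    refine (Finset.sum_subset hDF fun v _ hv => ?_).symm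
    rw [level, h0 v hv, ite_self, mul_zero]
  have e2 : ∑ v ∈ D.filter (fun v => ¬ o v = v), sgn v * level (flowHeight D o) v = 0 := by
    have e3 : ∑ v ∈ D.filter (fun v => ¬ o v = v), sgn v * level (flowHeight D o) v =
        ∑ v ∈ D.filter (fun v => ¬ o v = v ∧ o (o v) = v), sgn v * flowHeight D o v := by
      rw [← Finset.filter_filter, Finset.sum_filter (s := Finset.filter _ _)]
      refine Finset.sum_congr rfl fun v _ => ?_
      rw [level]
      simp only [ho.constAt_iff]
      split_ifs <;> simp
    rw [e3]
    refine Finset.sum_involution (fun v _ => o v) (fun v hv => ?_) (fun v hv _ => ?_)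
      (fun v hv => ?_) (fun v hv => ?_) <;> rw [Finset.mem_filter] at hv
    · obtain ⟨-, hne, hoo⟩ := hv
      have hs : sgn (o v) = -sgn v := by
        have hadj := ho.adj v hne
        rw [adj_iff] at hadj
        simp only at hadj
        simp only [sgn, IsWhite, Int.even_iff]
        split_ifs <;> omega
      have hc := (ho.constAt_iff v).2 hoo
      have hc' := (ho.constAt_iff (o v)).2 (by rw [hoo])
      have hh : flowHeight D o (o v) = flowHeight D o v := by
        obtain ⟨x, y⟩ := v
        rcases ho.adj_cases x y with h | h | h | h | h <;> rw [h] at hc' ⊢ <;>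
          rw [DominoBrick.constAt_iff] at hc hc' <;>
          (try simp only [add_sub_cancel_right] at hc') <;> omega
      rw [hs, hh]
      ring
    · exact hv.2.1
    · rw [Finset.mem_filter, hv.2.2]
      exact ⟨ho.mem v hv.1, Ne.symm hv.2.1, rfl⟩
    · exact hv.2.2
  rw [e1, ← Finset.sum_filter_add_sum_filter_not D (fun v => o v = v), e2, add_zero]
  refine Finset.sum_congr rfl fun v hv => ?_
  rw [level, if_pos ((ho.constAt_iff v).2 (by rw [(Finset.mem_filter.1 hv).2,
    (Finset.mem_filter.1 hv).2]))]

end IsFlow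

/-! ### Winding numbers around the holes of a simply connected region -/

open scoped unitInterval in
/-- A branch of the logarithm of a function on a simply connected space, described by its
increments along paths. -/
theorem exists_log {X : Type*} [TopologicalSpace X] [SimplyConnectedSpace X] (f : C(X, ℂ))
    (hf : ∀ x, f x ≠ 0) : ∃ L : X → ℂ, ∀ (a b : X) (γ : Path a b) (Γ : C(I, ℂ)),
      (∀ t, Complex.exp (Γ t) = f (γ t)) → L b - L a = Γ 1 - Γ 0 := by
  have cov := Complex.isCoveringMap_exp
  set g : C(X, {z : ℂ // z ≠ 0}) := ⟨fun x => ⟨f x, hf x⟩, by fun_prop⟩ with hg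
  obtain ⟨x₀⟩ : Nonempty X := inferInstance
  -- The branch is defined by lifting, through the exponential, a chosen path from `x₀` to each
  -- point.
  let p : ∀ x, Path x₀ x := fun x => (PathConnectedSpace.joined x₀ x).somePath
  have hex : ∀ x, ∃ Γ : C(I, ℂ), (∀ t, Complex.exp (Γ t) = f (p x t)) ∧
      Γ 0 = Complex.log (f x₀) := by
    intro x
    obtain ⟨Γ, h1, h2⟩ := cov.exists_path_lifts (g.comp (p x)) (Complex.log (f x₀))
      (Subtype.ext (by simp [hg, Complex.exp_log (hf x₀)]))
    exact ⟨Γ, fun t => congrArg Subtype.val (congrFun h1 t), h2⟩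
  choose G hG hG0 using hex
  refine ⟨fun x => G x 1, fun a b γ Γ hΓ => ?_⟩
  let P₁ : Path (Complex.log (f x₀)) (G a 1) := ⟨G a, hG0 a, rfl⟩
  -- Along `γ` the lift from `a` is continued by the increments of `Γ`. The lift of the chosen path
  -- to `b` must then end at the same value, since the two paths from `x₀` to `b` are homotopic.
  let P₂ : Path (G a 1) (G a 1 + (Γ 1 - Γ 0)) :=
    ⟨⟨fun t => G a 1 + (Γ t - Γ 0), by fun_prop⟩, by simp, rfl⟩
  have hP₂ : ∀ t, Complex.exp (P₂ t) = f (γ t) := fun t => by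
    change Complex.exp (G a 1 + (Γ t - Γ 0)) = _
    rw [Complex.exp_add, Complex.exp_sub, hΓ, hΓ, hG, γ.source, (p a).target,
      mul_div_cancel₀ _ (hf a)]
  have hlift : ∀ t, Complex.exp ((P₁.trans P₂) t) = f ((p a).trans γ t) := fun t => by
    rw [Path.trans_apply, Path.trans_apply]
    split_ifs
    · exact hG a _
    · exact hP₂ _
  have h0 : ∀ q : Path x₀ b, (g.comp q.toContinuousMap) 0 = ⟨_, Complex.exp_ne_zero
      (Complex.log (f x₀))⟩ := fun q => Subtype.ext (by simp [hg, Complex.exp_log (hf x₀)])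
  have main := cov.liftPath_apply_one_eq_of_homotopicRel
    (ContinuousMap.HomotopicRel.comp_continuousMap
      (SimplyConnectedSpace.paths_homotopic (p b) ((p a).trans γ)) g)
    (Complex.log (f x₀)) (h0 (p b)) (h0 ((p a).trans γ))
  rw [← (cov.eq_liftPath_iff' (h0 (p b))).2 ⟨funext fun t => Subtype.ext (hG b t), hG0 b⟩,
    ← (cov.eq_liftPath_iff' (h0 ((p a).trans γ)) (Γ := (P₁.trans P₂).toContinuousMap)).2
      ⟨funext fun t => Subtype.ext (hlift t), (P₁.trans P₂).source⟩] at main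
  have h1 : (P₁.trans P₂).toContinuousMap 1 = G a 1 + (Γ 1 - Γ 0) := (P₁.trans P₂).target
  simp only [main, h1]
  ring

/-- The center of a square. -/
noncomputable def center (u : Square) : ℝ × ℝ := (u.1 + 1 / 2, u.2 + 1 / 2)

/-- The position of a point relative to a point of the square `v`. -/
noncomputable def relPos (v : Square) (x : ℝ × ℝ) : ℂ := ⟨x.1 - (v.1 + 1 / 2), x.2 - (v.2 + 3 / 4)⟩

theorem continuous_relPos (v : Square) : Continuous (relPos v) := by
  have : relPos v = fun x => ((x.1 - (v.1 + 1 / 2) : ℝ) : ℂ) +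
      ((x.2 - (v.2 + 3 / 4) : ℝ) : ℂ) * Complex.I := by
    funext x
    exact (Complex.mk_eq_add_mul_I _ _)
  rw [this]
  fun_prop

/-- The base point is interior to the square `v`, hence avoids all other closed unit squares. It
lies a quarter unit below the center so that its horizontal ray misses all centers of squares. -/
theorem relPos_ne_zero {D : Finset Square} {v : Square} (hv : v ∉ D) {x : ℝ × ℝ}
    (hx : x ∈ planeRegion D) : relPos v x ≠ 0 := by
  intro h
  have h1 : x.1 - (v.1 + 1 / 2) = 0 := congrArg Complex.re h
  have h2 : x.2 - (v.2 + 3 / 4) = 0 := congrArg Complex.im h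
  simp only [planeRegion, Set.mem_iUnion, Set.mem_prod, Set.mem_Icc] at hx
  obtain ⟨w, hw, ⟨h3, h4⟩, h5, h6⟩ := hx
  refine hv ?_
  convert hw
  have e1 : (v.1 : ℝ) < w.1 + 1 := by linarith
  have e2 : (w.1 : ℝ) < v.1 + 1 := by linarith
  have e3 : (v.2 : ℝ) < w.2 + 1 := by linarith
  have e4 : (w.2 : ℝ) < v.2 + 1 := by linarith
  norm_cast at e1 e2 e3 e4
  exact Prod.ext (by omega) (by omega)

open AffineMap in
theorem lineMap_center_mem {D : Finset Square} {u w : Square} (hu : u ∈ D) (hw : w ∈ D)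
    (h : Adj (u, 0) (w, 0)) {t : ℝ} (ht : t ∈ Set.Icc (0 : ℝ) 1) :
    lineMap (center u) (center w) t ∈ planeRegion D := by
  obtain ⟨x, y⟩ := u
  obtain ⟨x', y'⟩ := w
  rw [adj_iff] at h
  simp only at h
  simp only [planeRegion, Set.mem_iUnion, Set.mem_prod, Set.mem_Icc]
  obtain ⟨h0, h1⟩ := ht
  rcases le_total t (1 / 2) with ht | ht
  · refine ⟨_, hu, ?_⟩
    simp only [center, lineMap_apply, vsub_eq_sub, vadd_eq_add, Prod.fst_add, Prod.snd_add,
      Prod.smul_fst, Prod.smul_snd, Prod.fst_sub, Prod.snd_sub, smul_eq_mul]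
    rcases h with ⟨rfl | rfl, rfl, -⟩ | ⟨rfl | rfl, rfl, -⟩ | h
    any_goals push_cast; constructor <;> constructor <;> nlinarith
    omega
  · refine ⟨_, hw, ?_⟩
    simp only [center, lineMap_apply, vsub_eq_sub, vadd_eq_add, Prod.fst_add, Prod.snd_add,
      Prod.smul_fst, Prod.smul_snd, Prod.fst_sub, Prod.snd_sub, smul_eq_mul]
    rcases h with ⟨rfl | rfl, rfl, -⟩ | ⟨rfl | rfl, rfl, -⟩ | h
    any_goals push_cast; constructor <;> constructor <;> nlinarith
    omega

/-- The logarithm with a cut along the positive real axis, up to a constant. -/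
theorem log_sub_log_of_im {a b : ℂ} (ha : a.im < 0) (hb : 0 < b.im) :
    Complex.log b - Complex.log a =
      Complex.log (-b) - Complex.log (-a) + 2 * Real.pi * Complex.I := by
  simp only [Complex.log, norm_neg, Complex.arg_neg_eq_arg_sub_pi_of_im_pos hb,
    Complex.arg_neg_eq_arg_add_pi_of_im_neg ha]
  push_cast
  ring

/-- The increments of the logarithm along the edges of a system of cycles. -/
theorem exists_log_center {D : Finset Square} (hD : IsSimplyConnected (planeRegion D))
    {v : Square} (hv : v ∉ D) : ∃ L : Square → ℂ, ∀ u ∈ D, ∀ w ∈ D, Adj (u, 0) (w, 0) →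
      L w - L u = Complex.log (-relPos v (center w)) - Complex.log (-relPos v (center u)) -
        2 * Real.pi * Complex.I * (crossing v (u, w) : ℂ) := by
  have := hD.simplyConnectedSpace
  obtain ⟨L, hL⟩ := exists_log (X := planeRegion D)
    ⟨fun x => relPos v x, (continuous_relPos v).comp continuous_subtype_val⟩
    fun x => relPos_ne_zero hv x.2
  have hc : ∀ u ∈ D, center u ∈ planeRegion D := fun u hu => by
    simp only [planeRegion, Set.mem_iUnion, Set.mem_prod, Set.mem_Icc]
    refine ⟨u, hu, ?_⟩
    simp only [center]
    norm_num
  refine ⟨fun u => if hu : u ∈ D then L ⟨center u, hc u hu⟩ else 0, fun u hu w hw hadj => ?_⟩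
  simp only [dif_pos hu, dif_pos hw]
  let γ : Path (⟨center u, hc u hu⟩ : planeRegion D) ⟨center w, hc w hw⟩ :=
    { toFun := fun t => ⟨AffineMap.lineMap (center u) (center w) (t : ℝ),
        lineMap_center_mem hu hw hadj t.2⟩
      continuous_toFun := by
        refine Continuous.subtype_mk ?_ _
        exact (AffineMap.lineMap_continuous).comp continuous_subtype_val
      source' := by simp
      target' := by simp }
  have hγ : Continuous fun t => relPos v (γ t).1 :=
    (continuous_relPos v).comp (continuous_subtype_val.comp γ.continuous)
  have hre : ∀ t, (relPos v (γ t).1).re = (1 - (t : ℝ)) * (relPos v (center u)).re +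
      t * (relPos v (center w)).re := fun t => by
    change (relPos v (AffineMap.lineMap (center u) (center w) (t : ℝ))).re = _
    simp only [relPos, AffineMap.lineMap_apply, vsub_eq_sub, vadd_eq_add, Prod.fst_add,
      Prod.smul_fst, Prod.fst_sub, smul_eq_mul]
    ring
  have him : ∀ t, (relPos v (γ t).1).im = (1 - (t : ℝ)) * (relPos v (center u)).im +
      t * (relPos v (center w)).im := fun t => by
    change (relPos v (AffineMap.lineMap (center u) (center w) (t : ℝ))).im = _
    simp only [relPos, AffineMap.lineMap_apply, vsub_eq_sub, vadd_eq_add, Prod.snd_add,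
      Prod.smul_snd, Prod.snd_sub, smul_eq_mul]
    ring
  have convex_pos : ∀ (a b : ℝ) (t : unitInterval), 0 < a → 0 < b →
      0 < (1 - (t : ℝ)) * a + t * b := by
    intro a b t ha hb
    have h0 := t.2.1
    have h1 := t.2.2
    rcases h0.eq_or_lt with h | h
    · rw [← h]; simpa using ha
    · nlinarith [mul_pos h hb, mul_nonneg (sub_nonneg.2 h1) ha.le]
  have convex_neg : ∀ (a b : ℝ) (t : unitInterval), a < 0 → b < 0 →
      (1 - (t : ℝ)) * a + t * b < 0 := by
    intro a b t ha hb
    have := convex_pos (-a) (-b) t (by linarith) (by linarith)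
    linarith
  -- Off the positive real axis, `log (-z) + π i` is a continuous logarithm of `z`.
  have hneg : (∀ t, -relPos v (γ t).1 ∈ Complex.slitPlane) → L ⟨center w, hc w hw⟩ -
      L ⟨center u, hc u hu⟩ = Complex.log (-relPos v (center w)) -
        Complex.log (-relPos v (center u)) := by
    intro hs
    have := hL _ _ γ ⟨fun t => Complex.log (-relPos v (γ t).1) + Real.pi * Complex.I,
      (hγ.neg.clog hs).add continuous_const⟩ fun t => by
        change Complex.exp (Complex.log (-relPos v (γ t).1) + Real.pi * Complex.I) =
          relPos v (γ t).1
        rw [Complex.exp_add, Complex.exp_log (neg_ne_zero.2 (relPos_ne_zero hv (γ t).2)),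
          Complex.exp_pi_mul_I]
        ring
    rw [this]
    simp
  -- For edges that cross the positive real axis the principal branch is used; the two branches
  -- differ by the jump in `log_sub_log_of_im`.
  have hpos : (∀ t, relPos v (γ t).1 ∈ Complex.slitPlane) → L ⟨center w, hc w hw⟩ -
      L ⟨center u, hc u hu⟩ = Complex.log (relPos v (center w)) -
        Complex.log (relPos v (center u)) := by
    intro hs
    have := hL _ _ γ ⟨fun t => Complex.log (relPos v (γ t).1), hγ.clog hs⟩ fun t =>
      Complex.exp_log (relPos_ne_zero hv (γ t).2)
    rw [this]
    simp
  have hr : ∀ q : Square, (relPos v (center q)).re = ((q.1 - v.1 : ℤ) : ℝ) := fun q => by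
    simp only [relPos, center]; push_cast; ring
  have hi : ∀ q : Square, (relPos v (center q)).im = ((q.2 - v.2 : ℤ) : ℝ) - 1 / 4 := fun q => by
    simp only [relPos, center]; push_cast; ring
  have ipos : ∀ q : Square, v.2 < q.2 → 0 < (relPos v (center q)).im := fun q hq => by
    rw [hi]
    have : (1 : ℝ) ≤ ((q.2 - v.2 : ℤ) : ℝ) := by exact_mod_cast (by omega : 1 ≤ q.2 - v.2)
    linarith
  have ineg : ∀ q : Square, q.2 ≤ v.2 → (relPos v (center q)).im < 0 := fun q hq => by
    rw [hi]
    have : ((q.2 - v.2 : ℤ) : ℝ) ≤ 0 := by exact_mod_cast (by omega : q.2 - v.2 ≤ 0)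
    linarith
  have hcr : (v.2 < u.2 ∧ v.2 < w.2) ∨ (u.2 ≤ v.2 ∧ w.2 ≤ v.2) → crossing v (u, w) = 0 := by
    intro h
    simp only [crossing]
    split_ifs <;> omega
  rw [adj_iff] at hadj
  simp only at hadj
  by_cases h1 : v.2 < u.2 ∧ v.2 < w.2
  · rw [hcr (Or.inl h1), hneg fun t => Complex.mem_slitPlane_iff.2 (Or.inr ?_)]
    · simp
    · rw [Complex.neg_im, him]
      exact neg_ne_zero.2 (convex_pos _ _ t (ipos u h1.1) (ipos w h1.2)).ne'
  by_cases h2 : u.2 ≤ v.2 ∧ w.2 ≤ v.2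
  · rw [hcr (Or.inr h2), hneg fun t => Complex.mem_slitPlane_iff.2 (Or.inr ?_)]
    · simp
    · rw [Complex.neg_im, him]
      exact neg_ne_zero.2 (convex_neg _ _ t (ineg u h2.1) (ineg w h2.2)).ne
  have huv : u ≠ v := fun h => hv (h ▸ hu)
  have hwv : w ≠ v := fun h => hv (h ▸ hw)
  rw [Ne, Prod.ext_iff] at huv hwv
  -- The edge now crosses the horizontal line through the base point. On the left it misses the ray;
  -- straight below the center one of its ends would be `v` itself, which is not in `D`; on the
  -- right it crosses the ray once.
  rcases lt_trichotomy u.1 v.1 with h3 | h3 | h3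
  · have hcr0 : crossing v (u, w) = 0 := by
      simp only [crossing]
      split_ifs <;> omega
    rw [hcr0, hneg fun t => Complex.mem_slitPlane_iff.2 (Or.inl ?_)]
    · simp
    · rw [Complex.neg_re, hre]
      refine neg_pos.2 (convex_neg _ _ t ?_ ?_) <;> rw [hr] <;> exact_mod_cast (by omega)
  · omega
  · rw [hpos fun t => Complex.mem_slitPlane_iff.2 (Or.inl ?_)]
    · rcases lt_or_ge v.2 w.2 with h4 | h4
      · have hcr1 : crossing v (u, w) = -1 := by
          simp only [crossing]
          split_ifs <;> omega
        rw [hcr1, log_sub_log_of_im (ineg u (by omega)) (ipos w h4)]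
        push_cast
        ring
      · have hcr1 : crossing v (u, w) = 1 := by
          simp only [crossing]
          split_ifs <;> omega
        have := log_sub_log_of_im (ineg w h4) (ipos u (by omega))
        rw [hcr1]
        push_cast
        linear_combination -this
    · rw [hre]
      refine convex_pos _ _ t ?_ ?_ <;> rw [hr] <;> exact_mod_cast (by omega)

/-- The cycles in a simply connected region do not wind around the squares outside. -/
theorem IsFlow.flowHeight_eq_zero {D : Finset Square} {o : Square → Square} (ho : IsFlow D o)
    (hD : IsSimplyConnected (planeRegion D)) {v : Square} (hv : v ∉ D) :
    flowHeight D o v = 0 := by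
  obtain ⟨L, hL⟩ := exists_log_center hD hv
  -- The sum of `M (o u) - M u` vanishes because `o` permutes `D`, while each term is a multiple of
  -- the crossing number. So the total crossing number is zero.
  set M : Square → ℂ := fun u => L u - Complex.log (-relPos v (center u)) with hM
  have hsum : ∑ u ∈ D, M (o u) = ∑ u ∈ D, M u :=
    Finset.sum_nbij o ho.mem ho.inj.injOn
      (Finset.surjOn_of_injOn_of_card_le _ ho.mem ho.inj.injOn le_rfl) fun _ _ => rfl
  have hstep : ∀ u ∈ D, M (o u) - M u =
      -(2 * Real.pi * Complex.I) * (crossing v (u, o u) : ℂ) := by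
    intro u hu
    by_cases hne : o u = u
    · rw [hne, crossing_self]; simp
    · have := hL u hu (o u) (ho.mem u hu) (ho.adj u hne)
      simp only [hM]
      linear_combination this
  rw [← sub_eq_zero, ← Finset.sum_sub_distrib, Finset.sum_congr rfl hstep, ← Finset.mul_sum,
    mul_eq_zero, neg_eq_zero] at hsum
  rcases hsum with h | h
  · exact absurd h Complex.two_pi_I_ne_zero
  · exact_mod_cast h

/-! ### The twist -/

theorem evalOne_derivative (P : ℤ[T;T⁻¹]) : evalOne (derivative P) =
    P.coeff.sum fun n a => a * n := by
  rw [derivative, Finsupp.sum, evalOne, map_sum]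
  refine Finset.sum_congr rfl fun n _ => ?_
  simp

/-- The value at `1` of the derivative, as an additive map. -/
noncomputable def slope : ℤ[T;T⁻¹] →+ ℤ where
  toFun P := evalOne (derivative P)
  map_zero' := by rw [evalOne_derivative]; simp
  map_add' P Q := by
    simp only [evalOne_derivative, AddMonoidAlgebra.coeff_add]
    exact Finsupp.sum_add_index' (by simp) (by intros; ring)

theorem slope_T (n : ℤ) : slope (LaurentPolynomial.T n) = n := by
  change evalOne (derivative _) = n
  rw [evalOne_derivative, LaurentPolynomial.T, AddMonoidAlgebra.coeff_single,
    Finsupp.sum_single_index (by simp), one_mul]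

namespace Tiling

theorem twist_eq {D : Finset Square} (t : Tiling (duplex D)) :
    t.twist = ∑ v ∈ t.jewels, sgn v * t.winding v := by
  change slope t.invariant = _
  rw [invariant, map_sub, map_sum, map_sum,
    ← Finset.sum_filter_add_sum_filter_not t.jewels IsWhite, sub_eq_neg_add,
    ← Finset.sum_neg_distrib]
  congr 1 <;> refine Finset.sum_congr rfl fun v hv => ?_ <;>
    simp [slope_T, sgn, (Finset.mem_filter.1 hv).2]

/-! ### The system of cycles of a tiling -/

theorem exists_adj {R : Finset Cube} (t : Tiling R) {a : Cube} (ha : a ∈ R) :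
    ∃ b, Adj a b ∧ {a, b} ∈ t.dimers := by
  rw [← t.cover, Finset.mem_biUnion] at ha
  obtain ⟨d, hd, had⟩ := ha
  obtain ⟨c, u, hu, rfl⟩ := t.isDimer d hd
  simp only [id, Finset.mem_insert, Finset.mem_singleton] at had
  rcases had with rfl | rfl
  · exact ⟨_, ⟨u, hu, Or.inl rfl⟩, hd⟩
  · exact ⟨c, ⟨u, hu, Or.inr rfl⟩, by rwa [Finset.pair_comm]⟩

theorem mem_of_mem_dimers {R : Finset Cube} (t : Tiling R) {a : Cube} {d : Finset Cube}
    (hd : d ∈ t.dimers) (ha : a ∈ d) : a ∈ R := by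
  rw [← t.cover]
  exact Finset.mem_biUnion.2 ⟨d, hd, ha⟩

theorem eq_of_mem {R : Finset Cube} (t : Tiling R) {a : Cube} {d e : Finset Cube}
    (hd : d ∈ t.dimers) (he : e ∈ t.dimers) (had : a ∈ d) (hae : a ∈ e) : d = e := by
  by_contra hne
  exact Finset.disjoint_left.1 (t.disjoint hd he hne) had hae

theorem eq_of_pair_mem {R : Finset Cube} (t : Tiling R) {a b b' : Cube}
    (hb : {a, b} ∈ t.dimers) (hb' : {a, b'} ∈ t.dimers) : b = b' := by
  have h := t.eq_of_mem hb hb' (a := a) (by simp) (by simp)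
  have h1 : b ∈ ({a, b'} : Finset Cube) := h ▸ by simp
  have h2 : b' ∈ ({a, b} : Finset Cube) := h ▸ by simp
  simp only [Finset.mem_insert, Finset.mem_singleton] at h1 h2
  rcases h1 with rfl | rfl
  · rcases h2 with rfl | rfl <;> rfl
  · rfl

theorem adj_of_mem {R : Finset Cube} (t : Tiling R) {a b : Cube} (h : {a, b} ∈ t.dimers) :
    Adj a b := by
  obtain ⟨b', h1, h2⟩ := t.exists_adj (t.mem_of_mem_dimers h (a := a) (by simp))
  rwa [t.eq_of_pair_mem h h2]

variable {D : Finset Square}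

theorem mem_duplex {v : Square} {z : ℤ} : (v, z) ∈ duplex D ↔ v ∈ D ∧ (z = 0 ∨ z = 1) := by
  simp only [duplex, floors, Finset.mem_product, Finset.mem_Ico]
  have : (0 ≤ z ∧ z < 2) ↔ (z = 0 ∨ z = 1) := by omega
  rw [this]

/-- The floor on which the edge of the drawing that leaves a square lies. -/
def exitFloor (v : Square) : ℤ := if IsWhite v then 0 else 1

theorem exitFloor_eq (v : Square) : exitFloor v = 0 ∨ exitFloor v = 1 := by
  rw [exitFloor]; split_ifs <;> simp

theorem exitFloor_of_adj {v w : Square} {z : ℤ} (h : Adj (v, z) (w, z)) :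
    exitFloor w = 1 - exitFloor v := by
  rw [adj_iff] at h
  simp only [exitFloor, IsWhite, Int.even_iff] at h ⊢
  split_ifs <;> omega

/-- The dimer on the exit floor of `v` that contains `v` joins it to `w`. -/
def Exit (t : Tiling (duplex D)) (v w : Square) : Prop :=
  {(v, exitFloor v), (w, exitFloor v)} ∈ t.dimers

open Classical in
/-- The square that follows `v` in the drawing, or `v` itself if `v` is a jewel. -/
noncomputable def next (t : Tiling (duplex D)) (v : Square) : Square :=
  if h : ∃ w, t.Exit v w then h.choose else v

theorem Exit.adj {t : Tiling (duplex D)} {v w : Square} (h : t.Exit v w) (z : ℤ) :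
    Adj (v, z) (w, z) := by
  have := t.adj_of_mem h
  rw [adj_iff] at this ⊢
  simpa using this

theorem Exit.ne {t : Tiling (duplex D)} {v w : Square} (h : t.Exit v w) : v ≠ w := fun he =>
  (h.adj 0).ne (by rw [he])

theorem Exit.mem {t : Tiling (duplex D)} {v w : Square} (h : t.Exit v w) : v ∈ D ∧ w ∈ D :=
  ⟨(mem_duplex.1 (t.mem_of_mem_dimers h (a := (v, exitFloor v)) (by simp))).1,
    (mem_duplex.1 (t.mem_of_mem_dimers h (a := (w, exitFloor v)) (by simp))).1⟩

theorem Exit.next_eq {t : Tiling (duplex D)} {v w : Square} (h : t.Exit v w) : t.next v = w := by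
  have hex : ∃ w, t.Exit v w := ⟨w, h⟩
  rw [next, dif_pos hex]
  exact congrArg Prod.fst (t.eq_of_pair_mem hex.choose_spec h)

theorem exit_next {t : Tiling (duplex D)} {v : Square} (h : t.next v ≠ v) :
    t.Exit v (t.next v) := by
  rw [next] at h ⊢
  split_ifs at h ⊢ with hex
  · exact hex.choose_spec
  · exact absurd rfl h

theorem column_mem {t : Tiling (duplex D)} {v : Square} (hv : v ∈ D) (h : t.next v = v) :
    {(v, 0), (v, 1)} ∈ t.dimers := by
  obtain ⟨⟨w, z⟩, hadj, hd⟩ := t.exists_adj (mem_duplex.2 ⟨hv, exitFloor_eq v⟩)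
  have hz := (mem_duplex.1 (t.mem_of_mem_dimers hd (a := (w, z)) (by simp))).2
  by_cases hw : w = v
  · subst hw
    have hne : z ≠ exitFloor w := fun he => hadj.ne (by rw [he])
    rcases exitFloor_eq w with h0 | h0 <;> rw [h0] at hd hne
    · rwa [show z = 1 by omega] at hd
    · rwa [show z = 0 by omega, Finset.pair_comm] at hd
  · have : z = exitFloor v := by
      rw [adj_iff] at hadj
      simp only at hadj
      rw [Prod.ext_iff] at hw
      omega
    subst this
    exact absurd (Exit.next_eq (show t.Exit v w from hd) ▸ h) hw

theorem column_mem_iff {t : Tiling (duplex D)} {v : Square} :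
    {(v, 0), (v, 1)} ∈ t.dimers ↔ v ∈ D ∧ t.next v = v := by
  refine ⟨fun h => ⟨(mem_duplex.1 (t.mem_of_mem_dimers h (a := (v, 0)) (by simp))).1, ?_⟩,
    fun h => column_mem h.1 h.2⟩
  by_contra hne
  have hex := exit_next hne
  have := t.eq_of_mem h hex (a := (v, exitFloor v))
    (by rcases exitFloor_eq v with h | h <;> simp [h]) (by simp)
  have h1 : (t.next v, exitFloor v) ∈ ({(v, 0), (v, 1)} : Finset Cube) := this ▸ by simp
  simp only [Finset.mem_insert, Finset.mem_singleton, Prod.mk.injEq] at h1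
  exact hne (h1.elim And.left And.left)

/-- A square that is not a jewel is left through the dimer on its exit floor and entered through the
one on the other floor. Neighboring squares have different exit floors, so two predecessors of a
square would share a cube with one and the same dimer. -/
theorem isFlow_next (t : Tiling (duplex D)) : IsFlow D t.next where
  mem v hv := by
    by_cases h : t.next v = v
    · rwa [h]
    · exact (exit_next h).mem.2
  fix v hv := by
    by_contra h
    exact hv (exit_next h).mem.1
  adj v h := (exit_next h).adj 0
  inj := by
    have key : ∀ v w, t.next v = v → t.next w = v → v = w := fun v w hv hw => by
      by_contra hne
      have hex : t.Exit w v := hw ▸ exit_next (by rw [hw]; exact hne)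
      have hc := column_mem hex.mem.2 hv
      have := t.eq_of_mem hc hex (a := (v, exitFloor w))
        (by rcases exitFloor_eq w with h | h <;> simp [h]) (by simp)
      have h1 : (w, exitFloor w) ∈ ({(v, 0), (v, 1)} : Finset Cube) := this ▸ by simp
      simp only [Finset.mem_insert, Finset.mem_singleton, Prod.mk.injEq] at h1
      exact hne (h1.elim (fun h => h.1.symm) fun h => h.1.symm)
    intro v w h
    by_cases hv : t.next v = v
    · exact key v w hv (by rw [← h, hv])
    by_cases hw : t.next w = w
    · exact (key w v hw (by rw [h, hw])).symm
    · have e1 := exit_next hv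
      have e2 := exit_next hw
      have h1 := exitFloor_of_adj (e1.adj 0)
      have h2 := exitFloor_of_adj (e2.adj 0)
      rw [h] at h1 e1
      have h3 : exitFloor v = exitFloor w := by omega
      rw [Exit, Finset.pair_comm] at e1 e2
      rw [h3] at e1
      exact congrArg Prod.fst (t.eq_of_pair_mem e1 e2)

theorem cell_next_of_ne {t : Tiling (duplex D)} {v : Square} (h : t.next v ≠ v) :
    cell t.next 0 v = {(v, exitFloor v), (t.next v, exitFloor v)} := by
  simp only [cell, cellPair, if_neg h, pairSet, exitFloor]
  split_ifs <;> simp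

theorem cell_next_of_eq {t : Tiling (duplex D)} {v : Square} (h : t.next v = v) :
    cell t.next 0 v = {(v, 0), (v, 1)} := by
  simp [cell, cellPair, if_pos h, pairSet]

/-- Each horizontal dimer is assigned to that one of its two squares whose exit floor is the floor
of the dimer, and each column to its jewel. -/
theorem dimers_eq (t : Tiling (duplex D)) : t.dimers = D.image (cell t.next 0) := by
  ext d
  rw [Finset.mem_image]
  constructor
  · intro hd
    have hflat : ∀ (v w : Square) (z : ℤ), v ≠ w → d = {(v, z), (w, z)} → exitFloor v = z →
        ∃ v ∈ D, cell t.next 0 v = d := by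
      rintro v w z hne rfl rfl
      have hex : t.Exit v w := hd
      exact ⟨v, hex.mem.1, by rw [cell_next_of_ne (by rw [hex.next_eq]; exact hne.symm),
        hex.next_eq]⟩
    obtain ⟨⟨v, z⟩, u, hu, hdu⟩ := t.isDimer d hd
    have hv := mem_duplex.1 (t.mem_of_mem_dimers hd (a := (v, z)) (by simp [hdu]))
    obtain ⟨⟨w, z'⟩, hw⟩ : ∃ b : Cube, b = (v, z) + u := ⟨_, rfl⟩
    rw [← hw] at hdu
    have hz' := (mem_duplex.1 (t.mem_of_mem_dimers hd (a := (w, z')) (by simp [hdu]))).2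
    have hadj : Adj (v, z) (w, z') := ⟨u, hu, Or.inl hw⟩
    by_cases hwv : w = v
    · subst hwv
      have hne : z ≠ z' := fun he => hadj.ne (by rw [he])
      have hdc : d = {(w, 0), (w, 1)} := by
        rcases hv.2 with h1 | h1 <;> rcases hz' with h2 | h2
        · omega
        · rw [hdu, h1, h2]
        · rw [hdu, h1, h2, Finset.pair_comm]
        · omega
      have := (column_mem_iff (t := t)).1 (hdc ▸ hd)
      exact ⟨w, this.1, by rw [cell_next_of_eq this.2, hdc]⟩
    · have hzz : z' = z := by
        have h := hadj
        rw [adj_iff] at h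
        simp only at h
        rw [Prod.ext_iff] at hwv
        omega
      subst hzz
      have h1 := exitFloor_of_adj hadj
      by_cases h2 : exitFloor v = z'
      · exact hflat v w z' (Ne.symm hwv) hdu h2
      · refine hflat w v z' hwv (by rw [hdu, Finset.pair_comm]) ?_
        have := exitFloor_eq v
        omega
  · rintro ⟨v, hv, rfl⟩
    by_cases h : t.next v = v
    · rw [cell_next_of_eq h]
      exact column_mem hv h
    · rw [cell_next_of_ne h]
      exact exit_next h

theorem cell_next_injOn (t : Tiling (duplex D)) : Set.InjOn (cell t.next 0) D := by
  intro v _ w _ h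
  have hmem : (v, exitFloor v) ∈ cell t.next 0 v := by
    by_cases hv : t.next v = v
    · rw [cell_next_of_eq hv]
      rcases exitFloor_eq v with h | h <;> simp [h]
    · rw [cell_next_of_ne hv]; simp
  rw [h] at hmem
  by_cases hw : t.next w = w
  · rw [cell_next_of_eq hw] at hmem
    simp only [Finset.mem_insert, Finset.mem_singleton, Prod.mk.injEq] at hmem
    exact hmem.elim And.left And.left
  · rw [cell_next_of_ne hw] at hmem
    simp only [Finset.mem_insert, Finset.mem_singleton, Prod.mk.injEq] at hmem
    rcases hmem with hmem | ⟨h1, h2⟩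
    · exact hmem.1
    · have := exitFloor_of_adj ((exit_next hw).adj 0)
      rw [← h1] at this
      have := exitFloor_eq v
      omega

theorem dimers_val (t : Tiling (duplex D)) : t.dimers.val = lay t.next D 0 := by
  rw [t.dimers_eq, Finset.image_val_of_injOn t.cell_next_injOn, lay]

theorem mem_drawing {t : Tiling (duplex D)} {e : Square × Square} :
    e ∈ t.drawing ↔ t.Exit e.1 e.2 := by
  rw [drawing, Finset.mem_filter, Finset.mem_product]
  have : (if IsWhite e.1 then ({(e.1, 0), (e.2, 0)} : Finset Cube) ∈ t.dimers
      else {(e.1, 1), (e.2, 1)} ∈ t.dimers) ↔ t.Exit e.1 e.2 := by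
    rw [Exit, exitFloor]
    split_ifs <;> rfl
  rw [this]
  exact ⟨And.right, fun h => ⟨h.mem, h⟩⟩

theorem winding_eq (t : Tiling (duplex D)) (j : Square) :
    t.winding j = flowHeight D t.next j := by
  have h0 : flowHeight D t.next j =
      ∑ v ∈ D.filter (fun v => t.next v ≠ v), crossing j (v, t.next v) := by
    rw [flowHeight, Finset.sum_filter]
    refine Finset.sum_congr rfl fun v _ => ?_
    split_ifs with h
    · rfl
    · rw [not_not.1 h, crossing_self]
  rw [h0, winding]
  refine Finset.sum_nbij' (fun e => e.1) (fun v => (v, t.next v)) ?_ ?_ ?_ ?_ ?_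
  · intro e he
    rw [mem_drawing] at he
    rw [Finset.mem_filter, he.next_eq]
    exact ⟨he.mem.1, he.ne.symm⟩
  · intro v hv
    rw [mem_drawing]
    exact exit_next (Finset.mem_filter.1 hv).2
  · intro e he
    rw [mem_drawing] at he
    simp only [he.next_eq]
  · exact fun v _ => rfl
  · intro e he
    rw [mem_drawing] at he
    simp only [he.next_eq]

theorem jewels_eq (t : Tiling (duplex D)) : t.jewels = D.filter fun v => t.next v = v := by
  rw [jewels]
  refine Finset.filter_congr fun v hv => ?_
  rw [column_mem_iff]
  exact and_iff_right hv

/-- The canonical charge is the twist: the jewels are the fixed squares of `next`, the heights are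
the winding numbers, and squares outside `D` have height zero. -/
theorem heightTwist_eq_twist (t : Tiling (duplex D)) (hD : IsSimplyConnected (planeRegion D))
    {F : Finset Square} (hF : D ⊆ F) : heightTwist F (flowHeight D t.next) = t.twist := by
  rw [t.isFlow_next.heightTwist_eq hF fun v hv => t.isFlow_next.flowHeight_eq_zero hD hv,
    twist_eq, jewels_eq]
  exact Finset.sum_congr rfl fun v _ => by rw [winding_eq]

/-! ### Embedded tilings as multisets of dimers -/

theorem union_val {R S U : Finset Cube} (t : Tiling R) (s : Tiling S) (hd : Disjoint R S)
    (hU : R ∪ S = U) : (t.union s hd hU).dimers.val = t.dimers.val + s.dimers.val := by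
  have hdis : Disjoint t.dimers s.dimers := by
    rw [Finset.disjoint_left]
    intro d h1 h2
    obtain ⟨c, u, -, rfl⟩ := t.isDimer d h1
    exact Finset.disjoint_left.1 hd (t.mem_of_mem_dimers h1 (a := c) (by simp))
      (s.mem_of_mem_dimers h2 (a := c) (by simp))
  change (t.dimers ∪ s.dimers).val = _
  rw [← Finset.disjUnion_eq_union _ _ hdis, Finset.disjUnion_val]

theorem columns_val (Q : Finset Square) (m : ℤ) : (columns Q m).dimers.val = cols Q.val m := by
  refine Finset.image_val_of_injOn fun v _ w _ h => ?_
  have : (v, m) ∈ ({(w, m), (w, m + 1)} : Finset Cube) := by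
    rw [← show ({(v, m), (v, m + 1)} : Finset Cube) = {(w, m), (w, m + 1)} from h]
    simp
  simp only [Finset.mem_insert, Finset.mem_singleton, Prod.mk.injEq] at this
  exact this.elim And.left And.left

theorem embedFour_val (t : Tiling (duplex D)) {Q : Finset Square} (h : D ⊆ Q) :
    (t.embedFour h).dimers.val = lay t.next Q 0 + hlay 0 Q 2 := by
  rw [embedFour, union_val, embedTwo, union_val, columns_val, columns_val, dimers_val,
    lay_sdiff h, hlay, lay_eq_cols (o := out 0) fun v _ => out_zero v,
    lay_eq_cols (o := t.next) (Q := Q \ D) fun v hv =>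
      t.isFlow_next.fix v (Finset.mem_sdiff.1 hv).2]

end Tiling

theorem exists_bound (D : Finset Square) : ∃ r : ℤ, 0 ≤ r ∧ ∀ q ∈ D, |q.1| ≤ r ∧ |q.2| ≤ r := by
  refine ⟨∑ q ∈ D, (|q.1| + |q.2|), Finset.sum_nonneg fun q _ => by positivity, fun q hq => ?_⟩
  have := Finset.single_le_sum (f := fun q : Square => |q.1| + |q.2|)
    (fun q _ => by positivity) hq
  have h1 := abs_nonneg q.1
  have h2 := abs_nonneg q.2
  omega

end DominoBrick

theorem mainTheorem5 (D : Finset DominoBrick.Square)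
    (hD : IsSimplyConnected (DominoBrick.planeRegion D))
    (t₀ t₁ : DominoBrick.Tiling (DominoBrick.duplex D))
    (htwist : t₀.twist = t₁.twist) :
    ∃ (a b c d : ℤ) (hQ : D ⊆ DominoBrick.rectangle a b c d),
      DominoBrick.FlipConnected (t₀.embedFour hQ) (t₁.embedFour hQ) := by
  open DominoBrick in
  obtain ⟨r, hr0, hr⟩ := exists_bound D
  set F : Finset Square := Finset.Icc (-(r + 1)) (r + 1) ×ˢ Finset.Icc (-(r + 1)) (r + 1) with hFdef
  have hF : ∀ v, v ∈ F ↔ |v.1| ≤ r + 1 ∧ |v.2| ≤ r + 1 := fun v => by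
    rw [hFdef, Finset.mem_product, Finset.mem_Icc, Finset.mem_Icc, abs_le, abs_le]
  have hDF : D ⊆ F := fun q hq => (hF q).2 (by have := hr q hq; omega)
  set size : Tiling (duplex D) → ℤ := fun t => ∑ v ∈ F, |flowHeight D t.next v| with hsize
  have hpos : ∀ t, 0 ≤ size t := fun t => Finset.sum_nonneg fun v _ => abs_nonneg _
  -- The number of rings that arise from a tiling is at most its total absolute height; the sum of
  -- both totals makes one box and one parking lot serve both tilings.
  set N := size t₀ + size t₁ with hN
  have hN0 : 0 ≤ N := add_nonneg (hpos t₀) (hpos t₁)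
  set Y := r + 10 with hY
  -- Each ring takes `6` columns of the lot. The constant `21` is odd so that `X + Y = 2 * r + 31 +
  -- 6 * N` is odd and the ring at `(X, Y)` surrounds a black square.
  set X := r + 21 + 6 * N with hX
  have hmem : ∀ v : Square, v ∈ rectangle (-r - 10) (X + 3) (-r - 10) (Y + 3) ↔
      (-r - 10 ≤ v.1 ∧ v.1 < X + 3) ∧ -r - 10 ≤ v.2 ∧ v.2 < Y + 3 := fun v => by
    rw [rectangle, Finset.mem_product, Finset.mem_Ico, Finset.mem_Ico]
  have hDQ : D ⊆ rectangle (-r - 10) (X + 3) (-r - 10) (Y + 3) := fun q hq => by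
    have := hr q hq
    rw [abs_le, abs_le] at this
    rw [hmem]
    omega
  refine ⟨_, _, _, _, hDQ, flipConnected_of_reach ?_⟩
  set Q := rectangle (-r - 10) (X + 3) (-r - 10) (Y + 3)
  have main : ∀ t : Tiling (duplex D), size t ≤ N →
      Reach (t.embedFour hDQ).dimers.val (hlay 0 Q 0 + hlay (parked X Y t.twist) Q 2) := by
    intro t ht
    rw [t.embedFour_val]
    refine ((t.isFlow_next.reach_hlay hDQ 0).add_right _).trans ?_
    have := reduce_height (X := X) (Y := Y) (r := r) (N := N) (by omega) (by omega) (by omega)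
      (Q := Q) (fun v h1 h2 h3 h4 => (hmem v).2 (by omega)) hF (size t).toNat
      (h := flowHeight D t.next) (n := 0) t.isFlow_next.validAt
      (fun q hq => hr q (by_contra fun hm => hq (t.isFlow_next.flowHeight_eq_zero hD hm)))
      (by rw [Int.toNat_of_nonneg (hpos t)])
      (by rw [Int.toNat_of_nonneg (hpos t)]; simpa using ht)
    rwa [parked_zero, zero_add, t.heightTwist_eq_twist hD hDF] at this
  have h0 := main t₀ (by have := hpos t₁; omega)
  have h1 := main t₁ (by have := hpos t₀; omega)
  rw [htwist] at h0
  exact h0.trans h1.symm
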